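/- **Setting.** Let $E_0,E_1,\dots,E_m$ $(m\ge 1)$ be disjoint nondegenerate continua in the extended plane with $\infty\in E_0$ and $E_1,\dots,E_m$ bounded, let $D=\mathbb C_\infty\setminus\bigcup_{j=0}^m E_j$ be a bounded domain of $\mathbb C$, and suppose that every $\partial E_j$ is a Jordan curve and that $\partial D$ is a regular ($C^1$) arc, with $D$ on one side, near all but finitely many of its points. Let $u_1$ be the solution of the Dirichlet problem on $D$: $u_1$ is harmonic in $D$ and continuous on $\overline D$, with $u_1=0$ on $\partial E_0$ and $u_1=1$ on $\partial E_1,\dots,\partial E_m$. **Cuts.** Let $\gamma_0$ be a path of steepest descent of $u_1$ in $D$, free of critical points, from one of the curves $\partial E_j$, $j\ge1$, to $\partial E_0$. Let $\gamma_1,\dots,\gamma_q$ be simple curves in $D$ such that each joins boundary points of two of the sets $E_1,\dots,E_m$ and consists of two curves of steepest descent of $u_1$ that start at these points and meet at a saddle point (critical point) of $u_1$. The cuts may overlap partially and may contain further critical points, finitely many in number; every critical point of $u_1$ in $D$ lies on some cut. Suppose that the cut domain $\tilde D=D\setminus\bigcup_{k=0}^q\gamma_k$ is simply connected, and that its boundary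 (in the sense of prime ends, so that the two sides of a cut are distinct; positively oriented, and described by a Riemann map of the unit disc onto $\tilde D$ that is continuous on the closed disc) is traversed in the order $$\sigma_0=\gamma_0^+,\ \alpha_1,\ \sigma_1,\ \alpha_2,\ \dots,\ \alpha_N,\ \sigma_N=\gamma_0^-,\ \partial E_0 .$$ Here $\gamma_0^+$ and $\gamma_0^-$ are the two sides of $\gamma_0$, traversed from and to $\partial E_0$ respectively; each $\sigma_n$ with $0<n<N$ is a side of one of the cuts $\gamma_1,\dots,\gamma_q$; each $\alpha_n$ is a segment of some $\partial E_j$, $j\ge 1$; and every $\partial E_j$, $0\le j\le m$, is traversed once. **Modulus and jumps.** Let $\Gamma_0$ be an equipotential curve of $u_1$ in $\tilde D$ from $\gamma_0^+$ to $\gamma_0^-$ (it closes up across $\gamma_0$ to a contour line of $u_1$ that encloses $E_1,\dots,E_m$). For $1\le n\le N$ let $\Gamma_n$ be an equipotential curve of $u_1$ in $\tilde D$ from the side $\sigma_{n-1}$ to the side $\sigma_n$. Put $$ M(D)=d=\int_{\Gamma_0}|\nabla u_1|\,ds,\qquad d_n=\int_{\Gamma_n}|\nabla u_1|\,ds .$$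 **Conjugate problem.** Let $u_2$ solve the conjugate Dirichlet–Neumann problem on $\tilde D$: $u_2$ is harmonic in $\tilde D$ and continuous up to the (two-sided) boundary, $u_2=0$ on $\gamma_0^+$, $u_2=1$ on $\gamma_0^-$, $u_2=\frac1d\sum_{i=1}^n d_i$ on $\sigma_n$ for $0<n<N$; and at all but finitely many points of $\partial E_0,\dots,\partial E_m$ the gradient $\nabla u_2$ extends continuously to the boundary and $\partial u_2/\partial n=0$. **Claim.** Let $\tilde\Gamma$ be any equipotential curve of $u_2$ in $\tilde D$ that runs from $\partial E_0$ to $\partial E_1\cup\dots\cup\partial E_m$, and so separates $\gamma_0^+$ from $\gamma_0^-$, and let $M(\tilde D)=\int_{\tilde\Gamma}|\nabla u_2|\,ds$ be the flux of $\nabla u_2$ from $\gamma_0^+$ to $\gamma_0^-$ across $\tilde\Gamma$. Then $$M(D)\cdot M(\tilde D)=1 .$$ (All curves $\Gamma_n$, $\tilde\Gamma$ are $C^1$ with nonvanishing derivative in their interior.) -/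

import Mathlib

open Set Filter Topology Metric

/-- `n` is the exterior unit normal of `D` at the boundary point `p`, where the boundary is a regular
(continuously differentiable) arc near `p` with `D` on one side of it: near `p`, the set `D` is
`{ρ < 0}` for a `C¹` function `ρ` with `ρ p = 0`, whose gradient at `p` is a positive multiple of `n`. -/
def IsExteriorNormal (D : Set ℂ) (p n : ℂ) : Prop :=
  ‖n‖ = 1 ∧ ∃ ρ : ℂ → ℝ, ∃ r : ℝ, 0 < r ∧ ContDiffAt ℝ 1 ρ p ∧ ρ p = 0 ∧
    gradient ρ p = (r : ℂ) * n ∧ ∀ᶠ z in 𝓝 p, (z ∈ D ↔ ρ z < 0)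

/-- A Jordan curve in the plane, as a set. -/
def IsJordanCurve (J : Set ℂ) : Prop :=
  ∃ c : Circle → ℂ, Continuous c ∧ Function.Injective c ∧ range c = J

/-- `D` is the `(m+1)`-connected domain complementary to the disjoint nondegenerate continua
`E 0, …, E m`, bounded by piecewise regular Jordan curves. The continuum `E 0` of the extended plane
contains `∞`; it is represented by its finite part, a closed connected set with bounded complement. -/
structure IsMultiplyConnectedDomain {m : ℕ} (E : Fin (m + 1) → Set ℂ) (D : Set ℂ) : Prop where
  eq_compl : D = (⋃ j, E j)ᶜ
  isConnected : IsConnected D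
  isClosed : ∀ j, IsClosed (E j)
  continuum : ∀ j, IsConnected (E j)
  nondegenerate : ∀ j, (E j).Nontrivial
  disjoint : Pairwise fun i j => Disjoint (E i) (E j)
  outer : Bornology.IsBounded (E 0)ᶜ
  inner_bounded : ∀ j, j ≠ 0 → Bornology.IsBounded (E j)
  jordan : ∀ j, IsJordanCurve (frontier (E j))
  regular : ∃ S : Set ℂ, S.Finite ∧ ∀ p ∈ frontier D \ S, ∃ n, IsExteriorNormal D p n

/-- `u` is the potential function of `D`: the solution of the Dirichlet problem with boundary
values `0` on `∂E 0` and `1` on `∂E 1, …, ∂E m`. -/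
structure IsPotential {m : ℕ} (E : Fin (m + 1) → Set ℂ) (D : Set ℂ) (u : ℂ → ℝ) : Prop where
  harmonic : InnerProductSpace.HarmonicOnNhd u D
  continuousOn : ContinuousOn u (closure D)
  eq_zero : ∀ p ∈ frontier (E 0), u p = 0
  eq_one : ∀ j, j ≠ 0 → ∀ p ∈ frontier (E j), u p = 1

/-- On `[a, b]`, `c` is a simple curve of steepest descent of `u`, in `D` apart from its end points.
It may run through finitely many critical points of `u`. -/
structure IsSteepestDescent (u : ℂ → ℝ) (D : Set ℂ) (c : ℝ → ℂ) (a b : ℝ) : Prop where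
  continuousOn : ContinuousOn c (Icc a b)
  injOn : InjOn c (Icc a b)
  mem : ∀ t ∈ Ioo a b, c t ∈ D
  descent : ∃ F : Set ℝ, F.Finite ∧ ∀ t ∈ Ioo a b \ F,
    gradient u (c t) ≠ 0 ∧ ∃ r : ℝ, 0 < r ∧ HasDerivAt c (-((r : ℂ) * gradient u (c t))) t

/-- The cuts of `D`. The first cut `γ₀` is a path of steepest descent from an inner boundary curve
to `∂E 0` without critical points. Each further cut `γ k` joins two inner boundary curves through a
saddle point `γ k (τ k)`: it consists of two curves of steepest descent, starting on these boundary
curves and meeting at the saddle point. Every saddle point is on a cut. Cuts may overlap. -/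
structure Cuts {m : ℕ} (E : Fin (m + 1) → Set ℂ) (D : Set ℂ) (u : ℂ → ℝ) where
  γ₀ : ℝ → ℂ
  descent₀ : IsSteepestDescent u D γ₀ 0 1
  regular₀ : ∀ t ∈ Ioo (0 : ℝ) 1, gradient u (γ₀ t) ≠ 0
  start₀ : ∃ j, j ≠ 0 ∧ γ₀ 0 ∈ frontier (E j)
  end₀ : γ₀ 1 ∈ frontier (E 0)
  q : ℕ
  γ : Fin q → ℝ → ℂ
  τ : Fin q → ℝ
  τ_mem : ∀ k, τ k ∈ Ioo (0 : ℝ) 1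
  injOn : ∀ k, InjOn (γ k) (Icc 0 1)
  saddle_mem : ∀ k, γ k (τ k) ∈ D
  saddle : ∀ k, gradient u (γ k (τ k)) = 0
  descent_left : ∀ k, IsSteepestDescent u D (γ k) 0 (τ k)
  descent_right : ∀ k, IsSteepestDescent u D (fun t => γ k (1 - t)) 0 (1 - τ k)
  start : ∀ k, ∃ j, j ≠ 0 ∧ γ k 0 ∈ frontier (E j)
  finish : ∀ k, ∃ j, j ≠ 0 ∧ γ k 1 ∈ frontier (E j)
  all_saddles : ∀ z ∈ D, gradient u z = 0 → ∃ k, z ∈ γ k '' Icc 0 1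

/-- The cut domain, that is, `D` without the cuts. -/
def Cuts.domain {m : ℕ} {E : Fin (m + 1) → Set ℂ} {D : Set ℂ} {u : ℂ → ℝ} (C : Cuts E D u) :
    Set ℂ :=
  D \ (C.γ₀ '' Icc 0 1 ∪ ⋃ k, C.γ k '' Icc 0 1)

/-- On `[a, b]`, `c` runs through the curve `γ : [0, 1] → ℂ` once, from `γ 0` to `γ 1`. -/
def Traverses (c : ℝ → ℂ) (a b : ℝ) (γ : ℝ → ℂ) : Prop :=
  ∃ σ : ℝ → ℝ, ContinuousOn σ (Icc a b) ∧ StrictMonoOn σ (Icc a b) ∧ σ a = 0 ∧ σ b = 1 ∧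
    ∀ θ ∈ Icc a b, c θ = γ (σ θ)

/-- The oriented boundary of the simply connected cut domain. The two sides of a cut are different
parts of this boundary, so it is not a subset of the plane but the circle of prime ends. It is
described by a Riemann map `Φ` of the unit disc onto the cut domain, continuous up to the unit circle:
the boundary is traced by `θ ↦ Φ (exp (i θ))`, with the domain on the left.

The angles are `a 0 < b 0 < a 1 < b 1 < ⋯ < a N < b N < a 0 + 2π`. The interval `[a n, b n]` is the
`n`-th side of a cut; the side `0` is `γ₀⁺`, run through from `∂E 0` inwards, and the side `N` is
`γ₀⁻`, run through back to `∂E 0`. The interval from `b n` to `a (n+1)` is a segment of the inner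
boundary curve `∂E (j n)`, and the one from `b N` to `a 0 + 2π` runs through `∂E 0`. -/
structure OrientedBoundary {m : ℕ} {E : Fin (m + 1) → Set ℂ} {D : Set ℂ} {u : ℂ → ℝ}
    (C : Cuts E D u) where
  Φ : ℂ → ℂ
  holomorphic : DifferentiableOn ℂ Φ (ball 0 1)
  injOn : InjOn Φ (ball 0 1)
  image : Φ '' ball 0 1 = C.domain
  continuousOn : ContinuousOn Φ (closedBall 0 1)
  N : ℕ
  a : Fin (N + 1) → ℝ
  b : Fin (N + 1) → ℝ
  j : Fin N → Fin (m + 1)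
  a_lt_b : ∀ n, a n < b n
  b_lt_a : ∀ n : Fin N, b n.castSucc < a n.succ
  b_last : b (Fin.last N) < a 0 + 2 * Real.pi
  side_first : Traverses (fun θ => Φ (circleMap 0 1 θ)) (a 0) (b 0) (fun t => C.γ₀ (1 - t))
  side_last : Traverses (fun θ => Φ (circleMap 0 1 θ)) (a (Fin.last N)) (b (Fin.last N)) C.γ₀
  side : ∀ n, n ≠ 0 → n ≠ Fin.last N → ∃ k,
    Traverses (fun θ => Φ (circleMap 0 1 θ)) (a n) (b n) (C.γ k) ∨
    Traverses (fun θ => Φ (circleMap 0 1 θ)) (a n) (b n) (fun t => C.γ k (1 - t))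
  inner_ne : ∀ n, j n ≠ 0
  inner : ∀ n : Fin N, ∀ θ ∈ Icc (b n.castSucc) (a n.succ), Φ (circleMap 0 1 θ) ∈ frontier (E (j n))
  outer : ∀ θ ∈ Icc (b (Fin.last N)) (a 0 + 2 * Real.pi), Φ (circleMap 0 1 θ) ∈ frontier (E 0)
  once : InjOn (fun θ => Φ (circleMap 0 1 θ))
    ((⋃ n : Fin N, Ioo (b n.castSucc) (a n.succ)) ∪ Ioo (b (Fin.last N)) (a 0 + 2 * Real.pi))

/-- `Γ` is a regular curve in `G`, parametrized by `(0, 1)`, on which `u` is constant. -/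
structure IsEquipotential (u : ℂ → ℝ) (G : Set ℂ) (Γ : ℝ → ℂ) : Prop where
  mem : ∀ t ∈ Ioo (0 : ℝ) 1, Γ t ∈ G
  contDiffOn : ContDiffOn ℝ 1 Γ (Ioo 0 1)
  deriv_ne_zero : ∀ t ∈ Ioo (0 : ℝ) 1, deriv Γ t ≠ 0
  const : ∃ c : ℝ, ∀ t ∈ Ioo (0 : ℝ) 1, u (Γ t) = c

/-- The integral `∫_Γ |∇u| ds`. -/
noncomputable def gradIntegral (u : ℂ → ℝ) (Γ : ℝ → ℂ) : ℝ :=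
  ∫ t in (0 : ℝ)..1, ‖gradient u (Γ t)‖ * ‖deriv Γ t‖

/-- `Γ` is an equipotential curve of `u` in the cut domain from the side `n` to the side `n'`: it is
the image of a curve `g` in the disc that ends on the two circular arcs belonging to these sides. -/
def OrientedBoundary.Joins {m : ℕ} {E : Fin (m + 1) → Set ℂ} {D : Set ℂ} {u : ℂ → ℝ} {C : Cuts E D u}
    (B : OrientedBoundary C) (n n' : Fin (B.N + 1)) (Γ : ℝ → ℂ) : Prop :=
  IsEquipotential u C.domain Γ ∧
  ∃ g : ℝ → ℂ, ContinuousOn g (Icc 0 1) ∧ (∀ t ∈ Ioo (0 : ℝ) 1, g t ∈ ball (0 : ℂ) 1) ∧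
    (∀ t ∈ Icc (0 : ℝ) 1, Γ t = B.Φ (g t)) ∧
    (∃ θ ∈ Ioo (B.a n) (B.b n), g 0 = circleMap 0 1 θ) ∧
    (∃ θ ∈ Ioo (B.a n') (B.b n'), g 1 = circleMap 0 1 θ)

/-- `u₂` solves the conjugate Dirichlet–Neumann problem on the cut domain. Here `d` is the modulus of
`D`, and `jump i` is the jump between the sides `i` and `i + 1`. The function `u₂` is harmonic, it
is continuous up to the oriented boundary, where it takes the value `0` on `γ₀⁺`, the value `1` on
`γ₀⁻` and on each other side the cumulative sum of the jumps divided by `d`; and, at all but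
finitely many points of the curves `∂E j`, it is continuously differentiable up to the boundary with
vanishing normal derivative. -/
structure IsConjugateSolution {m : ℕ} {E : Fin (m + 1) → Set ℂ} {D : Set ℂ} {u : ℂ → ℝ}
    {C : Cuts E D u} (B : OrientedBoundary C) (d : ℝ) (jump : Fin B.N → ℝ) (u₂ : ℂ → ℝ) : Prop where
  harmonic : InnerProductSpace.HarmonicOnNhd u₂ C.domain
  dirichlet : ∃ U : ℂ → ℝ, ContinuousOn U (closedBall 0 1) ∧
    (∀ ζ ∈ ball (0 : ℂ) 1, U ζ = u₂ (B.Φ ζ)) ∧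
    (∀ θ ∈ Icc (B.a 0) (B.b 0), U (circleMap 0 1 θ) = 0) ∧
    (∀ θ ∈ Icc (B.a (Fin.last B.N)) (B.b (Fin.last B.N)), U (circleMap 0 1 θ) = 1) ∧
    (∀ n, n ≠ 0 → n ≠ Fin.last B.N → ∀ θ ∈ Icc (B.a n) (B.b n),
      U (circleMap 0 1 θ) = (∑ i : Fin B.N with i.castSucc < n, jump i) / d)
  neumann : ∃ T : Set ℂ, T.Finite ∧ ∀ p ∈ frontier D \ T, ∀ n, IsExteriorNormal D p n →
    ∃ G : ℂ, Tendsto (gradient u₂) (𝓝[C.domain] p) (𝓝 G) ∧ inner ℝ G n = 0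

/-- `η` is an equipotential curve of `u₂` in the cut domain that crosses it from `∂E 0` to an inner
boundary curve, and so separates `γ₀⁺` from `γ₀⁻`. -/
def Cuts.IsCrossing {m : ℕ} {E : Fin (m + 1) → Set ℂ} {D : Set ℂ} {u : ℂ → ℝ} (C : Cuts E D u)
    (u₂ : ℂ → ℝ) (η : ℝ → ℂ) : Prop :=
  IsEquipotential u₂ C.domain η ∧
  (∃ p ∈ frontier (E 0), Tendsto η (𝓝[>] 0) (𝓝 p)) ∧
  (∃ j, j ≠ 0 ∧ ∃ p ∈ frontier (E j), Tendsto η (𝓝[<] 1) (𝓝 p))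

/-!
The function `u₂` is, up to an affine change, the harmonic conjugate of `u₁`. On the simply connected
cut domain, `u₁ = Re F`; put `v = Im F`. The cuts consist of gradient lines of `u₁`, so `v` is constant
on each side `σ n`, with value `κ n`, and along a level line of `u₁` the integral of `|∇u₁| = |∇v|` is
the increment of `v`. Hence `d = κ N - κ 0` and `d_n = κ n - κ (n-1)`, and `(v - κ 0) / d` has the boundary
values prescribed for `u₂` on all sides. On the curves `∂E j` the function `u₁` is constant, which is
the Neumann condition for `v`. If the mixed problem has only one solution, then
`u₂ = (v - κ 0) / d`; a level line `η` of `u₂` is a level line of `v`, so that `∫_η |∇u₂|` is `1 / d` times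
the increment of `u₁` along `η`, which is `1`.

Everything is transferred to the unit disc by the map `B.Φ`, and to the upper half-plane by
`expI z = exp (I z)`, which sends the real line to the unit circle.

* *Boundary values of `v`.* A holomorphic function in the half-plane whose imaginary part tends to zero
  along an interval extends continuously to it (`exists_tendsto_of_im_tendsto_zero`, using the
  reflection principle). This covers the sides and the boundary curves. At the corner between a
  boundary curve, where the real part is constant, and a side, where the imaginary part is constant,
  a square root substitution opens the angle so that the two reflections become one
  (`exists_tendsto_of_re_left_of_im_right`); only the real part is known to be bounded there, and
  that suffices to remove the singularity.
* *The signs of the jumps.* On the inner curves `u₁` has its maximum `1`, so by the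
  Cauchy–Riemann equations `v` is nondecreasing there in the direction of the boundary, and all
  differences `κ n - κ (n-1)` are nonnegative (`exists_hasDerivAt_nonneg_of_re_max`).
* *Uniqueness.* The gradient of `u₂` extends continuously to most points of the `∂E j`, where its
  normal component vanishes. Near such a point the harmonic conjugate of `u₂` extends continuously
  to the boundary with locally constant boundary values
  (`exists_continuous_im_eq_of_normal_deriv_eq_zero`); finitely many exceptional points are removed by
  boundedness (`locally_const_of_finite_exceptions`). The difference `W` of two solutions is thus zero
  on the sides, while on the remaining arcs its conjugate is constant; a maximum of `W` on such an arc
  can be reflected to an interior maximum, so `W` vanishes (`eq_zero_of_mixed_boundary`).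
-/

open scoped ComplexConjugate

/-! ### Maximum principle -/

/-- An abstract maximum principle: a continuous function on a connected compact set is bounded by `C`
if, wherever it exceeds `C`, it cannot attain its maximum without being locally constant. -/
theorem IsCompact.le_of_locally_const_at_max {X : Type*} [TopologicalSpace X] {K : Set X}
    (hK : IsCompact K) (hc : IsPreconnected K) {W : X → ℝ} (hW : ContinuousOn W K) {C : ℝ}
    (hne : ∃ z ∈ K, W z ≤ C)
    (h : ∀ z ∈ K, W z ≤ C ∨ (IsMaxOn W K z → ∀ᶠ y in 𝓝[K] z, W y = W z)) :
    ∀ z ∈ K, W z ≤ C := by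
  obtain ⟨z₀, hz₀, hz₀C⟩ := hne
  obtain ⟨m, hm, hmax⟩ := hK.exists_isMaxOn ⟨z₀, hz₀⟩ hW
  suffices hmC : W m ≤ C from fun z hz => (hmax hz).trans hmC
  by_contra! hlt
  -- The set of maximum points is open and closed in `K`.
  have key : ∀ z ∈ K, W z = W m → ∀ᶠ y in 𝓝[K] z, W y = W m := by
    intro z hz hzm
    rcases h z hz with h1 | h1
    · rw [hzm] at h1; exact absurd h1 (not_le.2 hlt)
    · rw [← hzm]
      exact h1 fun y hy => by
        have : W y ≤ W m := hmax hy
        simpa [hzm] using this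
  have hconst : ∀ z ∈ K, W z = W m := by
    have : PreconnectedSpace K := isPreconnected_iff_preconnectedSpace.1 hc
    let A : Set K := {z | W z = W m}
    have hWr : Continuous (fun z : K => W z) := continuousOn_iff_continuous_domRestrict.1 hW
    have hA : IsClopen A := by
      refine ⟨isClosed_eq hWr continuous_const, isOpen_iff_mem_nhds.2 fun z hz => ?_⟩
      have := key z z.2 hz
      rw [← map_nhds_subtype_val z] at this
      exact this
    have : A = univ := hA.eq_univ ⟨⟨m, hm⟩, rfl⟩
    intro z hz
    have : (⟨z, hz⟩ : K) ∈ A := this ▸ mem_univ _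
    exact this
  rw [← hconst z₀ hz₀] at hlt
  exact absurd hz₀C (not_le.2 hlt)

theorem Complex.re_eventually_eq_of_isLocalMax {f : ℂ → ℂ} {c : ℂ} (hf : AnalyticAt ℂ f c)
    (hc : ∀ᶠ z in 𝓝 c, (f z).re ≤ (f c).re) : ∀ᶠ z in 𝓝 c, (f z).re = (f c).re := by
  have h1 : ∀ᶠ z in 𝓝 c, DifferentiableAt ℂ (fun z => Complex.exp (f z)) z :=
    hf.eventually_analyticAt.mono fun z hz => hz.differentiableAt.cexp
  have h2 : IsLocalMax (norm ∘ fun z => Complex.exp (f z)) c := by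
    filter_upwards [hc] with z hz
    simpa [Complex.norm_exp] using hz
  filter_upwards [Complex.norm_eventually_eq_of_isLocalMax h1 h2] with z hz
  simpa [Complex.norm_exp] using hz

theorem Complex.im_eventually_eq_of_isLocalMax {f : ℂ → ℂ} {c : ℂ} (hf : AnalyticAt ℂ f c)
    (hc : ∀ᶠ z in 𝓝 c, (f z).im ≤ (f c).im) : ∀ᶠ z in 𝓝 c, (f z).im = (f c).im := by
  have := Complex.re_eventually_eq_of_isLocalMax (f := fun z => -Complex.I * f z)
    (analyticAt_const.mul hf) (by simpa using hc)
  simpa using this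

/-! ### Boundary values in the upper half-plane -/

/-- The open upper half-plane. -/
def UHP : Set ℂ := {z | 0 < z.im}

theorem isOpen_UHP : IsOpen UHP := isOpen_lt continuous_const Complex.continuous_im

theorem mem_UHP {z : ℂ} : z ∈ UHP ↔ 0 < z.im := Iff.rfl

theorem convex_UHP : Convex ℝ UHP := convex_halfSpace_im_gt 0

theorem mem_closure_UHP {z : ℂ} (hz : 0 ≤ z.im) : z ∈ closure UHP := by
  have : closure UHP = {z : ℂ | 0 ≤ z.im} := Complex.closure_setOfPred_lt_im 0
  rw [this]; exact hz

instance nhdsWithin_UHP_neBot (x : ℝ) : (𝓝[UHP] (x : ℂ)).NeBot :=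
  mem_closure_iff_nhdsWithin_neBot.1 (mem_closure_UHP (by simp))

/-- A barrier estimate: a holomorphic function on a half-disc whose imaginary part is at most `M` and
tends to `0` at the diameter has imaginary part `O(y)` on the axis of the half-disc. -/
theorem im_le_of_tendsto_zero {f : ℂ → ℂ} {x R M : ℝ} (hR : 0 < R) (hM : 0 ≤ M)
    (hf : DifferentiableOn ℂ f (UHP ∩ ball (x : ℂ) R))
    (h0 : ∀ t : ℝ, (t : ℂ) ∈ ball (x : ℂ) R → Tendsto (fun z => (f z).im) (𝓝[UHP] (t : ℂ)) (𝓝 0))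
    (hb : ∀ z ∈ UHP ∩ ball (x : ℂ) R, (f z).im ≤ M) {y : ℝ} (hy : 0 < y) (hyR : y ≤ R / 2) :
    (f (x + y * Complex.I)).im ≤ 4 * M * y / R := by
  classical
  set r := R / 2 with hr
  have hr0 : 0 < r := by positivity
  -- The barrier is `M * (2 Y + X ^ 2 - Y ^ 2)` in the coordinates `X + i Y = (z - x) / r`: it is at least
  -- `0` on the diameter and at least `M` on the half-circle, where `X ^ 2 + Y ^ 2 = 1`.
  let P : ℂ → ℂ := fun z => M * (2 * ((z - x) / r) + Complex.I * ((z - x) / r) ^ 2)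
  have hPd : Differentiable ℂ P := by fun_prop
  have hPim : ∀ z : ℂ, (P z).im = M * (2 * (z.im / r) + (((z.re - x) / r) ^ 2 - (z.im / r) ^ 2)) := by
    intro z
    have h1 : ((z - x) / r).im = z.im / r := by simp
    have h2 : ((z - x) / r).re = (z.re - x) / r := by simp
    simp only [P, Complex.mul_im, Complex.add_im, Complex.ofReal_re, Complex.ofReal_im,
      Complex.I_re, Complex.I_im, sq, Complex.mul_re, h1, h2, Complex.re_ofNat, Complex.im_ofNat]
    ring
  let u : ℂ → ℝ := fun z => if 0 < z.im then (f z).im else 0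
  let W : ℂ → ℝ := fun z => u z - (P z).im
  set K : Set ℂ := closedBall (x : ℂ) r ∩ {z | 0 ≤ z.im} with hKdef
  have hKc : IsCompact K :=
    (isCompact_closedBall _ _).inter_right (isClosed_le continuous_const Complex.continuous_im)
  have hKconv : Convex ℝ K := (convex_closedBall _ _).inter (convex_halfSpace_im_ge 0)
  have hsub : closedBall (x : ℂ) r ⊆ ball (x : ℂ) R := closedBall_subset_ball (by linarith)
  have hu_im : ∀ z ∈ UHP, u =ᶠ[𝓝 z] fun z => (f z).im := fun z hz => by
    filter_upwards [isOpen_UHP.mem_nhds hz] with w hw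
    exact if_pos hw
  have hopen : IsOpen (UHP ∩ ball (x : ℂ) R) := isOpen_UHP.inter isOpen_ball
  have huc : ContinuousOn u K := by
    intro z hz
    rcases (show (0 : ℝ) ≤ z.im from hz.2).lt_or_eq with him | him
    · have hd := hf.differentiableAt (hopen.mem_nhds ⟨him, hsub hz.1⟩)
      exact ((Complex.continuous_im.continuousAt.comp hd.continuousAt).congr
        (hu_im z him).symm).continuousWithinAt
    · have hz' : z = (z.re : ℂ) := Complex.ext (by simp) (by simp [← him])
      have h1 := h0 z.re (hz' ▸ hsub hz.1)
      rw [← hz'] at h1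
      have hu0 : u z = 0 := if_neg (by simp [← him])
      have : Tendsto u (𝓝 z) (𝓝 (u z)) := by
        rw [hu0]
        exact Tendsto.if h1 tendsto_const_nhds
      exact this.mono_left nhdsWithin_le_nhds
  have hW : ContinuousOn W K :=
    huc.sub (Complex.continuous_im.comp hPd.continuous).continuousOn
  have hreal : ∀ z ∈ K, z.im = 0 → W z ≤ 0 := by
    intro z _ him
    have : u z = 0 := if_neg (by simp [him])
    simp only [W, this, hPim, him]
    have : 0 ≤ M * (((z.re - x) / r) ^ 2) := by positivity
    simp only [zero_div]; nlinarith
  have hmain : ∀ z ∈ K, W z ≤ 0 := by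
    refine hKc.le_of_locally_const_at_max hKconv.isPreconnected hW
      ⟨x, ⟨by simp [hr0.le], by simp⟩, hreal _ ⟨by simp [hr0.le], by simp⟩ (by simp)⟩ ?_
    intro z hz
    rcases (show (0 : ℝ) ≤ z.im from hz.2).lt_or_eq with him | him
    · rcases (mem_closedBall.1 hz.1).lt_or_eq with hlt | heq
      · right
        intro hmax
        have hKn : K ∈ 𝓝 z := by
          filter_upwards [isOpen_UHP.mem_nhds him, isOpen_ball.mem_nhds hlt] with w hw hw'
          exact ⟨ball_subset_closedBall hw', (mem_UHP.1 hw).le⟩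
        have han : AnalyticAt ℂ (fun w => f w - P w) z :=
          (hf.analyticAt (hopen.mem_nhds ⟨him, hsub hz.1⟩)).sub (hPd.analyticAt z)
        have hWe : ∀ᶠ w in 𝓝 z, W w = (f w - P w).im := by
          filter_upwards [hu_im z him] with w hw
          simp [W, hw]
        have hWz := hWe.self_of_nhds
        have := Complex.im_eventually_eq_of_isLocalMax han (by
          filter_upwards [hWe, hKn] with w hw hwK
          rw [← hw, ← hWz]; exact hmax hwK)
        apply nhdsWithin_le_nhds
        filter_upwards [hWe, this] with w hw hw'
        rw [hw, hw', hWz]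
      · left
        have h1 : u z ≤ M := by
          simp only [u, if_pos him]; exact hb z ⟨him, hsub hz.1⟩
        have h2 : ((z.re - x) / r) ^ 2 + (z.im / r) ^ 2 = 1 := by
          have : ‖z - x‖ ^ 2 = r ^ 2 := by rw [← dist_eq_norm, heq]
          rw [Complex.sq_norm, Complex.normSq_apply] at this
          simp at this
          field_simp; nlinarith
        have h3 : 0 ≤ z.im / r := by positivity
        have h4 : z.im / r ≤ 1 := by nlinarith [sq_nonneg ((z.re - x) / r)]
        simp only [W, hPim]
        have : (1 : ℝ) ≤ 2 * (z.im / r) + (((z.re - x) / r) ^ 2 - (z.im / r) ^ 2) := by nlinarith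
        nlinarith
    · exact Or.inl (hreal z hz him.symm)
  have hzK : (x + y * Complex.I : ℂ) ∈ K := by
    refine ⟨?_, by simp [hy.le]⟩
    simp [dist_eq_norm, abs_of_pos hy, hyR]
  have := hmain _ hzK
  have hup : (0 : ℝ) < (x + y * Complex.I : ℂ).im := by simpa using hy
  simp only [W, u, if_pos hup, hPim] at this
  simp only [Complex.add_im, Complex.ofReal_im, Complex.mul_im, Complex.ofReal_re, Complex.I_im,
    Complex.I_re, Complex.add_re, Complex.mul_re] at this ⊢
  have h5 : 4 * M * y / R = M * (2 * (y / r)) := by rw [hr]; field_simp; ring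
  rw [h5]
  have : 0 ≤ M * (y / r) ^ 2 := by positivity
  ring_nf at *
  linarith

/-- A gradient estimate for a holomorphic function in terms of its imaginary part, by the
Borel-Carathéodory inequality. -/
theorem norm_deriv_le_of_abs_im_le {f : ℂ → ℂ} {z : ℂ} {s M : ℝ} (hs : 0 < s) (hM : 0 < M)
    (hf : DifferentiableOn ℂ f (ball z s)) (h : ∀ w ∈ ball z s, |(f w).im| ≤ M) :
    ‖deriv f z‖ ≤ 8 * M / s := by
  let g : ℂ → ℂ := fun w => -Complex.I * (f (z + w) - f z)
  have hmaps : ∀ w ∈ ball (0 : ℂ) s, z + w ∈ ball z s := fun w hw => by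
    simpa [dist_eq_norm] using hw
  have hg : DifferentiableOn ℂ g (ball 0 s) := by
    refine (differentiableOn_const _).mul (DifferentiableOn.sub ?_ (differentiableOn_const _))
    exact hf.comp (by fun_prop) hmaps
  have hz := abs_le.1 (h z (mem_ball_self hs))
  have hgre : MapsTo g (ball 0 s) {z | z.re ≤ 2 * M} := fun w hw => by
    have := abs_le.1 (h _ (hmaps w hw))
    simp only [g, mem_ofPred_eq]
    simp
    linarith
  have hb : ∀ w ∈ sphere z (s / 2), ‖(fun w => f w - f z) w‖ ≤ 4 * M := fun w hw => by
    have hw' : ‖w - z‖ = s / 2 := by rw [← dist_eq_norm]; exact hw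
    have := Complex.borelCaratheodory_zero (z := w - z) (by positivity) hg hgre hs
      (by rw [mem_ball_zero_iff, hw']; linarith) (by simp [g])
    rw [hw'] at this
    simp only [g, add_sub_cancel, norm_mul, norm_neg, Complex.norm_I, one_mul] at this
    refine this.trans (le_of_eq ?_)
    field_simp; ring
  have hd : DiffContOnCl ℂ (fun w => f w - f z) (ball z (s / 2)) :=
    (hf.sub_const _).diffContOnCl_ball (closedBall_subset_ball (by linarith))
  have := Complex.norm_deriv_le_of_forall_mem_sphere_norm_le (by positivity) hd hb
  rw [deriv_sub_const] at this
  refine this.trans (le_of_eq ?_)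
  field_simp; ring

/-- If the imaginary part of a holomorphic function tends to `0` at the real axis, then it is so small
near the axis that the derivative stays bounded; hence the function has boundary values. -/
theorem exists_tendsto_of_im_tendsto_zero {f : ℂ → ℂ} {Ω : Set ℂ} {x : ℝ} (hΩ : Ω ∈ 𝓝 (x : ℂ))
    (hf : DifferentiableOn ℂ f (UHP ∩ Ω))
    (h0 : ∀ t : ℝ, (t : ℂ) ∈ Ω → Tendsto (fun z => (f z).im) (𝓝[UHP] (t : ℂ)) (𝓝 0)) :
    ∃ ℓ, Tendsto f (𝓝[UHP] (x : ℂ)) (𝓝 ℓ) := by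
  have hx : (x : ℂ) ∈ Ω := mem_of_mem_nhds hΩ
  have h1 : ∀ᶠ z in 𝓝 (x : ℂ), z ∈ UHP → |(f z).im| ≤ 1 := by
    rw [← eventually_nhdsWithin_iff]
    have := (h0 x hx).abs
    rw [abs_zero] at this
    exact (this.eventually_lt_const one_pos).mono fun z hz => hz.le
  obtain ⟨R, hR, hRsub⟩ := Metric.eventually_nhds_iff_ball.1 (h1.and hΩ)
  -- By the barrier estimate `Im f` is `O(Im z)` on the ball of radius `Im z` about `z`.
  have hder : ∀ z ∈ UHP ∩ ball (x : ℂ) (R / 8), ‖deriv f z‖ ≤ 128 / R := by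
    rintro z ⟨hz, hzx⟩
    have hs : 0 < z.im := hz
    have hzx' : ‖z - x‖ < R / 8 := by rw [← dist_eq_norm]; exact hzx
    have hsR : z.im < R / 8 := by
      have := (abs_le.1 (Complex.abs_im_le_norm (z - x))).2
      simp at this; linarith
    have hball : ∀ w ∈ ball z z.im, 0 < w.im ∧ w.im < 2 * z.im ∧ ‖w - x‖ < R / 4 := by
      intro w hw
      rw [mem_ball, dist_eq_norm] at hw
      have h2 := abs_le.1 (Complex.abs_im_le_norm (w - z))
      rw [Complex.sub_im] at h2
      refine ⟨by linarith, by linarith, ?_⟩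
      calc ‖w - x‖ ≤ ‖w - z‖ + ‖z - x‖ := by simpa using norm_add_le (w - z) (z - x)
        _ < R / 4 := by linarith
    have him : ∀ w ∈ ball z z.im, |(f w).im| ≤ 16 * z.im / R := by
      intro w hw
      obtain ⟨hw1, hw2, hw3⟩ := hball w hw
      have hre : |w.re - x| < R / 4 := by
        have := Complex.abs_re_le_norm (w - x)
        simp at this; linarith
      have hsub : ball ((w.re : ℝ) : ℂ) (R / 2) ⊆ ball (x : ℂ) R := by
        refine ball_subset_ball' ?_
        rw [dist_eq_norm, ← Complex.ofReal_sub, Complex.norm_real, Real.norm_eq_abs]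
        linarith
      have hd : DifferentiableOn ℂ f (UHP ∩ ball ((w.re : ℝ) : ℂ) (R / 2)) :=
        hf.mono fun v hv => ⟨hv.1, (hRsub v (hsub hv.2)).2⟩
      have hw4 : w.im ≤ R / 2 / 2 := by linarith
      have e1 := im_le_of_tendsto_zero (by positivity) zero_le_one hd
        (fun t ht => h0 t (hRsub _ (hsub ht)).2)
        (fun v hv => (abs_le.1 ((hRsub v (hsub hv.2)).1 hv.1)).2) hw1 hw4
      have e2 := im_le_of_tendsto_zero (f := fun z => -f z) (by positivity) zero_le_one hd.fun_neg
        (fun t ht => by simpa using (h0 t (hRsub _ (hsub ht)).2).neg)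
        (fun v hv => by
          have := (abs_le.1 ((hRsub v (hsub hv.2)).1 hv.1)).1
          simp; linarith) hw1 hw4
      have hww : ((w.re : ℝ) : ℂ) + (w.im : ℝ) * Complex.I = w := Complex.re_add_im w
      rw [hww] at e1 e2
      have e3 : 4 * 1 * w.im / (R / 2) ≤ 16 * z.im / R := by
        rw [div_le_div_iff₀ (by positivity) hR]; nlinarith
      rw [Complex.neg_im] at e2
      exact abs_le.2 ⟨by linarith, by linarith⟩
    have hd : DifferentiableOn ℂ f (ball z z.im) := hf.mono fun w hw => by
      obtain ⟨hw1, hw2, hw3⟩ := hball w hw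
      exact ⟨hw1, (hRsub w (by rw [mem_ball, dist_eq_norm]; linarith)).2⟩
    refine (norm_deriv_le_of_abs_im_le hs (by positivity) hd him).trans (le_of_eq ?_)
    field_simp; ring
  have hopen : IsOpen (UHP ∩ ball (x : ℂ) (R / 8)) := isOpen_UHP.inter isOpen_ball
  have hconv : Convex ℝ (UHP ∩ ball (x : ℂ) (R / 8)) := convex_UHP.inter (convex_ball _ _)
  have hlip : LipschitzOnWith (Real.toNNReal (128 / R)) f (UHP ∩ ball (x : ℂ) (R / 8)) := by
    refine hconv.lipschitzOnWith_of_nnnorm_deriv_le (𝕜 := ℂ) (fun z hz => ?_) fun z hz => ?_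
    · refine (hf.mono fun w hw => ⟨hw.1, ?_⟩).differentiableAt (hopen.mem_nhds hz)
      exact (hRsub w (ball_subset_ball (by linarith) hw.2)).2
    · rw [← NNReal.coe_le_coe, coe_nnnorm, Real.coe_toNNReal _ (by positivity)]
      exact hder z hz
  have hcau : Cauchy (map f (𝓝[UHP] (x : ℂ))) := by
    refine Cauchy.map_of_le (s := UHP ∩ ball (x : ℂ) (R / 8)) ?_ hlip.uniformContinuousOn ?_
    · exact cauchy_nhds.mono nhdsWithin_le_nhds
    · exact le_principal_iff.2 (inter_mem_nhdsWithin _ (ball_mem_nhds _ (by positivity)))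
  exact CompleteSpace.complete hcau

/-- A continuous function that is holomorphic off the real axis is holomorphic. -/
theorem differentiableOn_of_continuousOn_off_real {Ω : Set ℂ} (hΩ : IsOpen Ω) {g : ℂ → ℂ}
    (hc : ContinuousOn g Ω) (hd : ∀ z ∈ Ω, z.im ≠ 0 → DifferentiableAt ℂ g z) :
    DifferentiableOn ℂ g Ω := by
  refine (Complex.isConservativeOn_and_continuousOn_iff_isDifferentiableOn hΩ).1 ⟨?_, hc⟩
  intro z w hzw
  rw [← add_eq_zero_iff_eq_neg, Complex.wedgeIntegral_add_wedgeIntegral_eq]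
  rw [Complex.Rectangle] at hzw
  -- A rectangle whose interior avoids the real axis.
  have off : ∀ z w : ℂ, uIcc z.re w.re ×ℂ uIcc z.im w.im ⊆ Ω →
      (0 : ℝ) ∉ Ioo (min z.im w.im) (max z.im w.im) →
      (∫ x : ℝ in z.re..w.re, g (x + z.im * Complex.I)) -
        (∫ x : ℝ in z.re..w.re, g (x + w.im * Complex.I)) +
      Complex.I • (∫ y : ℝ in z.im..w.im, g (w.re + y * Complex.I)) -
      Complex.I • (∫ y : ℝ in z.im..w.im, g (z.re + y * Complex.I)) = 0 := by
    intro z w hsub h0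
    refine Complex.integral_boundary_rect_eq_zero_of_continuousOn_of_differentiableOn g z w
      (hc.mono hsub) fun v hv => ?_
    refine (hd v (hsub ⟨Ioo_subset_Icc_self hv.1, Ioo_subset_Icc_self hv.2⟩)
      fun h => h0 ?_).differentiableWithinAt
    rw [← h]; exact hv.2
  by_cases h0 : (0 : ℝ) ∈ Ioo (min z.im w.im) (max z.im w.im)
  · have hmem : (0 : ℝ) ∈ uIcc z.im w.im := Ioo_subset_Icc_self h0
    have hs1 : uIcc z.im (0 : ℝ) ⊆ uIcc z.im w.im := uIcc_subset_uIcc_left hmem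
    have hs2 : uIcc (0 : ℝ) w.im ⊆ uIcc z.im w.im := uIcc_subset_uIcc_right hmem
    have e1 := off z ⟨w.re, 0⟩ (fun v hv => hzw ⟨hv.1, hs1 hv.2⟩) (by
      rintro ⟨h, h'⟩
      rcases le_total z.im 0 with h2 | h2
      · simp [h2] at h'
      · simp [h2] at h)
    have e2 := off ⟨z.re, 0⟩ w (fun v hv => hzw ⟨hv.1, hs2 hv.2⟩) (by
      rintro ⟨h, h'⟩
      rcases le_total w.im 0 with h2 | h2
      · simp [h2] at h'
      · simp [h2] at h)
    have hvert : ∀ a ∈ uIcc z.re w.re, ∀ b₁ b₂ : ℝ, uIcc b₁ b₂ ⊆ uIcc z.im w.im →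
        IntervalIntegrable (fun y : ℝ => g (a + y * Complex.I)) MeasureTheory.volume b₁ b₂ := by
      intro a ha b₁ b₂ hb
      refine ContinuousOn.intervalIntegrable (hc.comp (by fun_prop) fun y hy => hzw ⟨?_, ?_⟩)
      · simpa using ha
      · simpa using hb hy
    have e3 := intervalIntegral.integral_add_adjacent_intervals
      (hvert w.re right_mem_uIcc z.im 0 hs1) (hvert w.re right_mem_uIcc 0 w.im hs2)
    have e4 := intervalIntegral.integral_add_adjacent_intervals
      (hvert z.re left_mem_uIcc z.im 0 hs1) (hvert z.re left_mem_uIcc 0 w.im hs2)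
    rw [← e3, ← e4, smul_add, smul_add]
    dsimp only at e1 e2
    linear_combination e1 + e2
  · exact off z w hzw h0

/-- **Schwarz reflection principle** on an open set `Ω` that is symmetric about the real axis. Only the
imaginary part is assumed to have boundary values. The last conclusion transfers to the extension all
closed conditions on the values of `f` that are invariant under conjugation. -/
theorem exists_reflection {Ω : Set ℂ} (hΩ : IsOpen Ω) (hsymm : ∀ z ∈ Ω, conj z ∈ Ω) {f : ℂ → ℂ}
    (hf : DifferentiableOn ℂ f (UHP ∩ Ω))
    (h0 : ∀ t : ℝ, (t : ℂ) ∈ Ω → Tendsto (fun z => (f z).im) (𝓝[UHP] (t : ℂ)) (𝓝 0)) :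
    ∃ g : ℂ → ℂ, DifferentiableOn ℂ g Ω ∧ EqOn g f (UHP ∩ Ω) ∧ (∀ z ∈ Ω, g (conj z) = conj (g z)) ∧
      ∀ S : Set ℂ, IsClosed S → (∀ w ∈ S, conj w ∈ S) → MapsTo f (UHP ∩ Ω) S → MapsTo g Ω S := by
  classical
  have hopen : IsOpen (UHP ∩ Ω) := isOpen_UHP.inter hΩ
  have hlim : ∀ t : ℝ, (t : ℂ) ∈ Ω → ∃ ℓ, Tendsto f (𝓝[UHP] (t : ℂ)) (𝓝 ℓ) := fun t ht =>
    exists_tendsto_of_im_tendsto_zero (hΩ.mem_nhds ht) hf h0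
  have hlim' : ∀ z ∈ closure UHP ∩ Ω, ∃ ℓ, Tendsto f (𝓝[UHP] z) (𝓝 ℓ) := by
    rintro z ⟨hz, hzΩ⟩
    have hz0 : 0 ≤ z.im := by
      have : closure UHP = {z : ℂ | 0 ≤ z.im} := Complex.closure_setOfPred_lt_im 0
      rw [this] at hz; exact hz
    rcases hz0.lt_or_eq with h | h
    · exact ⟨f z, (hf.differentiableAt (hopen.mem_nhds ⟨h, hzΩ⟩)).continuousAt.tendsto.mono_left
        nhdsWithin_le_nhds⟩
    · have hz' : z = (z.re : ℂ) := Complex.ext (by simp) (by simp [← h])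
      rw [hz'] at hzΩ ⊢
      exact hlim _ hzΩ
  let F := extendFrom UHP f
  have hFc : ContinuousOn F (closure UHP ∩ Ω) := by
    refine continuousOn_extendFrom inter_subset_left hlim'
  have hFf : EqOn F f (UHP ∩ Ω) := fun z hz =>
    extendFrom_eq (subset_closure hz.1)
      ((hf.differentiableAt (hopen.mem_nhds hz)).continuousAt.tendsto.mono_left nhdsWithin_le_nhds)
  have hFt : ∀ t : ℝ, (t : ℂ) ∈ Ω → Tendsto f (𝓝[UHP] (t : ℂ)) (𝓝 (F t)) := fun t ht =>
    tendsto_extendFrom (hlim t ht)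
  have hFre : ∀ t : ℝ, (t : ℂ) ∈ Ω → (F t).im = 0 := fun t ht =>
    tendsto_nhds_unique ((Complex.continuous_im.tendsto _).comp (hFt t ht)) (h0 t ht)
  let g : ℂ → ℂ := fun z => if 0 ≤ z.im then F z else conj (F (conj z))
  have hconjc : Continuous (fun z : ℂ => conj z) := Complex.continuous_conj
  have hgc : ContinuousOn g Ω := by
    refine ContinuousOn.if (fun z hz => ?_) ?_ ?_
    · have hz2 : z ∈ frontier {z : ℂ | 0 ≤ z.im} := hz.2
      rw [Complex.frontier_setOfPred_le_im] at hz2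
      have hzi : z.im = 0 := hz2
      have hz' : (z.re : ℂ) = z := Complex.ext (by simp) (by simp [hzi])
      have h1 : conj z = z := Complex.conj_eq_iff_im.2 hzi
      rw [h1]
      have := hFre z.re (hz' ▸ hz.1)
      rw [hz'] at this
      exact (Complex.conj_eq_iff_im.2 this).symm
    · refine hFc.mono fun z hz => ⟨mem_closure_UHP ?_, hz.1⟩
      have := hz.2
      rw [IsClosed.closure_eq (isClosed_le continuous_const Complex.continuous_im)] at this
      exact this
    · refine hconjc.comp_continuousOn (hFc.comp hconjc.continuousOn fun z hz => ⟨?_, hsymm z hz.1⟩)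
      refine mem_closure_UHP ?_
      have : z ∈ closure {z : ℂ | ¬ 0 ≤ z.im} := hz.2
      simp only [not_le] at this
      rw [Complex.closure_setOfPred_im_lt] at this
      have : z.im ≤ 0 := this
      simpa using this
  have hgU : EqOn g f (UHP ∩ Ω) := fun z hz => by
    simp only [g, if_pos (mem_UHP.1 hz.1).le]; exact hFf hz
  have hgconj : ∀ z ∈ Ω, g (conj z) = conj (g z) := by
    intro z hz
    rcases lt_trichotomy z.im 0 with h | h | h
    · simp [g, h.le, not_le.2 h]
    · have h1 : conj z = z := Complex.conj_eq_iff_im.2 h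
      have hz' : (z.re : ℂ) = z := Complex.ext (by simp) (by simp [h])
      have := hFre z.re (hz' ▸ hz)
      rw [hz'] at this
      rw [h1]
      simp only [g, h, le_refl, if_true]
      exact (Complex.conj_eq_iff_im.2 this).symm
    · simp [g, h.le, not_le.2 h]
  have hgd : DifferentiableOn ℂ g Ω := by
    refine differentiableOn_of_continuousOn_off_real hΩ hgc fun z hz him => ?_
    rcases lt_or_gt_of_ne him with h | h
    · have hz' : conj z ∈ UHP ∩ Ω := ⟨by simpa [mem_UHP] using h, hsymm z hz⟩
      have h1 : DifferentiableAt ℂ f (conj z) := hf.differentiableAt (hopen.mem_nhds hz')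
      have h2 : DifferentiableAt ℂ (conj ∘ f ∘ conj) z := by
        have := h1.conj_conj
        simpa using this
      refine h2.congr_of_eventuallyEq ?_
      filter_upwards [(isOpen_lt Complex.continuous_im continuous_const).mem_nhds h,
        hΩ.mem_nhds hz] with w hw hwΩ
      have hw' : w.im < 0 := hw
      have : conj w ∈ UHP ∩ Ω := ⟨by simpa [mem_UHP] using hw', hsymm w hwΩ⟩
      simp only [g, not_le.2 hw', if_false, Function.comp, hFf this]
    · have h1 := hf.differentiableAt (hopen.mem_nhds ⟨h, hz⟩)
      refine h1.congr_of_eventuallyEq ?_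
      filter_upwards [hopen.mem_nhds ⟨h, hz⟩] with w hw
      exact hgU hw
  refine ⟨g, hgd, hgU, hgconj, fun S hS hSc hfS => ?_⟩
  have hnonneg : ∀ z ∈ Ω, 0 ≤ z.im → g z ∈ S := by
    intro z hz him
    have : Tendsto g (𝓝[UHP] z) (𝓝 (g z)) :=
      (hgc.continuousAt (hΩ.mem_nhds hz)).tendsto.mono_left nhdsWithin_le_nhds
    have hne : (𝓝[UHP] z).NeBot := mem_closure_iff_nhdsWithin_neBot.1 (mem_closure_UHP him)
    refine hS.mem_of_tendsto this ?_
    filter_upwards [self_mem_nhdsWithin, nhdsWithin_le_nhds (hΩ.mem_nhds hz)] with w hw hwΩ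
    rw [hgU ⟨hw, hwΩ⟩]; exact hfS ⟨hw, hwΩ⟩
  intro z hz
  rcases le_total 0 z.im with h | h
  · exact hnonneg z hz h
  · have := hSc _ (hnonneg (conj z) (hsymm z hz) (by simpa using h))
    rwa [hgconj z hz, Complex.conj_conj] at this

/-- A holomorphic function with bounded real part has a removable singularity: pass to
`(h + const)⁻¹`, which is bounded and, by the maximum principle, cannot vanish at the centre. -/
theorem exists_tendsto_punctured_of_abs_re_le {h : ℂ → ℂ} {c : ℂ} {r M : ℝ} (hr : 0 < r)
    (hd : DifferentiableOn ℂ h (ball c r \ {c})) (hb : ∀ z ∈ ball c r \ {c}, |(h z).re| ≤ M) :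
    ∃ ℓ, Tendsto h (𝓝[≠] c) (𝓝 ℓ) := by
  set A : ℝ := |M| + 1 with hA
  have hA0 : 0 < A := by positivity
  have hre : ∀ z ∈ ball c r \ {c}, A ≤ (h z + 2 * A).re := by
    intro z hz
    have := (abs_le.1 ((hb z hz).trans (le_abs_self M))).1
    simp; linarith
  have hne : ∀ z ∈ ball c r \ {c}, h z + 2 * A ≠ 0 := fun z hz h0 => by
    have := hre z hz
    rw [h0] at this; simp at this; linarith
  let k : ℂ → ℂ := fun z => (h z + 2 * A)⁻¹
  have hkd : DifferentiableOn ℂ k (ball c r \ {c}) := (hd.add_const _).inv hne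
  have hball : ball c r ∈ 𝓝 c := ball_mem_nhds c hr
  have hkb : BddAbove (norm ∘ k '' (ball c r \ {c})) := by
    refine ⟨A⁻¹, ?_⟩
    rintro _ ⟨z, hz, rfl⟩
    simp only [Function.comp, k, norm_inv]
    exact inv_anti₀ hA0 ((hre z hz).trans (Complex.re_le_norm _))
  have hK := Complex.differentiableOn_update_limUnder_of_bddAbove hball hkd hkb
  set L := limUnder (𝓝[≠] c) k
  set K := Function.update k c L with hKdef
  have hKan : AnalyticAt ℂ K c := hK.analyticAt hball
  have hKc : K c = L := Function.update_self ..
  have hKk : ∀ z ≠ c, K z = k z := fun z hz => Function.update_of_ne hz ..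
  have hkt : Tendsto k (𝓝[≠] c) (𝓝 L) := by
    have := hKan.continuousAt.tendsto.mono_left (nhdsWithin_le_nhds (s := {c}ᶜ))
    rw [hKc] at this
    refine this.congr' ?_
    filter_upwards [self_mem_nhdsWithin] with z hz using hKk z hz
  have hkpos : ∀ z ∈ ball c r \ {c}, 0 < (k z).re := fun z hz => by
    simp only [k, Complex.inv_re]
    exact div_pos (hA0.trans_le (hre z hz)) (Complex.normSq_pos.2 (hne z hz))
  -- If `L = 0`, then `Re K`, positive off `c`, would have a strict minimum there.
  have hL : L ≠ 0 := by
    intro hL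
    have h1 : ∀ᶠ z in 𝓝 c, (-K z).re ≤ (-K c).re := by
      filter_upwards [hball] with z hz
      rcases eq_or_ne z c with rfl | hzc
      · exact le_rfl
      · rw [hKk z hzc, hKc, hL]
        have := hkpos z ⟨hz, hzc⟩
        simp; linarith
    have h2 := Complex.re_eventually_eq_of_isLocalMax (f := fun z => -K z) hKan.neg h1
    have h3 : ∀ᶠ z in 𝓝[≠] c, False := by
      filter_upwards [self_mem_nhdsWithin, nhdsWithin_le_nhds h2, nhdsWithin_le_nhds hball]
        with z hzc hz hzb
      have := hkpos z ⟨hzb, hzc⟩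
      rw [hKk z hzc, hKc, hL] at hz
      simp at hz; linarith
    exact h3.exists.elim fun _ h => h
  refine ⟨L⁻¹ - 2 * A, ?_⟩
  refine ((hkt.inv₀ hL).sub_const _).congr' ?_
  filter_upwards [self_mem_nhdsWithin] with z hz
  simp [k]

theorem exists_mem_UHP_sq_eq {w : ℂ} (hw : 0 < w.im) : ∃ ξ ∈ UHP, ξ ^ 2 = -w := by
  obtain ⟨v, hv⟩ : ∃ v : ℂ, v ^ 2 = w :=
    ⟨w ^ (((2 : ℕ) : ℂ)⁻¹), Complex.cpow_nat_inv_pow w two_ne_zero⟩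
  have him : 0 < v.re * v.im := by
    have : (v ^ 2).im = 2 * (v.re * v.im) := by simp [sq]; ring
    rw [hv] at this; linarith
  have hI : (Complex.I * v) ^ 2 = -w := by rw [mul_pow, Complex.I_sq, hv]; ring
  rcases pos_and_pos_or_neg_and_neg_of_mul_pos him with h | h
  · exact ⟨Complex.I * v, by simpa [mem_UHP] using h.1, hI⟩
  · exact ⟨-(Complex.I * v), by simpa [mem_UHP] using h.1, by rw [neg_sq, hI]⟩

/-- A bounded mixed boundary value problem has no singularity at a corner: if the real part is
constant to the left of `x` and the imaginary part is constant to the right of it, then the function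
has a limit at `x`. Reflection on the right, the substitution `z = x - ξ ^ 2` and a reflection in the
remaining boundary turn the corner into an isolated singularity. -/
theorem exists_tendsto_of_re_left_of_im_right {f : ℂ → ℂ} {x r M a b : ℝ} (hr : 0 < r)
    (hf : DifferentiableOn ℂ f (UHP ∩ ball (x : ℂ) r))
    (hM : ∀ z ∈ UHP ∩ ball (x : ℂ) r, |(f z).re| ≤ M)
    (hleft : ∀ t ∈ Ioo (x - r) x, Tendsto (fun z => (f z).re) (𝓝[UHP] (t : ℂ)) (𝓝 a))
    (hright : ∀ t ∈ Ioo x (x + r), Tendsto (fun z => (f z).im) (𝓝[UHP] (t : ℂ)) (𝓝 b)) :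
    ∃ ℓ, Tendsto f (𝓝[UHP] (x : ℂ)) (𝓝 ℓ) := by
  -- `g` is the reflection of `f - i b` across the right half of the axis, on the disc slit along the left.
  set Ω : Set ℂ := ball (x : ℂ) r ∩ {z | z - x ∈ Complex.slitPlane} with hΩdef
  have hΩ : IsOpen Ω :=
    isOpen_ball.inter (Complex.isOpen_slitPlane.preimage (by fun_prop))
  have hballconj : ∀ z ∈ ball (x : ℂ) r, conj z ∈ ball (x : ℂ) r := fun z hz => by
    rw [mem_ball, dist_eq_norm] at hz ⊢
    rw [← Complex.norm_conj]; simpa using hz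
  have hsymm : ∀ z ∈ Ω, conj z ∈ Ω := fun z hz => by
    refine ⟨hballconj z hz.1, ?_⟩
    have : z - x ∈ Complex.slitPlane := hz.2
    rw [Complex.mem_slitPlane_iff] at this
    change conj z - x ∈ Complex.slitPlane
    rw [Complex.mem_slitPlane_iff]
    simpa using this
  have hΩup : UHP ∩ Ω = UHP ∩ ball (x : ℂ) r := by
    ext z
    refine ⟨fun hz => ⟨hz.1, hz.2.1⟩, fun hz => ⟨hz.1, hz.2, ?_⟩⟩
    change z - x ∈ Complex.slitPlane
    rw [Complex.mem_slitPlane_iff]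
    right
    have := mem_UHP.1 hz.1
    simpa using this.ne'
  obtain ⟨g, hgd, hgf, hgconj, hgS⟩ := exists_reflection hΩ hsymm
    (f := fun z => f z - b * Complex.I) (by rw [hΩup]; exact hf.sub_const _) (by
      intro t ht
      have h1 : |t - x| < r := by
        have := ht.1
        rwa [mem_ball, dist_eq_norm, ← Complex.ofReal_sub, Complex.norm_real] at this
      have h2 : 0 < t - x := by
        have : (t : ℂ) - x ∈ Complex.slitPlane := ht.2
        rw [← Complex.ofReal_sub] at this
        exact Complex.ofReal_mem_slitPlane.1 this
      rw [abs_of_pos h2] at h1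
      have := (hright t ⟨by linarith, by linarith⟩).sub_const b
      simpa using this)
  rw [hΩup] at hgf hgS
  have hgM : ∀ z ∈ Ω, |(g z).re| ≤ M := by
    refine hgS {w | |w.re| ≤ M} (isClosed_le (by fun_prop) continuous_const) (by simp) fun z hz => ?_
    have := hM z hz
    simpa using this
  have hgre : ∀ z ∈ Ω, (g (conj z)).re = (g z).re := fun z hz => by rw [hgconj z hz]; simp
  set s := Real.sqrt r with hs
  have hs0 : 0 < s := Real.sqrt_pos.2 hr
  have hss : s ^ 2 = r := Real.sq_sqrt hr.le
  let Ω' : Set ℂ := ball (0 : ℂ) s \ {0}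
  -- The map `ξ ↦ x - ξ ^ 2` opens the slit: it sends the upper half-disc to the slit disc and both halves
  -- of the real axis to the two edges of the slit, where `Re g = a`.
  let k : ℂ → ℂ := fun ξ => Complex.I * (g (x - ξ ^ 2) - a)
  have hnorm : ∀ ξ ∈ ball (0 : ℂ) s, x - ξ ^ 2 ∈ ball (x : ℂ) r := fun ξ hξ => by
    rw [mem_ball_zero_iff] at hξ
    simp only [mem_ball, dist_eq_norm, sub_sub_cancel_left, norm_neg, norm_pow]
    rw [← hss]; gcongr
  have hmaps : ∀ ξ ∈ UHP ∩ Ω', x - ξ ^ 2 ∈ Ω := by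
    rintro ξ ⟨hξ, hξb, -⟩
    refine ⟨hnorm ξ hξb, ?_⟩
    change (x : ℂ) - ξ ^ 2 - x ∈ Complex.slitPlane
    rw [Complex.mem_slitPlane_iff]
    have h1 : ((x : ℂ) - ξ ^ 2 - x).re = ξ.im ^ 2 - ξ.re ^ 2 := by simp [sq]
    have h2 : ((x : ℂ) - ξ ^ 2 - x).im = -2 * (ξ.re * ξ.im) := by simp [sq]; ring
    rw [h1, h2]
    have h3 := mem_UHP.1 hξ
    by_cases h4 : ξ.re = 0
    · left; rw [h4]; nlinarith
    · right; exact mul_ne_zero (by norm_num) (mul_ne_zero h4 h3.ne')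
  have hkd : DifferentiableOn ℂ k (UHP ∩ Ω') :=
    ((hgd.comp (by fun_prop) hmaps).sub_const _).const_mul _
  have hΩ'symm : ∀ z ∈ Ω', conj z ∈ Ω' := fun z hz => by
    refine ⟨?_, ?_⟩
    · rw [mem_ball_zero_iff, Complex.norm_conj]; simpa using hz.1
    · have := hz.2; simpa using this
  have hbd : ∀ t : ℝ, (t : ℂ) ∈ Ω' →
      Tendsto (fun ξ => (k ξ).im) (𝓝[UHP] (t : ℂ)) (𝓝 0) := by
    intro t ht
    have ht0 : t ≠ 0 := fun h => ht.2 (by simp [h])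
    have hts : x - t ^ 2 ∈ Ioo (x - r) x := by
      have := hnorm t ht.1
      rw [mem_ball, dist_eq_norm, sub_sub_cancel_left, norm_neg, norm_pow, Complex.norm_real,
        Real.norm_eq_abs, sq_abs] at this
      have : 0 < t ^ 2 := by positivity
      constructor <;> linarith
    have hcore : Tendsto (fun z => (g z).re) (𝓝[UHP] ((x - t ^ 2 : ℝ) : ℂ)) (𝓝 a) := by
      refine (hleft _ hts).congr' ?_
      have hmem : ball (x : ℂ) r ∈ 𝓝 ((x - t ^ 2 : ℝ) : ℂ) := by
        refine isOpen_ball.mem_nhds ?_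
        have := hnorm t ht.1
        push_cast; exact this
      filter_upwards [self_mem_nhdsWithin, nhdsWithin_le_nhds hmem] with z hz hzb
      rw [hgf ⟨hz, hzb⟩]; simp
    have hkim : ∀ ξ, (k ξ).im = (g (x - ξ ^ 2)).re - a := fun ξ => by simp [k]
    simp_rw [hkim]
    rw [← sub_self a]
    refine Tendsto.sub_const ?_ a
    have hcont : Tendsto (fun ξ : ℂ => (x : ℂ) - ξ ^ 2) (𝓝 (t : ℂ)) (𝓝 ((x - t ^ 2 : ℝ) : ℂ)) := by
      have : Continuous (fun ξ : ℂ => (x : ℂ) - ξ ^ 2) := by fun_prop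
      convert this.tendsto (t : ℂ) using 2
      push_cast; rfl
    have him : ∀ ξ : ℂ, ((x : ℂ) - ξ ^ 2).im = -2 * (ξ.re * ξ.im) := fun ξ => by simp [sq]; ring
    rcases lt_or_gt_of_ne ht0 with h | h
    · refine hcore.comp (tendsto_nhdsWithin_iff.2 ⟨hcont.mono_left nhdsWithin_le_nhds, ?_⟩)
      filter_upwards [self_mem_nhdsWithin, nhdsWithin_le_nhds
        ((isOpen_lt Complex.continuous_re continuous_const).mem_nhds (show (t : ℂ).re < 0 by simpa))]
        with ξ hξ hξ'
      rw [mem_UHP, him]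
      have h1 := mem_UHP.1 hξ
      have h2 : ξ.re < 0 := hξ'
      nlinarith
    · have hconj : Tendsto (fun ξ : ℂ => conj ((x : ℂ) - ξ ^ 2)) (𝓝 (t : ℂ))
          (𝓝 ((x - t ^ 2 : ℝ) : ℂ)) := by
        have := (Complex.continuous_conj.tendsto _).comp hcont
        rwa [Complex.conj_ofReal] at this
      have h1 : Tendsto (fun ξ : ℂ => (g (conj ((x : ℂ) - ξ ^ 2))).re) (𝓝[UHP] (t : ℂ)) (𝓝 a) := by
        refine hcore.comp (tendsto_nhdsWithin_iff.2 ⟨hconj.mono_left nhdsWithin_le_nhds, ?_⟩)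
        filter_upwards [self_mem_nhdsWithin, nhdsWithin_le_nhds
          ((isOpen_lt continuous_const Complex.continuous_re).mem_nhds
            (show 0 < (t : ℂ).re by simpa))] with ξ hξ hξ'
        rw [mem_UHP, Complex.conj_im, him]
        have h1 := mem_UHP.1 hξ
        have h2 : 0 < ξ.re := hξ'
        nlinarith
      refine h1.congr' ?_
      have hΩ'o : IsOpen Ω' := isOpen_ball.sdiff isClosed_singleton
      filter_upwards [self_mem_nhdsWithin, nhdsWithin_le_nhds (hΩ'o.mem_nhds ht)] with ξ hξ hξ'
      exact hgre _ (hmaps ξ ⟨hξ, hξ'⟩)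
  obtain ⟨q, hqd, hqk, -, hqS⟩ := exists_reflection (isOpen_ball.sdiff isClosed_singleton) hΩ'symm
    hkd hbd
  have hqM : ∀ ξ ∈ Ω', |(q ξ).im| ≤ M + |a| := by
    refine hqS {w | |w.im| ≤ M + |a|} (isClosed_le (by fun_prop) continuous_const) (by simp)
      fun z hz => ?_
    have h1 : (k z).im = (g (x - z ^ 2)).re - a := by simp [k]
    change |(k z).im| ≤ M + |a|
    rw [h1]
    exact (abs_sub _ _).trans (add_le_add (hgM _ (hmaps z hz)) le_rfl)
  obtain ⟨ℓ, hℓ⟩ := exists_tendsto_punctured_of_abs_re_le (h := fun ξ => -Complex.I * q ξ) hs0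
    (hqd.const_mul _) (M := M + |a|) (by intro z hz; simpa using hqM z hz)
  have hex : ∀ z : ℂ, ∃ ξ : ℂ, z ∈ UHP → ξ ∈ UHP ∧ ξ ^ 2 = -(z - x) := fun z => by
    by_cases hz : z ∈ UHP
    · have hz' := mem_UHP.1 hz
      obtain ⟨ξ, h1, h2⟩ := exists_mem_UHP_sq_eq (w := z - x) (by simpa using hz')
      exact ⟨ξ, fun _ => ⟨h1, h2⟩⟩
    · exact ⟨0, fun h => absurd h hz⟩
  choose ξ hξ using hex
  have hξ0 : Tendsto ξ (𝓝[UHP] (x : ℂ)) (𝓝[≠] 0) := by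
    refine tendsto_nhdsWithin_iff.2 ⟨?_, ?_⟩
    · rw [tendsto_zero_iff_norm_tendsto_zero]
      have h1 : Tendsto (fun z : ℂ => Real.sqrt ‖z - x‖) (𝓝[UHP] (x : ℂ)) (𝓝 0) := by
        have : Continuous fun z : ℂ => Real.sqrt ‖z - x‖ := by fun_prop
        have := this.tendsto (x : ℂ)
        simp only [sub_self, norm_zero, Real.sqrt_zero] at this
        exact this.mono_left nhdsWithin_le_nhds
      refine h1.congr' ?_
      filter_upwards [self_mem_nhdsWithin] with z hz
      rw [Real.sqrt_eq_iff_mul_self_eq (norm_nonneg _) (norm_nonneg _), ← norm_mul, ← sq,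
        (hξ z hz).2, norm_neg]
    · filter_upwards [self_mem_nhdsWithin] with z hz h0
      have := mem_UHP.1 (hξ z hz).1
      rw [h0] at this; simp at this
  refine ⟨ℓ + a + b * Complex.I, ?_⟩
  have h2 := ((hℓ.comp hξ0).add_const (a : ℂ)).add_const (b * Complex.I)
  refine h2.congr' ?_
  have hev := hξ0.eventually (mem_nhdsWithin_of_mem_nhds (ball_mem_nhds (0 : ℂ) hs0))
  filter_upwards [self_mem_nhdsWithin, nhdsWithin_le_nhds (ball_mem_nhds (x : ℂ) hr), hev,
    hξ0.eventually self_mem_nhdsWithin] with z hz hzb hξb hξne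
  have h3 : q (ξ z) = k (ξ z) := hqk ⟨(hξ z hz).1, hξb, hξne⟩
  have h4 : (x : ℂ) - ξ z ^ 2 = z := by rw [(hξ z hz).2]; ring
  have h5 : g z = f z - b * Complex.I := hgf ⟨hz, hzb⟩
  simp only [Function.comp, h3, k, h4, h5]
  linear_combination (-f z + b * Complex.I + a) * Complex.I_sq

/-- The mirror image of `exists_tendsto_of_re_left_of_im_right`. -/
theorem exists_tendsto_of_im_left_of_re_right {f : ℂ → ℂ} {x r M a b : ℝ} (hr : 0 < r)
    (hf : DifferentiableOn ℂ f (UHP ∩ ball (x : ℂ) r))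
    (hM : ∀ z ∈ UHP ∩ ball (x : ℂ) r, |(f z).re| ≤ M)
    (hleft : ∀ t ∈ Ioo (x - r) x, Tendsto (fun z => (f z).im) (𝓝[UHP] (t : ℂ)) (𝓝 a))
    (hright : ∀ t ∈ Ioo x (x + r), Tendsto (fun z => (f z).re) (𝓝[UHP] (t : ℂ)) (𝓝 b)) :
    ∃ ℓ, Tendsto f (𝓝[UHP] (x : ℂ)) (𝓝 ℓ) := by
  let m : ℂ → ℂ := fun z => 2 * x - conj z
  have hmc : Continuous m := continuous_const.sub Complex.continuous_conj
  have hmm : ∀ z, m (m z) = z := fun z => by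
    apply Complex.ext <;> simp [m]
  have hmU : ∀ z ∈ UHP, m z ∈ UHP := fun z hz => by
    have := mem_UHP.1 hz
    simpa [mem_UHP, m] using this
  have hmb : ∀ z ∈ ball (x : ℂ) r, m z ∈ ball (x : ℂ) r := fun z hz => by
    rw [mem_ball, dist_eq_norm] at hz ⊢
    have : m z - x = -conj (z - x) := by simp [m]; ring
    rwa [this, norm_neg, Complex.norm_conj]
  have hmt : ∀ t : ℝ, Tendsto m (𝓝[UHP] (t : ℂ)) (𝓝[UHP] ((2 * x - t : ℝ) : ℂ)) := fun t => by
    refine tendsto_nhdsWithin_iff.2 ⟨?_, ?_⟩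
    · have := hmc.tendsto (t : ℂ)
      simp only [m, Complex.conj_ofReal] at this
      push_cast
      exact this.mono_left nhdsWithin_le_nhds
    · filter_upwards [self_mem_nhdsWithin] with z hz using hmU z hz
  have hopen : IsOpen (UHP ∩ ball (x : ℂ) r) := isOpen_UHP.inter isOpen_ball
  let f' : ℂ → ℂ := fun z => conj (f (m z))
  have hd : DifferentiableOn ℂ f' (UHP ∩ ball (x : ℂ) r) := by
    intro z hz
    refine DifferentiableAt.differentiableWithinAt ?_
    have h1 : DifferentiableAt ℂ f (2 * x - conj z) :=
      hf.differentiableAt (hopen.mem_nhds ⟨hmU z hz.1, hmb z hz.2⟩)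
    have h2 : DifferentiableAt ℂ (fun w => f (2 * x - w)) (conj z) :=
      DifferentiableAt.comp (conj z) h1 (by fun_prop)
    have := h2.conj_conj
    simpa [Function.comp_def] using this
  obtain ⟨ℓ, hℓ⟩ := exists_tendsto_of_re_left_of_im_right (f := f') (a := b) (b := -a) hr hd
    (fun z hz => by simpa [f'] using hM _ ⟨hmU z hz.1, hmb z hz.2⟩)
    (fun t ht => by
      have := (hright (2 * x - t) ⟨by linarith [ht.2], by linarith [ht.1]⟩).comp (hmt t)
      simpa [f', Function.comp_def] using this)
    (fun t ht => by
      have := ((hleft (2 * x - t) ⟨by linarith [ht.2], by linarith [ht.1]⟩).comp (hmt t)).neg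
      simpa [f', Function.comp_def] using this)
  refine ⟨conj ℓ, ?_⟩
  have h1 := hmt x
  rw [show 2 * x - x = x by ring] at h1
  have := (Complex.continuous_conj.tendsto _).comp (hℓ.comp h1)
  simpa [Function.comp_def, f', hmm] using this

/-- If the real part is bounded and the imaginary part vanishes on the boundary near `x`, except
possibly at `x`, then reflection turns `x` into a removable singularity. -/
theorem tendsto_im_zero_of_punctured {f : ℂ → ℂ} {x r M : ℝ} (hr : 0 < r)
    (hf : DifferentiableOn ℂ f (UHP ∩ ball (x : ℂ) r))
    (hM : ∀ z ∈ UHP ∩ ball (x : ℂ) r, |(f z).re| ≤ M)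
    (h0 : ∀ t ∈ Ioo (x - r) (x + r), t ≠ x → Tendsto (fun z => (f z).im) (𝓝[UHP] (t : ℂ)) (𝓝 0)) :
    ∃ (g : ℂ → ℂ) (ℓ : ℂ), Tendsto g (𝓝[≠] (x : ℂ)) (𝓝 ℓ) ∧ EqOn g f (UHP ∩ ball (x : ℂ) r) ∧
      (∀ t ∈ Ioo (x - r) (x + r), t ≠ x → (g t).im = 0 ∧ Tendsto f (𝓝[UHP] (t : ℂ)) (𝓝 (g t))) := by
  let Ω : Set ℂ := ball (x : ℂ) r \ {(x : ℂ)}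
  have hΩ : IsOpen Ω := isOpen_ball.sdiff isClosed_singleton
  have hΩup : UHP ∩ Ω = UHP ∩ ball (x : ℂ) r := by
    ext z
    refine ⟨fun hz => ⟨hz.1, hz.2.1⟩, fun hz => ⟨hz.1, hz.2, fun h => ?_⟩⟩
    have := mem_UHP.1 hz.1
    rw [show z = x from h] at this
    simp at this
  have hsymm : ∀ z ∈ Ω, conj z ∈ Ω := fun z hz => by
    refine ⟨?_, fun h => hz.2 ?_⟩
    · have := hz.1
      rw [mem_ball, dist_eq_norm] at this ⊢
      rw [← Complex.norm_conj]; simpa using this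
    · have h1 : conj z = x := h
      have := congrArg conj h1
      simpa using this
  have hΩt : ∀ t : ℝ, (t : ℂ) ∈ Ω ↔ t ∈ Ioo (x - r) (x + r) ∧ t ≠ x := fun t => by
    simp only [Ω, Set.mem_sdiff, mem_ball, dist_eq_norm, ← Complex.ofReal_sub, Complex.norm_real,
      mem_singleton_iff, Complex.ofReal_inj, Real.norm_eq_abs, abs_lt, mem_Ioo]
    constructor
    · rintro ⟨⟨h1, h2⟩, h3⟩; exact ⟨⟨by linarith, by linarith⟩, h3⟩
    · rintro ⟨⟨h1, h2⟩, h3⟩; exact ⟨⟨by linarith, by linarith⟩, h3⟩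
  obtain ⟨g, hgd, hgf, hgconj, hgS⟩ := exists_reflection hΩ hsymm (f := f) (by rwa [hΩup])
    fun t ht => h0 t ((hΩt t).1 ht).1 ((hΩt t).1 ht).2
  rw [hΩup] at hgf hgS
  have hgM : ∀ z ∈ Ω, |(g z).re| ≤ M :=
    hgS {w | |w.re| ≤ M} (isClosed_le (by fun_prop) continuous_const) (by simp) hM
  obtain ⟨ℓ, hℓ⟩ := exists_tendsto_punctured_of_abs_re_le hr hgd hgM
  refine ⟨g, ℓ, hℓ, hgf, fun t ht htx => ⟨?_, ?_⟩⟩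
  · have := hgconj t ((hΩt t).2 ⟨ht, htx⟩)
    rw [Complex.conj_ofReal] at this
    exact Complex.conj_eq_iff_im.1 this.symm
  · have hmem : Ω ∈ 𝓝 (t : ℂ) := hΩ.mem_nhds ((hΩt t).2 ⟨ht, htx⟩)
    have := ((hgd.differentiableAt hmem).continuousAt.tendsto).mono_left
      (nhdsWithin_le_nhds (s := UHP))
    refine this.congr' ?_
    filter_upwards [self_mem_nhdsWithin, nhdsWithin_le_nhds hmem] with z hz hzΩ
    exact hgf ⟨hz, hzΩ.1⟩

theorem tendsto_ofReal_nhdsNE (x : ℝ) :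
    Tendsto (fun t : ℝ => (t : ℂ)) (𝓝[≠] x) (𝓝[≠] (x : ℂ)) := by
  refine tendsto_nhdsWithin_iff.2
    ⟨(Complex.continuous_ofReal.tendsto x).mono_left nhdsWithin_le_nhds, ?_⟩
  filter_upwards [self_mem_nhdsWithin] with t ht
  simpa using ht

/-- A function with bounded real part cannot have different constant imaginary parts on the two sides
of a boundary point `x`: otherwise `exp (π (f - i b) / (a - b))` would be bounded away from `0` and
extend continuously to `x` by reflection, with positive values on one side and negative values on the
other. Hence its imaginary part tends to the common constant at `x` as well. -/
theorem tendsto_im_of_im_left_of_im_right {f : ℂ → ℂ} {x r M a b : ℝ} (hr : 0 < r)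
    (hf : DifferentiableOn ℂ f (UHP ∩ ball (x : ℂ) r))
    (hM : ∀ z ∈ UHP ∩ ball (x : ℂ) r, |(f z).re| ≤ M)
    (hleft : ∀ t ∈ Ioo (x - r) x, Tendsto (fun z => (f z).im) (𝓝[UHP] (t : ℂ)) (𝓝 a))
    (hright : ∀ t ∈ Ioo x (x + r), Tendsto (fun z => (f z).im) (𝓝[UHP] (t : ℂ)) (𝓝 b)) :
    a = b ∧ Tendsto (fun z => (f z).im) (𝓝[UHP] (x : ℂ)) (𝓝 a) := by
  have hR : Ioo x (x + r) ∈ 𝓝[>] x := Ioo_mem_nhdsGT (by linarith)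
  have hL : Ioo (x - r) x ∈ 𝓝[<] x := Ioo_mem_nhdsLT (by linarith)
  have hab : a = b := by
    by_contra hab
    have hab' : a - b ≠ 0 := sub_ne_zero.2 hab
    set c : ℝ := Real.pi / (a - b) with hc
    have hca : c * (a - b) = Real.pi := by rw [hc]; field_simp
    let E : ℂ → ℂ := fun z => Complex.exp (c * (f z - b * Complex.I))
    have hEre : ∀ z, (c * (f z - b * Complex.I)).re = c * (f z).re := fun z => by simp
    have hEim : ∀ z, (c * (f z - b * Complex.I)).im = c * ((f z).im - b) := fun z => by simp
    have hcM : ∀ z ∈ UHP ∩ ball (x : ℂ) r, |c * (f z).re| ≤ |c| * M := fun z hz => by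
      rw [abs_mul]; exact mul_le_mul_of_nonneg_left (hM z hz) (abs_nonneg c)
    have hup : ∀ z ∈ UHP ∩ ball (x : ℂ) r, ‖E z‖ ≤ Real.exp (|c| * M) := fun z hz => by
      simp only [E, Complex.norm_exp, hEre]
      exact Real.exp_le_exp.2 (abs_le.1 (hcM z hz)).2
    set δ := Real.exp (-(|c| * M)) with hδ
    have hδ0 : 0 < δ := Real.exp_pos _
    have hlow : ∀ z ∈ UHP ∩ ball (x : ℂ) r, δ ≤ ‖E z‖ := fun z hz => by
      simp only [E, Complex.norm_exp, hEre]
      exact Real.exp_le_exp.2 (abs_le.1 (hcM z hz)).1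
    have hre : ∀ z, (E z).re = ‖E z‖ * Real.cos (c * ((f z).im - b)) := fun z => by
      simp only [E, Complex.norm_exp, Complex.exp_re, hEre, hEim]
    have him : ∀ z, (E z).im = ‖E z‖ * Real.sin (c * ((f z).im - b)) := fun z => by
      simp only [E, Complex.norm_exp, Complex.exp_im, hEre, hEim]
    have hnear : ∀ t ∈ Ioo (x - r) (x + r), ∀ᶠ z in 𝓝[UHP] (t : ℂ), z ∈ UHP ∩ ball (x : ℂ) r := by
      intro t ht
      refine inter_mem self_mem_nhdsWithin (nhdsWithin_le_nhds (isOpen_ball.mem_nhds ?_))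
      rw [mem_ball, dist_eq_norm, ← Complex.ofReal_sub, Complex.norm_real, Real.norm_eq_abs, abs_lt]
      constructor <;> linarith [ht.1, ht.2]
    have harg_l : ∀ t ∈ Ioo (x - r) x,
        Tendsto (fun z => c * ((f z).im - b)) (𝓝[UHP] (t : ℂ)) (𝓝 Real.pi) := fun t ht => by
      rw [← hca]; exact ((hleft t ht).sub_const b).const_mul c
    have harg_r : ∀ t ∈ Ioo x (x + r),
        Tendsto (fun z => c * ((f z).im - b)) (𝓝[UHP] (t : ℂ)) (𝓝 0) := fun t ht => by
      have := ((hright t ht).sub_const b).const_mul c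
      rwa [sub_self, mul_zero] at this
    have hE0 : ∀ t ∈ Ioo (x - r) (x + r), t ≠ x →
        Tendsto (fun z => (E z).im) (𝓝[UHP] (t : ℂ)) (𝓝 0) := by
      intro t ht htx
      have hsin : Tendsto (fun z => Real.sin (c * ((f z).im - b))) (𝓝[UHP] (t : ℂ)) (𝓝 0) := by
        rcases lt_or_gt_of_ne htx with h | h
        · have := (Real.continuous_sin.tendsto _).comp (harg_l t ⟨ht.1, h⟩)
          rwa [Real.sin_pi] at this
        · have := (Real.continuous_sin.tendsto _).comp (harg_r t ⟨h, ht.2⟩)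
          rwa [Real.sin_zero] at this
      have h1 := hsin.abs.const_mul (Real.exp (|c| * M))
      rw [abs_zero, mul_zero] at h1
      refine squeeze_zero_norm' ?_ h1
      filter_upwards [hnear t ht] with z hz
      rw [him, norm_mul, norm_norm, Real.norm_eq_abs]
      exact mul_le_mul_of_nonneg_right (hup z hz) (abs_nonneg _)
    obtain ⟨g, ℓ, hgℓ, -, hgt⟩ := tendsto_im_zero_of_punctured (f := E) hr
      ((hf.sub_const _).const_mul _).cexp
      (fun z hz => (Complex.abs_re_le_norm _).trans (hup z hz)) hE0
    -- The argument of `E` tends to `0` on the right and to `π` on the left.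
    have hgr : ∀ t ∈ Ioo x (x + r), δ ≤ (g t).re := by
      intro t ht
      have ht' : t ∈ Ioo (x - r) (x + r) := ⟨by linarith [ht.1], ht.2⟩
      have h1 := (Complex.continuous_re.tendsto _).comp (hgt t ht' ht.1.ne').2
      have hcos := (Real.continuous_cos.tendsto _).comp (harg_r t ht)
      rw [Real.cos_zero] at hcos
      have h2 := hcos.const_mul δ
      rw [mul_one] at h2
      refine le_of_tendsto_of_tendsto h2 h1 ?_
      filter_upwards [hnear t ht', hcos.eventually_const_lt one_pos] with z hz hcz
      simp only [Function.comp, hre] at hcz ⊢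
      exact mul_le_mul_of_nonneg_right (hlow z hz) hcz.le
    have hgl : ∀ t ∈ Ioo (x - r) x, (g t).re ≤ -δ := by
      intro t ht
      have ht' : t ∈ Ioo (x - r) (x + r) := ⟨ht.1, by linarith [ht.2]⟩
      have h1 := (Complex.continuous_re.tendsto _).comp (hgt t ht' ht.2.ne).2
      have hcos := (Real.continuous_cos.tendsto _).comp (harg_l t ht)
      rw [Real.cos_pi] at hcos
      have h2 := hcos.const_mul δ
      rw [mul_neg_one] at h2
      refine le_of_tendsto_of_tendsto h1 h2 ?_
      filter_upwards [hnear t ht', hcos.eventually_lt_const (show (-1 : ℝ) < 0 by norm_num)]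
        with z hz hcz
      simp only [Function.comp, hre] at hcz ⊢
      exact mul_le_mul_of_nonpos_right (hlow z hz) hcz.le
    have hre_lim := (Complex.continuous_re.tendsto _).comp
      (hgℓ.comp (tendsto_ofReal_nhdsNE x))
    have h1 : δ ≤ ℓ.re := by
      refine ge_of_tendsto (hre_lim.mono_left (nhdsGT_le_nhdsNE x)) ?_
      filter_upwards [hR] with t ht using hgr t ht
    have h2 : ℓ.re ≤ -δ := by
      refine le_of_tendsto (hre_lim.mono_left (nhdsLT_le_nhdsNE x)) ?_
      filter_upwards [hL] with t ht using hgl t ht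
    linarith
  subst hab
  refine ⟨rfl, ?_⟩
  obtain ⟨g, ℓ, hgℓ, hgf, hgt⟩ := tendsto_im_zero_of_punctured (f := fun z => f z - a * Complex.I)
    hr (hf.sub_const _) (by simpa using hM) (by
      intro t ht htx
      have : Tendsto (fun z => (f z).im) (𝓝[UHP] (t : ℂ)) (𝓝 a) := by
        rcases lt_or_gt_of_ne htx with h | h
        · exact hleft t ⟨ht.1, h⟩
        · exact hright t ⟨h, ht.2⟩
      have := this.sub_const a
      rw [sub_self] at this
      simpa using this)
  have hℓ0 : ℓ.im = 0 := by
    have hlim := (Complex.continuous_im.tendsto _).comp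
      (hgℓ.comp (tendsto_ofReal_nhdsNE x))
    refine tendsto_nhds_unique (hlim.mono_left (nhdsGT_le_nhdsNE x)) ?_
    refine tendsto_const_nhds.congr' ?_
    filter_upwards [hR] with t ht
    exact (hgt t ⟨by linarith [ht.1], ht.2⟩ ht.1.ne').1.symm
  have h1 : Tendsto g (𝓝[UHP] (x : ℂ)) (𝓝 ℓ) := by
    refine hgℓ.mono_left (nhdsWithin_mono _ fun z hz h => ?_)
    have := mem_UHP.1 hz
    rw [show z = x from h] at this
    simp at this
  have h2 := ((Complex.continuous_im.tendsto _).comp h1).add_const a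
  rw [hℓ0, zero_add] at h2
  refine h2.congr' ?_
  filter_upwards [self_mem_nhdsWithin, nhdsWithin_le_nhds (ball_mem_nhds (x : ℂ) hr)] with z hz hzb
  simp [hgf ⟨hz, hzb⟩]

/-! ### Harmonic functions and holomorphic functions -/

theorem gradient_eq_conj_deriv {u : ℂ → ℝ} {f : ℂ → ℂ} {z : ℂ} (hf : DifferentiableAt ℂ f z)
    (h : u =ᶠ[𝓝 z] fun w => (f w).re) : gradient u z = conj (deriv f z) := by
  refine HasGradientAt.gradient ?_
  rw [hasGradientAt_iff_hasFDerivAt]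
  have h1 : HasFDerivAt (fun w => (f w).re)
      (Complex.reCLM.comp ((fderiv ℂ f z).restrictScalars ℝ)) z :=
    Complex.reCLM.hasFDerivAt.comp z (hf.hasFDerivAt.restrictScalars ℝ)
  refine (h1.congr_of_eventuallyEq h).congr_fderiv ?_
  ext
  all_goals simp [Complex.inner]

theorem deriv_eq_zero_of_re_eventually_const {f : ℂ → ℂ} {z : ℂ} {c : ℝ}
    (hf : DifferentiableAt ℂ f z) (h : ∀ᶠ w in 𝓝 z, (f w).re = c) : deriv f z = 0 := by
  have h1 := gradient_eq_conj_deriv (u := fun _ => c) hf (h.mono fun w hw => hw.symm)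
  have h2 : gradient (fun _ : ℂ => c) z = 0 := by simp [gradient]
  rw [h2] at h1
  simpa using h1.symm

theorem eq_of_re_eq_const {f : ℂ → ℂ} {s : Set ℂ} {c : ℝ} (hs : IsOpen s) (hs' : IsPreconnected s)
    (hf : DifferentiableOn ℂ f s) (h : ∀ z ∈ s, (f z).re = c) {z w : ℂ} (hz : z ∈ s) (hw : w ∈ s) :
    f z = f w :=
  hs.is_const_of_deriv_eq_zero hs' hf (fun _ hv =>
    deriv_eq_zero_of_re_eventually_const (hf.differentiableAt (hs.mem_nhds hv))
      (mem_of_superset (hs.mem_nhds hv) h)) hz hw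

theorem InnerProductSpace.HarmonicAt.exists_ball_re_eq {u : ℂ → ℝ} {z : ℂ} {s : Set ℂ} (hs : s ∈ 𝓝 z)
    (hu : InnerProductSpace.HarmonicAt u z) :
    ∃ R > 0, ball z R ⊆ s ∧ ∃ k : ℂ → ℂ, DifferentiableOn ℂ k (ball z R) ∧
      ∀ w ∈ ball z R, (k w).re = u w := by
  obtain ⟨R, hR, h⟩ := Metric.eventually_nhds_iff_ball.1 (hu.eventually.and hs)
  obtain ⟨k, hk, hku⟩ := InnerProductSpace.HarmonicOnNhd.exists_analyticOnNhd_ball_re_eq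
    (f := u) (z := z) (R := R) fun w hw => (h w hw).1
  exact ⟨R, hR, fun w hw => (h w hw).2, k, hk.differentiableOn, hku⟩

/-- On a conformal image of the disc every harmonic function is the real part of a holomorphic one. -/
theorem exists_differentiableOn_re_eq {G : Set ℂ} {Φ : ℂ → ℂ} {u : ℂ → ℝ}
    (hΦ : DifferentiableOn ℂ Φ (ball 0 1)) (hinj : InjOn Φ (ball 0 1)) (himg : Φ '' ball 0 1 = G)
    (hu : InnerProductSpace.HarmonicOnNhd u G) :
    ∃ f : ℂ → ℂ, DifferentiableOn ℂ f G ∧ ∀ z ∈ G, (f z).re = u z := by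
  have hmaps : ∀ ζ ∈ ball (0 : ℂ) 1, Φ ζ ∈ G := fun ζ hζ => himg ▸ mem_image_of_mem Φ hζ
  have hΦan : ∀ ζ ∈ ball (0 : ℂ) 1, AnalyticAt ℂ Φ ζ := fun ζ hζ =>
    hΦ.analyticAt (isOpen_ball.mem_nhds hζ)
  have hharm : InnerProductSpace.HarmonicOnNhd (fun ζ => u (Φ ζ)) (ball 0 1) := by
    intro ζ hζ
    obtain ⟨R, hR, -, k, hk, hku⟩ := (hu _ (hmaps ζ hζ)).exists_ball_re_eq univ_mem
    have h1 : AnalyticAt ℂ (fun ζ => k (Φ ζ)) ζ :=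
      (hk.analyticAt (ball_mem_nhds _ hR)).comp (hΦan ζ hζ)
    refine (InnerProductSpace.harmonicAt_congr_nhds ?_).1 h1.harmonicAt_re
    filter_upwards [(hΦan ζ hζ).continuousAt (ball_mem_nhds _ hR)] with w hw
    exact hku _ hw
  obtain ⟨F, hF, hFu⟩ := hharm.exists_analyticOnNhd_ball_re_eq
  let ι := Function.invFunOn Φ (ball 0 1)
  have hι : ∀ ζ ∈ ball (0 : ℂ) 1, ι (Φ ζ) = ζ := fun ζ hζ => hinj.leftInvOn_invFunOn hζ
  refine ⟨fun z => F (ι z), ?_, ?_⟩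
  · intro z hz
    rw [← himg] at hz
    obtain ⟨ζ, hζ, rfl⟩ := hz
    obtain ⟨R, hR, -, k, hk, hku⟩ := (hu _ (hmaps ζ hζ)).exists_ball_re_eq univ_mem
    obtain ⟨s, hs, hsub⟩ := Metric.eventually_nhds_iff_ball.1
      (((hΦan ζ hζ).continuousAt.eventually (ball_mem_nhds _ hR)).and
        (isOpen_ball.mem_nhds hζ))
    have hd : DifferentiableOn ℂ (fun w => F w - k (Φ w)) (ball ζ s) := by
      refine (hF.differentiableOn.mono fun w hw => (hsub w hw).2).sub ?_
      exact hk.comp (hΦ.mono fun w hw => (hsub w hw).2) fun w hw => (hsub w hw).1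
    have hconst : ∀ w ∈ ball ζ s, F w - k (Φ w) = F ζ - k (Φ ζ) := fun w hw => by
      refine eq_of_re_eq_const (c := 0) isOpen_ball (convex_ball ζ s).isPreconnected hd
        (fun v hv => ?_) hw (mem_ball_self hs)
      have h1 := hFu (hsub v hv).2
      have h2 := hku _ (hsub v hv).1
      simp only at h1
      rw [Complex.sub_re, h1, h2, sub_self]
    -- The inverse of `Φ` need not be known to be differentiable: near `Φ ζ`, the function `F ∘ ι` differs
    -- from `k` by a constant, since `Φ` is open.
    have hopen : 𝓝 (Φ ζ) ≤ map Φ (𝓝 ζ) := by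
      refine (hΦan ζ hζ).eventually_constant_or_nhds_le_map_nhds.resolve_left fun hc => ?_
      have h1 : ∀ᶠ w in 𝓝[≠] ζ, False := by
        filter_upwards [self_mem_nhdsWithin, nhdsWithin_le_nhds hc,
          nhdsWithin_le_nhds (isOpen_ball.mem_nhds hζ)] with w hw hwc hwb
        exact hw (hinj hwb hζ hwc)
      exact h1.exists.elim fun _ h => h
    have hev : ∀ᶠ z in 𝓝 (Φ ζ), F (ι z) = k z + (F ζ - k (Φ ζ)) := by
      refine hopen ?_
      rw [mem_map]
      filter_upwards [ball_mem_nhds ζ hs] with w hw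
      change F (ι (Φ w)) = _
      rw [hι w (hsub w hw).2, ← hconst w hw]; ring
    have hkd : DifferentiableAt ℂ (fun z => k z + (F ζ - k (Φ ζ))) (Φ ζ) :=
      (hk.differentiableAt (ball_mem_nhds _ hR)).add_const _
    exact (hkd.congr_of_eventuallyEq hev).differentiableWithinAt
  · intro z hz
    rw [← himg] at hz
    obtain ⟨ζ, hζ, rfl⟩ := hz
    change (F (ι (Φ ζ))).re = _
    rw [hι ζ hζ]
    exact hFu hζ

/-! ### Vanishing normal derivative on a regular boundary arc -/

theorem eq_zero_of_mem_frontier {G : Set ℂ} {ρ : ℂ → ℝ} {q : ℂ} (hG : IsOpen G)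
    (hρ : ContinuousAt ρ q) (h : ∀ᶠ z in 𝓝 q, (z ∈ G ↔ ρ z < 0)) (hq : q ∈ frontier G) :
    ρ q = 0 := by
  refine le_antisymm ?_ ?_
  · by_contra! hpos
    have h1 : ∀ᶠ z in 𝓝 q, z ∉ G := by
      filter_upwards [h, hρ.eventually_const_lt hpos] with z hz hz'
      rw [hz]; exact not_lt.2 hz'.le
    exact mem_closure_iff_frequently.1 (frontier_subset_closure hq) h1
  · have hqG : q ∉ G := by
      rw [hG.frontier_eq] at hq; exact hq.2
    by_contra! hneg
    exact hqG (h.self_of_nhds.2 hneg)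

theorem fderiv_eq_of_gradient_eq {ρ : ℂ → ℝ} {p n : ℂ} {r : ℝ} (h : gradient ρ p = (r : ℂ) * n)
    (w : ℂ) : fderiv ℝ ρ p w = r * (conj n * w).re := by
  rw [← toDual_gradient, h, InnerProductSpace.toDual_apply_apply, Complex.inner, map_mul,
    Complex.conj_ofReal, mul_left_comm, Complex.re_ofReal_mul, mul_comm w]

/-- Let `f` be holomorphic in an open set `G` whose boundary near `p` is a regular arc, and let `f'`
extend continuously to that arc in such a way that the normal derivative of `Re f` vanishes. Then
`Im f` extends continuously to the arc and is constant along it. Near `p` the set `G` has an interior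
cone condition, so that estimates for `f'` integrate up to the boundary; along the boundary
`Im f` has derivative zero with respect to the tangential coordinate. -/
theorem exists_continuous_im_eq_of_normal_deriv_eq_zero {G : Set ℂ} {f : ℂ → ℂ} {p n : ℂ}
    (hG : IsOpen G) (hf : DifferentiableOn ℂ f G) (hn : IsExteriorNormal G p n)
    (hp : ∃ L, Tendsto (deriv f) (𝓝[G] p) (𝓝 L))
    (hbd : ∀ᶠ q in 𝓝 p, q ∈ frontier G → ∃ n', IsExteriorNormal G q n' ∧
      ∃ L, Tendsto (deriv f) (𝓝[G] q) (𝓝 L) ∧ (L * n').re = 0) :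
    ∃ δ > 0, ∃ J : ℂ → ℝ, Continuous J ∧ (∀ z ∈ G ∩ ball p δ, J z = (f z).im) ∧
      ∀ Z ⊆ frontier G ∩ ball p δ, IsPreconnected Z → ∀ q ∈ Z, ∀ q' ∈ Z, J q = J q' := by
  obtain ⟨hn1, ρ, r, hr, hρ, -, hgrad, hGρ⟩ := hn
  let ν : ℂ → ℝ := fun w => (conj n * w).re
  have hνn : ∀ s : ℝ, ν (s * n) = s := fun s => by
    have h1 : conj n * (s * n) = s * (n * conj n) := by ring
    have h2 : n * conj n = ((1 : ℝ) : ℂ) := by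
      rw [Complex.mul_conj, Complex.normSq_eq_norm_sq, hn1]; norm_num
    simp only [ν, h1, h2]; simp
  have hνadd : ∀ v w, ν (v + w) = ν v + ν w := fun v w => by simp only [ν, mul_add, Complex.add_re]
  have hνsmul : ∀ (s : ℝ) (w : ℂ), ν (s * w) = s * ν w := fun s w => by
    simp only [ν]; rw [mul_left_comm, Complex.re_ofReal_mul]
  have hνle : ∀ w, |ν w| ≤ ‖w‖ := fun w => by
    refine (Complex.abs_re_le_norm _).trans ?_
    rw [norm_mul, Complex.norm_conj, hn1, one_mul]
  -- The defining function is close to `r * ν`, uniformly near `p`.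
  have hstrict := (hρ.hasStrictFDerivAt one_ne_zero).isLittleO.def (show 0 < r / 4 by positivity)
  rw [nhds_prod_eq] at hstrict
  obtain ⟨δ₁, hδ₁, hρest'⟩ : ∃ δ > 0, ∀ z ∈ ball p δ, ∀ w ∈ ball p δ,
      |ρ z - ρ w - r * ν (z - w)| ≤ r / 4 * ‖z - w‖ := by
    obtain ⟨t, ht, hsub⟩ := (mem_prod_same_iff).1 hstrict
    obtain ⟨δ, hδ, hδt⟩ := Metric.mem_nhds_iff.1 ht
    refine ⟨δ, hδ, fun z hz w hw => ?_⟩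
    have := hsub (show (z, w) ∈ t ×ˢ t from ⟨hδt hz, hδt hw⟩)
    simp only [mem_ofPred_eq, fderiv_eq_of_gradient_eq hgrad] at this
    exact this
  have hρc : ∀ᶠ z in 𝓝 p, ContinuousAt ρ z :=
    (hρ.eventually (by simp)).mono fun z hz => hz.continuousAt
  obtain ⟨K, hK⟩ : ∃ K : ℝ, ∀ᶠ z in 𝓝[G] p, ‖deriv f z‖ ≤ K := by
    obtain ⟨L, hL⟩ := hp
    exact ⟨‖L‖ + 1, (hL.norm.eventually_lt_const (lt_add_one _)).mono fun z hz => hz.le⟩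
  rw [eventually_nhdsWithin_iff] at hK
  obtain ⟨R, hR, hRall⟩ := Metric.eventually_nhds_iff_ball.1
    ((hGρ.eventually_nhds.and hρc).and ((hbd.and hK).and (ball_mem_nhds p hδ₁)))
  have hρest : ∀ z ∈ ball p R, ∀ w ∈ ball p R, |ρ z - ρ w - r * ν (z - w)| ≤ r / 4 * ‖z - w‖ :=
    fun z hz w hw => hρest' z (hRall z hz).2.2 w (hRall w hw).2.2
  have hGiff : ∀ z ∈ ball p R, (z ∈ G ↔ ρ z < 0) := fun z hz => (hRall z hz).1.1.self_of_nhds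
  have hcone : ∀ z ∈ G ∩ ball p R, ∀ d : ℂ, z + d ∈ ball p R → ν d ≤ -(‖d‖ / 4) → z + d ∈ G := by
    rintro z ⟨hz, hzR⟩ d hd hνd
    rw [hGiff _ hd]
    have h1 := (hGiff z hzR).1 hz
    have h2 := (abs_le.1 (hρest _ hd z hzR)).2
    rw [add_sub_cancel_left] at h2
    nlinarith
  have hzero : ∀ q ∈ frontier G ∩ ball p R, ρ q = 0 := fun q hq =>
    eq_zero_of_mem_frontier hG (hRall q hq.2).1.2 (hRall q hq.2).1.1 hq.1
  have htang : ∀ q ∈ frontier G ∩ ball p R, ∀ q' ∈ frontier G ∩ ball p R,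
      |ν (q' - q)| ≤ ‖q' - q‖ / 4 := by
    intro q hq q' hq'
    have := hρest q' hq'.2 q hq.2
    rw [hzero q hq, hzero q' hq', sub_zero, zero_sub, abs_neg, abs_mul, abs_of_pos hr] at this
    have h3 : r * |ν (q' - q)| ≤ r * (‖q' - q‖ / 4) := by linarith
    exact le_of_mul_le_mul_left h3 hr
  -- Any two points of `G` near the boundary are joined by a path of comparable length in `G`.
  have hpath : ∀ (h : ℂ → ℂ) (q : ℂ) (S ε : ℝ), DifferentiableOn ℂ h G → ball q S ⊆ ball p R →
      (∀ z ∈ G ∩ ball q S, ‖deriv h z‖ ≤ ε) → ∀ z ∈ G ∩ ball q (S / 8), ∀ w ∈ G ∩ ball q (S / 8),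
      ‖h w - h z‖ ≤ 5 * ε * ‖w - z‖ := by
    intro h q S ε hh hsub hε z hz w hw
    set t := ‖w - z‖ with ht
    have ht0 : 0 ≤ t := norm_nonneg _
    have hzq : ‖z - q‖ < S / 8 := by rw [← dist_eq_norm]; exact hz.2
    have hwq : ‖w - q‖ < S / 8 := by rw [← dist_eq_norm]; exact hw.2
    have htS : t < S / 4 := by
      have : t ≤ ‖w - q‖ + ‖z - q‖ := by
        rw [ht, ← sub_sub_sub_cancel_right w z q]; exact norm_sub_le _ _
      linarith
    have hin : ∀ v ∈ G ∩ ball q (S / 8), ∀ d : ℂ, ‖d‖ ≤ 3 * t → ν d ≤ -(‖d‖ / 4) →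
        v + d ∈ G ∩ ball q S := by
      intro v hv d hd hνd
      have hvq : ‖v - q‖ < S / 8 := by rw [← dist_eq_norm]; exact hv.2
      have hb : v + d ∈ ball q S := by
        rw [mem_ball, dist_eq_norm]
        calc ‖v + d - q‖ = ‖(v - q) + d‖ := by congr 1; ring
          _ ≤ ‖v - q‖ + ‖d‖ := norm_add_le _ _
          _ < S := by linarith
      have hvb : v ∈ ball p R := by
        refine hsub ?_
        rw [mem_ball, dist_eq_norm]; linarith [norm_nonneg (v - q)]
      exact ⟨hcone v ⟨hv.1, hvb⟩ d (hsub hb) hνd, hb⟩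
    have hmv : ∀ a b : ℂ, segment ℝ a b ⊆ G ∩ ball q S → ‖h b - h a‖ ≤ ε * ‖b - a‖ := by
      intro a b hseg
      exact (convex_segment a b).norm_image_sub_le_of_norm_deriv_le
        (fun v hv => hh.differentiableAt (hG.mem_nhds (hseg hv).1)) (fun v hv => hε v (hseg hv))
        (left_mem_segment ℝ a b) (right_mem_segment ℝ a b)
    have hdown : ∀ v ∈ G ∩ ball q (S / 8), segment ℝ v (v + (-(2 * t) : ℝ) * n) ⊆ G ∩ ball q S := by
      intro v hv
      rw [segment_eq_image']
      rintro _ ⟨θ, hθ, rfl⟩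
      have h1 : v + θ • (v + ((-(2 * t) : ℝ) : ℂ) * n - v) = v + ((-(θ * (2 * t)) : ℝ) : ℂ) * n := by
        rw [Complex.real_smul]; push_cast; ring
      simp only [h1]
      have hθt : 0 ≤ θ * (2 * t) := mul_nonneg hθ.1 (by linarith)
      have h2 : ‖((-(θ * (2 * t)) : ℝ) : ℂ) * n‖ = θ * (2 * t) := by
        rw [norm_mul, hn1, mul_one, Complex.norm_real, norm_neg, Real.norm_eq_abs, abs_of_nonneg hθt]
      refine hin v hv _ ?_ ?_
      · rw [h2]; nlinarith [hθ.2]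
      · rw [h2, hνn]; linarith
    have hacross : segment ℝ (z + (-(2 * t) : ℝ) * n) (w + (-(2 * t) : ℝ) * n) ⊆ G ∩ ball q S := by
      rw [segment_eq_image']
      rintro _ ⟨θ, hθ, rfl⟩
      have h1 : z + ((-(2 * t) : ℝ) : ℂ) * n +
          θ • (w + ((-(2 * t) : ℝ) : ℂ) * n - (z + ((-(2 * t) : ℝ) : ℂ) * n)) =
          z + (((θ : ℝ) : ℂ) * (w - z) + ((-(2 * t) : ℝ) : ℂ) * n) := by
        rw [Complex.real_smul]; push_cast; ring
      simp only [h1]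
      have h2 : ‖((θ : ℝ) : ℂ) * (w - z) + ((-(2 * t) : ℝ) : ℂ) * n‖ ≤ 3 * t := by
        refine (norm_add_le _ _).trans ?_
        rw [norm_mul, norm_mul, hn1, Complex.norm_real, Complex.norm_real, norm_neg,
          Real.norm_eq_abs, Real.norm_eq_abs, abs_of_nonneg hθ.1, abs_of_nonneg (by linarith)]
        nlinarith [hθ.2]
      refine hin z hz _ h2 ?_
      rw [hνadd, hνn, hνsmul]
      have h3 : θ * ν (w - z) ≤ t := by
        have h4 := (abs_le.1 (hνle (w - z))).2
        have h5 : θ * ν (w - z) ≤ θ * t := mul_le_mul_of_nonneg_left h4 hθ.1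
        nlinarith [hθ.2]
      linarith
    have e1 := hmv _ _ (hdown z hz)
    have e2 := hmv _ _ (hdown w hw)
    have e3 := hmv _ _ hacross
    have hlen : ∀ v : ℂ, ‖v + ((-(2 * t) : ℝ) : ℂ) * n - v‖ = 2 * t := fun v => by
      rw [add_sub_cancel_left, norm_mul, hn1, mul_one, Complex.norm_real, norm_neg,
        Real.norm_eq_abs, abs_of_nonneg (by linarith)]
    rw [hlen] at e1 e2
    rw [add_sub_add_right_eq_sub] at e3
    set z' := z + ((-(2 * t) : ℝ) : ℂ) * n
    set w' := w + ((-(2 * t) : ℝ) : ℂ) * n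
    calc ‖h w - h z‖ = ‖(h w' - h z') + (h z' - h z) - (h w' - h w)‖ := by congr 1; ring
      _ ≤ ‖h w' - h z'‖ + ‖h z' - h z‖ + ‖h w' - h w‖ :=
        (norm_sub_le _ _).trans (add_le_add_left (norm_add_le _ _) _)
      _ ≤ ε * t + ε * (2 * t) + ε * (2 * t) := by gcongr
      _ = 5 * ε * t := by ring
  have hlip : LipschitzOnWith (Real.toNNReal (5 * K)) (fun z => (f z).im) (G ∩ ball p (R / 8)) := by
    refine LipschitzOnWith.of_dist_le_mul fun z hz w hw => ?_
    have h1 := hpath f p R K hf Subset.rfl (fun v hv => (hRall v hv.2).2.1.2 hv.1) w hw z hz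
    rw [Real.dist_eq, ← Complex.sub_im, dist_eq_norm]
    refine ((Complex.abs_im_le_norm _).trans h1).trans ?_
    exact mul_le_mul_of_nonneg_right (Real.le_coe_toNNReal _) (norm_nonneg _)
  obtain ⟨J, hJ, hJf⟩ := hlip.extend_real
  refine ⟨R / 8, by positivity, J, hJ.continuous, fun z hz => (hJf hz).symm, ?_⟩
  have hR8 : ball p (R / 8) ⊆ ball p R := ball_subset_ball (by linarith)
  -- Along the boundary, `J` has derivative zero.
  have hder : ∀ q ∈ frontier G ∩ ball p (R / 8), ∀ ε > 0, ∀ᶠ q' in 𝓝 q, q' ∈ frontier G →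
      |J q' - J q| ≤ ε * ‖q' - q‖ := by
    -- Since `Re (L * n') = 0`, the map `Im (L * ·)` depends on the normal coordinate only, and the latter is
    -- `o(‖q' - q‖)` along the boundary.
    rintro q ⟨hqG, hqR⟩ ε hε
    obtain ⟨n', ⟨hn1', ρ', r', hr', hρ', hρq, hgrad', hGρ'⟩, L, hL, hLn⟩ :=
      (hRall q (hR8 hqR)).2.1.1 hqG
    set lam := (L * n').im with hlam
    have hLw : ∀ w, (L * w).im = lam * (conj n' * w).re := by
      intro w
      have h1 : n' * conj n' = 1 := by
        rw [Complex.mul_conj, Complex.normSq_eq_norm_sq, hn1']; norm_num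
      have h2 : L * w = (L * n') * (conj n' * w) := by linear_combination (-(L * w)) * h1
      rw [h2, Complex.mul_im, hLn, zero_mul, zero_add]
    set ε₁ := ε / (2 * (|lam| + 1)) with hε₁
    have hε₁0 : 0 < ε₁ := by positivity
    have hdiff := ((hρ'.differentiableAt one_ne_zero).hasFDerivAt.isLittleO).def
      (show 0 < r' * ε₁ by positivity)
    have hρc' : ∀ᶠ z in 𝓝 q, ContinuousAt ρ' z :=
      (hρ'.eventually (by simp)).mono fun z hz => hz.continuousAt
    have hε10 : 0 < ε / 10 := by positivity
    have hLev : ∀ᶠ z in 𝓝 q, z ∈ G → ‖deriv f z - L‖ ≤ ε / 10 := by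
      rw [← eventually_nhdsWithin_iff]
      have := (hL.sub_const L).norm
      rw [sub_self, norm_zero] at this
      exact (this.eventually_lt_const hε10).mono fun z hz => hz.le
    obtain ⟨S, hS, hSall⟩ := Metric.eventually_nhds_iff_ball.1
      (hLev.and (isOpen_ball.mem_nhds hqR))
    have hSR : ball q S ⊆ ball p R := fun z hz => hR8 (hSall z hz).2
    have hest : ∀ z ∈ G ∩ ball q (S / 8), ∀ w ∈ G ∩ ball q (S / 8),
        |J w - J z - (L * (w - z)).im| ≤ ε / 2 * ‖w - z‖ := by
      intro z hz w hw
      have h1 := hpath (fun v => f v - L * v) q S (ε / 10)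
        (hf.sub (differentiableOn_id.const_mul L)) hSR (fun v hv => by
          have h2 : DifferentiableAt ℂ f v := hf.differentiableAt (hG.mem_nhds hv.1)
          have h3 : deriv (fun v => f v - L * v) v = deriv f v - L := by
            have := (h2.hasDerivAt.sub ((hasDerivAt_id v).const_mul L)).deriv
            rw [mul_one] at this
            exact this
          rw [h3]; exact (hSall v hv.2).1 hv.1) z hz w hw
      have h8 : ball q (S / 8) ⊆ ball q S := ball_subset_ball (by linarith)
      have h2 : J w - J z - (L * (w - z)).im = (f w - L * w - (f z - L * z)).im := by
        have hzJ : (f z).im = J z := hJf ⟨hz.1, (hSall z (h8 hz.2)).2⟩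
        have hwJ : (f w).im = J w := hJf ⟨hw.1, (hSall w (h8 hw.2)).2⟩
        rw [← hzJ, ← hwJ, mul_sub]
        simp only [Complex.sub_im]; ring
      rw [h2]
      refine ((Complex.abs_im_le_norm _).trans h1).trans (le_of_eq ?_)
      ring
    have hcl : ∀ z ∈ closure G ∩ ball q (S / 8), ∀ w ∈ closure G ∩ ball q (S / 8),
        |J w - J z - (L * (w - z)).im| ≤ ε / 2 * ‖w - z‖ := by
      have hJc := hJ.continuous
      have hclosed : IsClosed {x : ℂ × ℂ |
          |J x.2 - J x.1 - (L * (x.2 - x.1)).im| ≤ ε / 2 * ‖x.2 - x.1‖} :=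
        isClosed_le (by fun_prop) (by fun_prop)
      have hmem : ∀ z ∈ closure G ∩ ball q (S / 8), z ∈ closure (G ∩ ball q (S / 8)) := by
        rintro z ⟨hz, hzb⟩
        rw [inter_comm]
        exact isOpen_ball.inter_closure ⟨hzb, hz⟩
      intro z hz w hw
      have h1 : (z, w) ∈ closure ((G ∩ ball q (S / 8)) ×ˢ (G ∩ ball q (S / 8))) := by
        rw [closure_prod_eq]; exact ⟨hmem z hz, hmem w hw⟩
      exact closure_minimal (fun x hx => hest x.1 hx.1 x.2 hx.2) hclosed h1
    filter_upwards [hdiff, hρc', hGρ'.eventually_nhds, ball_mem_nhds q (show 0 < S / 8 by positivity)]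
      with q' h1 h2 h3 h4 h5
    have h6 : ρ' q' = 0 := eq_zero_of_mem_frontier hG h2 h3 h5
    rw [h6, hρq, sub_zero, zero_sub, norm_neg, fderiv_eq_of_gradient_eq hgrad', norm_mul,
      Real.norm_eq_abs, abs_of_pos hr', mul_assoc] at h1
    have h7 : |(conj n' * (q' - q)).re| ≤ ε₁ * ‖q' - q‖ := le_of_mul_le_mul_left h1 hr'
    have h8 := hcl q ⟨frontier_subset_closure hqG, mem_ball_self (by positivity)⟩ q'
      ⟨frontier_subset_closure h5, h4⟩
    rw [hLw] at h8
    have h9 : |lam * (conj n' * (q' - q)).re| ≤ ε / 2 * ‖q' - q‖ := by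
      rw [abs_mul]
      calc |lam| * |(conj n' * (q' - q)).re| ≤ (|lam| + 1) * (ε₁ * ‖q' - q‖) := by
            gcongr; linarith
        _ = ε / 2 * ‖q' - q‖ := by rw [hε₁]; field_simp
    calc |J q' - J q| = |(J q' - J q - lam * (conj n' * (q' - q)).re) +
          lam * (conj n' * (q' - q)).re| := by congr 1; ring
      _ ≤ _ := abs_add_le _ _
      _ ≤ ε * ‖q' - q‖ := by linarith
  -- The tangential coordinate is injective on the boundary near `p`, with Lipschitz inverse.
  intro Z hZ hZc
  let τ : ℂ → ℝ := fun q => (conj n * q).im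
  have hτc : Continuous τ := by fun_prop
  have hτ : ∀ q ∈ Z, ∀ q' ∈ Z, ‖q' - q‖ ≤ 2 * |τ q' - τ q| := by
    intro q hq q' hq'
    have h1 := htang q ⟨(hZ hq).1, hR8 (hZ hq).2⟩ q' ⟨(hZ hq').1, hR8 (hZ hq').2⟩
    have h2 : ‖q' - q‖ ^ 2 = ν (q' - q) ^ 2 + (τ q' - τ q) ^ 2 := by
      have h3 : τ q' - τ q = (conj n * (q' - q)).im := by
        simp only [τ, mul_sub, Complex.sub_im]
      have h4 : ‖q' - q‖ = ‖conj n * (q' - q)‖ := by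
        rw [norm_mul, Complex.norm_conj, hn1, one_mul]
      rw [h3, h4, Complex.sq_norm, Complex.normSq_apply]
      simp only [ν]; ring
    have h5 : ν (q' - q) ^ 2 ≤ (‖q' - q‖ / 4) ^ 2 := by
      rw [← sq_abs]; gcongr
    refine abs_le_of_sq_le_sq' (a := ‖q' - q‖) ?_ (by positivity) |>.2
    rw [mul_pow, sq_abs]
    nlinarith [sq_nonneg (‖q' - q‖)]
  have hinj : InjOn τ Z := fun q hq q' hq' h => by
    have := hτ q hq q' hq'
    rw [h, sub_self, abs_zero, mul_zero] at this
    exact (sub_eq_zero.1 (norm_le_zero_iff.1 this)).symm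
  let ψ : ℝ → ℝ := fun a => J (Function.invFunOn τ Z a)
  have hψ : ∀ q ∈ Z, ψ (τ q) = J q := fun q hq => by
    simp only [ψ]; rw [hinj.leftInvOn_invFunOn hq]
  have hAconv : Convex ℝ (τ '' Z) := (hZc.image τ hτc.continuousOn).ordConnected.convex
  have hψd : ∀ a ∈ τ '' Z, HasDerivWithinAt ψ 0 (τ '' Z) a := by
    rintro _ ⟨q, hq, rfl⟩
    rw [hasDerivWithinAt_iff_isLittleO, Asymptotics.isLittleO_iff]
    intro c hc
    obtain ⟨S, hS, hSall⟩ := Metric.eventually_nhds_iff_ball.1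
      (hder q (hZ hq) (c / 2) (by positivity))
    filter_upwards [self_mem_nhdsWithin,
      nhdsWithin_le_nhds (ball_mem_nhds (τ q) (show 0 < S / 2 by positivity))] with a ha haS
    obtain ⟨q', hq', rfl⟩ := ha
    have h1 := hτ q hq q' hq'
    rw [mem_ball, Real.dist_eq] at haS
    have h2 := hSall q' (by rw [mem_ball, dist_eq_norm]; linarith) (hZ hq').1
    rw [hψ q hq, hψ q' hq', smul_zero, sub_zero, Real.norm_eq_abs, Real.norm_eq_abs]
    calc |J q' - J q| ≤ c / 2 * ‖q' - q‖ := h2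
      _ ≤ c / 2 * (2 * |τ q' - τ q|) := by gcongr
      _ = c * |τ q' - τ q| := by ring
  intro q hq q' hq'
  have := hAconv.norm_image_sub_le_of_norm_hasDerivWithin_le (C := 0) hψd (by simp)
    (mem_image_of_mem τ hq') (mem_image_of_mem τ hq)
  rw [zero_mul, hψ q hq, hψ q' hq'] at this
  exact sub_eq_zero.1 (norm_le_zero_iff.1 this)

/-! ### The unit circle as the boundary of a half-plane -/

/-- The covering map `z ↦ exp (i z)` of the punctured unit disc by the upper half-plane; on the real
axis it parametrizes the unit circle by angle. -/
noncomputable def expI (z : ℂ) : ℂ := Complex.exp (z * Complex.I)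

theorem continuous_expI : Continuous expI := by unfold expI; fun_prop

theorem differentiable_expI : Differentiable ℂ expI := by unfold expI; fun_prop

theorem circleMap_eq_expI (θ : ℝ) : circleMap 0 1 θ = expI θ := by simp [circleMap, expI]

theorem norm_expI (z : ℂ) : ‖expI z‖ = Real.exp (-z.im) := by simp [expI, Complex.norm_exp]

theorem expI_mem_ball {z : ℂ} (hz : z ∈ UHP) : expI z ∈ ball (0 : ℂ) 1 := by
  rw [mem_ball_zero_iff, norm_expI, Real.exp_lt_one_iff]
  exact neg_neg_of_pos hz

theorem expI_mem_closedBall {z : ℂ} (hz : 0 ≤ z.im) : expI z ∈ closedBall (0 : ℂ) 1 := by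
  rw [mem_closedBall_zero_iff, norm_expI, Real.exp_le_one_iff]
  linarith

theorem expI_ofReal_mem_closedBall (t : ℝ) : expI t ∈ closedBall (0 : ℂ) 1 :=
  expI_mem_closedBall (by simp)

theorem tendsto_expI (θ : ℝ) : Tendsto expI (𝓝[UHP] (θ : ℂ)) (𝓝[ball 0 1] (expI θ)) :=
  tendsto_nhdsWithin_iff.2 ⟨continuous_expI.continuousAt.mono_left nhdsWithin_le_nhds,
    eventually_mem_nhdsWithin.mono fun _ hz => expI_mem_ball hz⟩

theorem tendsto_expI_closedBall (θ : ℝ) :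
    Tendsto expI (𝓝[{z | 0 ≤ z.im}] (θ : ℂ)) (𝓝[closedBall 0 1] (expI θ)) :=
  tendsto_nhdsWithin_iff.2 ⟨continuous_expI.continuousAt.mono_left nhdsWithin_le_nhds,
    eventually_mem_nhdsWithin.mono fun _ hz => expI_mem_closedBall hz⟩

theorem exists_expI_eq {ζ : ℂ} (hζ : ζ ∈ closedBall (0 : ℂ) 1) (hζ' : ζ ∉ ball (0 : ℂ) 1) (a : ℝ) :
    ∃ θ ∈ Ico a (a + 2 * Real.pi), expI θ = ζ := by
  have h1 : ‖ζ‖ = 1 := by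
    rw [mem_closedBall_zero_iff] at hζ
    rw [mem_ball_zero_iff, not_lt] at hζ'
    exact le_antisymm hζ hζ'
  refine ⟨toIcoMod Real.two_pi_pos a ζ.arg, toIcoMod_mem_Ico _ _ _, ?_⟩
  have h2 := toIcoMod_add_toIcoDiv_zsmul Real.two_pi_pos a ζ.arg
  have h3 := Complex.norm_mul_exp_arg_mul_I ζ
  rw [h1, Complex.ofReal_one, one_mul, ← h2] at h3
  refine Eq.trans ?_ h3
  rw [expI, Complex.exp_eq_exp_iff_exists_int]
  refine ⟨-toIcoDiv Real.two_pi_pos a ζ.arg, ?_⟩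
  push_cast [zsmul_eq_mul]; ring

/-- A local inverse of `expI` near a boundary point. -/
theorem exists_local_inverse_expI (θ : ℝ) : ∃ ℓ : ℂ → ℂ, (∀ ζ ≠ 0, expI (ℓ ζ) = ζ) ∧
    Tendsto ℓ (𝓝 (expI θ)) (𝓝 (θ : ℂ)) ∧ ∀ ζ, (ℓ ζ).im = -Real.log ‖ζ‖ := by
  have hne : expI θ ≠ 0 := Complex.exp_ne_zero _
  refine ⟨fun ζ => θ - Complex.I * Complex.log (ζ / expI θ), fun ζ hζ => ?_, ?_, fun ζ => ?_⟩
  · have h1 : ((θ : ℂ) - Complex.I * Complex.log (ζ / expI θ)) * Complex.I =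
        θ * Complex.I + Complex.log (ζ / expI θ) := by
      linear_combination (-Complex.log (ζ / expI θ)) * Complex.I_sq
    change Complex.exp _ = ζ
    rw [h1, Complex.exp_add, Complex.exp_log (div_ne_zero hζ hne)]
    change expI θ * _ = ζ
    field_simp
  · have h1 : ContinuousAt (fun ζ => (θ : ℂ) - Complex.I * Complex.log (ζ / expI θ)) (expI θ) := by
      refine continuousAt_const.sub (continuousAt_const.mul (ContinuousAt.clog (by fun_prop) ?_))
      rw [div_self hne]; exact Complex.one_mem_slitPlane
    have h2 := h1.tendsto
    simpa [div_self hne] using h2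
  · have h1 : ‖expI θ‖ = 1 := by rw [norm_expI]; simp
    simp [Complex.log_re, h1]

theorem tendsto_ball_of_tendsto_expI {α : Type*} {F : ℂ → α} {l : Filter α} {θ : ℝ}
    (h : Tendsto (fun z => F (expI z)) (𝓝[UHP] (θ : ℂ)) l) : Tendsto F (𝓝[ball 0 1] (expI θ)) l := by
  obtain ⟨ℓ, h1, h2, h3⟩ := exists_local_inverse_expI θ
  have hne : ∀ᶠ ζ in 𝓝[ball 0 1] (expI θ), ζ ≠ 0 :=
    nhdsWithin_le_nhds (isOpen_ne.mem_nhds (Complex.exp_ne_zero _))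
  refine (h.comp (tendsto_nhdsWithin_iff.2 ⟨h2.mono_left nhdsWithin_le_nhds, ?_⟩)).congr' ?_
  · filter_upwards [hne, self_mem_nhdsWithin] with ζ hζ hζb
    rw [mem_UHP, h3]
    exact neg_pos.2 (Real.log_neg (norm_pos_iff.2 hζ) (mem_ball_zero_iff.1 hζb))
  · filter_upwards [hne] with ζ hζ
    simp only [Function.comp, h1 ζ hζ]

/-! ### Uniqueness for the mixed boundary value problem in the disc -/

/-- At a boundary point near which the conjugate function is constant, the maximum can only be attained
by a locally constant function: by reflection the point becomes an interior one. -/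
theorem eventually_eq_of_isMaxOn_of_im_const {h : ℂ → ℂ} {W : ℂ → ℝ} {θ κ : ℝ}
    (hd : DifferentiableOn ℂ h (ball 0 1)) (hWc : ContinuousOn W (closedBall 0 1))
    (hW : ∀ ζ ∈ ball (0 : ℂ) 1, W ζ = (h ζ).re)
    (hκ : ∀ᶠ t : ℝ in 𝓝 θ, Tendsto (fun z => (h (expI z)).im) (𝓝[UHP] (t : ℂ)) (𝓝 κ))
    (hmax : IsMaxOn W (closedBall 0 1) (expI θ)) :
    ∀ᶠ y in 𝓝[closedBall 0 1] (expI θ), W y = W (expI θ) := by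
  obtain ⟨r, hr, hκr⟩ := Metric.eventually_nhds_iff_ball.1 hκ
  have hsymm : ∀ z ∈ ball (θ : ℂ) r, conj z ∈ ball (θ : ℂ) r := fun z hz => by
    rw [mem_ball, dist_eq_norm] at hz ⊢
    rw [← Complex.norm_conj]; simpa using hz
  obtain ⟨g, hgd, hgf, hgconj, -⟩ := exists_reflection isOpen_ball hsymm
    (f := fun z => h (expI z) - κ * Complex.I)
    ((hd.comp differentiable_expI.differentiableOn fun z hz => expI_mem_ball hz.1).sub_const _)
    (fun t ht => by
      have h1 := hκr t (by
        rw [mem_ball, dist_eq_norm, ← Complex.ofReal_sub, Complex.norm_real] at ht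
        exact ht)
      have := h1.sub_const κ
      rw [sub_self] at this
      simpa using this)
  have hup : ∀ z ∈ ball (θ : ℂ) r, z ∈ UHP → (g z).re = W (expI z) := fun z hz hzU => by
    rw [hgf ⟨hzU, hz⟩, hW _ (expI_mem_ball hzU)]; simp
  have hreal : ∀ z ∈ ball (θ : ℂ) r, 0 ≤ z.im → (g z).re = W (expI z) := by
    intro z hz him
    rcases him.lt_or_eq with h | h
    · exact hup z hz h
    · have hz' : z = (z.re : ℂ) := Complex.ext (by simp) (by simp [← h])
      rw [hz'] at hz ⊢
      have h1 : Tendsto (fun w => (g w).re) (𝓝[UHP] (z.re : ℂ)) (𝓝 (g z.re).re) :=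
        ((Complex.continuous_re.tendsto _).comp
          (hgd.differentiableAt (isOpen_ball.mem_nhds hz)).continuousAt.tendsto).mono_left
          nhdsWithin_le_nhds
      have h2 : Tendsto (fun w => W (expI w)) (𝓝[UHP] (z.re : ℂ)) (𝓝 (W (expI z.re))) :=
        ((hWc _ (expI_ofReal_mem_closedBall _)).tendsto.mono_left
          (nhdsWithin_mono _ ball_subset_closedBall)).comp (tendsto_expI _)
      refine tendsto_nhds_unique h1 (h2.congr' ?_)
      filter_upwards [self_mem_nhdsWithin, nhdsWithin_le_nhds (isOpen_ball.mem_nhds hz)]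
        with w hw hwb using (hup w hwb hw).symm
  have hθb : (θ : ℂ) ∈ ball (θ : ℂ) r := mem_ball_self hr
  have hθ := hreal θ hθb (by simp)
  have hle : ∀ z ∈ ball (θ : ℂ) r, (g z).re ≤ (g θ).re := by
    intro z hz
    rw [hθ]
    rcases le_total 0 z.im with h | h
    · rw [hreal z hz h]; exact hmax (expI_mem_closedBall h)
    · have h1 : (g z).re = (g (conj z)).re := by rw [hgconj z hz, Complex.conj_re]
      have h2 : 0 ≤ (conj z).im := by simpa using h
      rw [h1, hreal _ (hsymm z hz) h2]
      exact hmax (expI_mem_closedBall h2)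
  have hconst := Complex.re_eventually_eq_of_isLocalMax (hgd.analyticAt (ball_mem_nhds _ hr))
    (mem_of_superset (ball_mem_nhds _ hr) hle)
  obtain ⟨ℓ, h1, h2, h3⟩ := exists_local_inverse_expI θ
  filter_upwards [nhdsWithin_le_nhds (h2.eventually (hconst.and (ball_mem_nhds _ hr))),
    nhdsWithin_le_nhds (isOpen_ne.mem_nhds (Complex.exp_ne_zero _)), self_mem_nhdsWithin]
    with ζ hζ hζ0 hζb
  have h4 : 0 ≤ (ℓ ζ).im := by
    rw [h3]
    exact neg_nonneg.2 (Real.log_nonpos (norm_nonneg _) (mem_closedBall_zero_iff.1 hζb))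
  have h5 := hreal _ hζ.2 h4
  rw [h1 ζ hζ0] at h5
  rw [← h5, hζ.1, hθ]

theorem le_zero_of_mixed_boundary {h : ℂ → ℂ} {W : ℂ → ℝ}
    (hd : DifferentiableOn ℂ h (ball 0 1)) (hWc : ContinuousOn W (closedBall 0 1))
    (hW : ∀ ζ ∈ ball (0 : ℂ) 1, W ζ = (h ζ).re) {a : ℝ}
    (hbd : ∀ θ ∈ Ico a (a + 2 * Real.pi), W (expI θ) = 0 ∨ ∃ κ : ℝ, ∀ᶠ t : ℝ in 𝓝 θ,
      Tendsto (fun z => (h (expI z)).im) (𝓝[UHP] (t : ℂ)) (𝓝 κ))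
    (hex : ∃ θ : ℝ, W (expI θ) = 0) : ∀ ζ ∈ closedBall (0 : ℂ) 1, W ζ ≤ 0 := by
  obtain ⟨θ₀, hθ₀⟩ := hex
  refine (isCompact_closedBall _ _).le_of_locally_const_at_max
    (convex_closedBall _ _).isPreconnected hWc
    ⟨_, expI_ofReal_mem_closedBall θ₀, hθ₀.le⟩ fun ζ hζ => ?_
  by_cases hζb : ζ ∈ ball (0 : ℂ) 1
  · right
    intro hmax
    have hmem := isOpen_ball.mem_nhds hζb
    have h1 := Complex.re_eventually_eq_of_isLocalMax (hd.analyticAt hmem) (by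
      filter_upwards [hmem] with w hw
      rw [← hW w hw, ← hW ζ hζb]
      exact hmax (ball_subset_closedBall hw))
    apply nhdsWithin_le_nhds
    filter_upwards [h1, hmem] with w hw hwb
    rw [hW w hwb, hW ζ hζb, hw]
  · obtain ⟨θ, hθ, rfl⟩ := exists_expI_eq hζ hζb a
    rcases hbd θ hθ with h0 | ⟨κ, hκ⟩
    · exact Or.inl h0.le
    · exact Or.inr fun hmax => eventually_eq_of_isMaxOn_of_im_const hd hWc hW hκ hmax

/-- Uniqueness for the mixed problem: a harmonic function that is continuous on the closed disc vanishes
if at each boundary point it is zero or its conjugate is locally constant. -/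
theorem eq_zero_of_mixed_boundary {h : ℂ → ℂ} {W : ℂ → ℝ}
    (hd : DifferentiableOn ℂ h (ball 0 1)) (hWc : ContinuousOn W (closedBall 0 1))
    (hW : ∀ ζ ∈ ball (0 : ℂ) 1, W ζ = (h ζ).re) {a : ℝ}
    (hbd : ∀ θ ∈ Ico a (a + 2 * Real.pi), W (expI θ) = 0 ∨ ∃ κ : ℝ, ∀ᶠ t : ℝ in 𝓝 θ,
      Tendsto (fun z => (h (expI z)).im) (𝓝[UHP] (t : ℂ)) (𝓝 κ))
    (hex : ∃ θ : ℝ, W (expI θ) = 0) : ∀ ζ ∈ closedBall (0 : ℂ) 1, W ζ = 0 := by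
  intro ζ hζ
  refine le_antisymm (le_zero_of_mixed_boundary hd hWc hW hbd hex ζ hζ) ?_
  have := le_zero_of_mixed_boundary (h := fun z => -h z) (W := fun z => -W z) (a := a) hd.fun_neg
    hWc.fun_neg (fun ζ hζ => by simp [hW ζ hζ]) (fun θ hθ => ?_)
    (hex.imp fun θ hθ => by simp [hθ]) ζ hζ
  · linarith
  · refine (hbd θ hθ).imp (fun h => by simp [h]) ?_
    rintro ⟨κ, hκ⟩
    exact ⟨-κ, hκ.mono fun t ht => by simpa using ht.neg⟩

/-! ### Locally constant boundary values -/

theorem exists_tendsto_const_of_locally_const {I : Set ℝ} (hI : IsOpen I) (hI' : IsPreconnected I)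
    {F : ℂ → ℝ}
    (h : ∀ x ∈ I, ∃ κ, ∀ᶠ t : ℝ in 𝓝 x, Tendsto F (𝓝[UHP] (t : ℂ)) (𝓝 κ)) :
    ∃ κ, ∀ x ∈ I, Tendsto F (𝓝[UHP] (x : ℂ)) (𝓝 κ) := by
  rcases I.eq_empty_or_nonempty with rfl | ⟨x₀, hx₀⟩
  · exact ⟨0, by simp⟩
  have hex : ∀ x : ℝ, ∃ κ, x ∈ I → ∀ᶠ t : ℝ in 𝓝 x, Tendsto F (𝓝[UHP] (t : ℂ)) (𝓝 κ) := fun x => by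
    by_cases hx : x ∈ I
    · exact (h x hx).imp fun κ hκ _ => hκ
    · exact ⟨0, fun hx' => absurd hx' hx⟩
  choose κ hκ using hex
  have hloc : ∀ x ∈ I, κ =ᶠ[𝓝 x] fun _ => κ x := fun x hx => by
    filter_upwards [hκ x hx, hI.mem_nhds hx] with t ht htI
    exact tendsto_nhds_unique (hκ t htI).self_of_nhds ht
  have hder : ∀ x ∈ I, HasDerivAt κ 0 x := fun x hx =>
    (hasDerivAt_const x (κ x)).congr_of_eventuallyEq (hloc x hx)
  refine ⟨κ x₀, fun x hx => ?_⟩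
  have := hI.is_const_of_deriv_eq_zero hI'
    (fun y hy => (hder y hy).differentiableAt.differentiableWithinAt)
    (fun y hy => (hder y hy).deriv) hx hx₀
  rw [← this]
  exact (hκ x hx).self_of_nhds

/-- Finitely many exceptional points do not matter if the conjugate function is bounded. -/
theorem locally_const_of_finite_exceptions {f : ℂ → ℂ} {M : ℝ} (hf : DifferentiableOn ℂ f UHP)
    (hM : ∀ z ∈ UHP, |(f z).re| ≤ M) {I B : Set ℝ} (hI : IsOpen I) (hB : B.Finite)
    (h : ∀ x ∈ I \ B, ∃ κ, ∀ᶠ t : ℝ in 𝓝 x,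
      Tendsto (fun z => (f z).im) (𝓝[UHP] (t : ℂ)) (𝓝 κ)) :
    ∀ x ∈ I, ∃ κ, ∀ᶠ t : ℝ in 𝓝 x, Tendsto (fun z => (f z).im) (𝓝[UHP] (t : ℂ)) (𝓝 κ) := by
  intro x hx
  have hB' : (B \ {x})ᶜ ∈ 𝓝 x :=
    (hB.subset sdiff_subset).isClosed.isOpen_compl.mem_nhds fun hx' => hx'.2 rfl
  obtain ⟨r, hr, hsub⟩ := Metric.mem_nhds_iff.1 (inter_mem (hI.mem_nhds hx) hB')
  rw [Real.ball_eq_Ioo] at hsub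
  have hgood : ∀ t ∈ Ioo (x - r) (x + r), t ≠ x → t ∈ I \ B := fun t ht htx =>
    ⟨(hsub ht).1, fun htB => (hsub ht).2 ⟨htB, htx⟩⟩
  obtain ⟨a, ha⟩ := exists_tendsto_const_of_locally_const (isOpen_Ioo (a := x - r) (b := x))
    isPreconnected_Ioo fun t ht => h t (hgood t ⟨ht.1, by linarith [ht.2]⟩ ht.2.ne)
  obtain ⟨b, hb⟩ := exists_tendsto_const_of_locally_const (isOpen_Ioo (a := x) (b := x + r))
    isPreconnected_Ioo fun t ht => h t (hgood t ⟨by linarith [ht.1], ht.2⟩ ht.1.ne')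
  obtain ⟨rfl, hlim⟩ := tendsto_im_of_im_left_of_im_right hr (hf.mono inter_subset_left)
    (fun z hz => hM z hz.1) ha hb
  refine ⟨a, ?_⟩
  filter_upwards [Ioo_mem_nhds (show x - r < x by linarith) (show x < x + r by linarith)] with t ht
  rcases lt_trichotomy t x with h1 | rfl | h1
  · exact ha t ⟨ht.1, h1⟩
  · exact hlim
  · exact hb t ⟨h1, ht.2⟩

/-! ### The domain and its potential -/

section Domain

variable {m : ℕ} {E : Fin (m + 1) → Set ℂ} {D : Set ℂ}

theorem IsMultiplyConnectedDomain.isOpen (hD : IsMultiplyConnectedDomain E D) : IsOpen D := by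
  rw [hD.eq_compl]
  exact (isClosed_iUnion_of_finite hD.isClosed).isOpen_compl

theorem IsMultiplyConnectedDomain.notMem_of_mem_frontier (hD : IsMultiplyConnectedDomain E D)
    {j : Fin (m + 1)} {p : ℂ} (hp : p ∈ frontier (E j)) : p ∉ D := by
  rw [hD.eq_compl, notMem_compl_iff]
  exact mem_iUnion.2 ⟨j, (hD.isClosed j).frontier_subset hp⟩

theorem IsMultiplyConnectedDomain.exists_mem_frontier (hD : IsMultiplyConnectedDomain E D) {p : ℂ}
    (hp : p ∈ closure D) (hpD : p ∉ D) : ∃ j, p ∈ frontier (E j) := by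
  rw [hD.eq_compl, notMem_compl_iff] at hpD
  obtain ⟨j, hj⟩ := mem_iUnion.1 hpD
  refine ⟨j, subset_closure hj, fun hint => ?_⟩
  obtain ⟨z, hz, hzD⟩ := mem_closure_iff.1 hp _ isOpen_interior hint
  rw [hD.eq_compl] at hzD
  exact hzD (mem_iUnion.2 ⟨j, interior_subset hz⟩)

theorem IsMultiplyConnectedDomain.isCompact_closure (hD : IsMultiplyConnectedDomain E D) :
    IsCompact (closure D) := by
  refine (hD.outer.subset ?_).isCompact_closure
  rw [hD.eq_compl]
  exact compl_subset_compl.2 (subset_iUnion E 0)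

theorem IsPotential.le_one {u : ℂ → ℝ} (hD : IsMultiplyConnectedDomain E D) (hu : IsPotential E D u)
    {p : ℂ} (hpD : p ∈ closure D) (hp : p ∉ D) {z : ℂ} (hz : z ∈ closure D) : u z ≤ 1 := by
  have hbd : ∀ p ∈ closure D, p ∉ D → u p ≤ 1 := by
    intro p hp hpD
    obtain ⟨j, hj⟩ := hD.exists_mem_frontier hp hpD
    by_cases h0 : j = 0
    · subst h0; rw [hu.eq_zero p hj]; exact zero_le_one
    · exact (hu.eq_one j h0 p hj).le
  refine hD.isCompact_closure.le_of_locally_const_at_max hD.isConnected.isPreconnected.closure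
    hu.continuousOn ⟨p, hpD, hbd p hpD hp⟩ (fun z hz => ?_) z hz
  by_cases hzD : z ∈ D
  · right
    intro hmax
    obtain ⟨R, hR, hRD, k, hk, hku⟩ := (hu.harmonic z hzD).exists_ball_re_eq
      (hD.isOpen.mem_nhds hzD)
    have hball := ball_mem_nhds z hR
    have h1 := Complex.re_eventually_eq_of_isLocalMax (hk.analyticAt hball) (by
      filter_upwards [hball] with w hw
      rw [hku w hw, hku z (mem_ball_self hR)]
      exact hmax (subset_closure (hRD hw)))
    apply nhdsWithin_le_nhds
    filter_upwards [h1, hball] with w hw hwb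
    rw [← hku w hwb, hw, hku z (mem_ball_self hR)]
  · exact Or.inl (hbd z hz hzD)

end Domain

/-! ### The cuts -/

/-- A curve `[0, 1] → ℂ` that runs in `D`, apart from its end points, and is tangent to the gradient of
`u`, in either direction, except for finitely many parameters. The gradient may vanish on it. -/
structure IsGradientLine (u : ℂ → ℝ) (D : Set ℂ) (c : ℝ → ℂ) : Prop where
  continuousOn : ContinuousOn c (Icc 0 1)
  mem : ∀ t ∈ Ioo (0 : ℝ) 1, c t ∈ D
  tangent : ∃ S : Set ℝ, S.Finite ∧ ∀ t ∈ Ioo (0 : ℝ) 1 \ S,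
    ∃ s : ℝ, HasDerivAt c ((s : ℂ) * gradient u (c t)) t

theorem HasDerivAt.comp_one_sub {c : ℝ → ℂ} {c' : ℂ} {t : ℝ} (h : HasDerivAt c c' (1 - t)) :
    HasDerivAt (fun t => c (1 - t)) (-c') t := by
  have := h.scomp t ((hasDerivAt_id t).const_sub 1)
  simpa [Function.comp_def] using this

theorem IsGradientLine.reverse {u : ℂ → ℝ} {D : Set ℂ} {c : ℝ → ℂ} (h : IsGradientLine u D c) :
    IsGradientLine u D fun t => c (1 - t) := by
  obtain ⟨S, hS, hd⟩ := h.tangent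
  refine ⟨h.continuousOn.comp (by fun_prop) fun t ht => ⟨by linarith [ht.2], by linarith [ht.1]⟩,
    fun t ht => h.mem _ ⟨by linarith [ht.2], by linarith [ht.1]⟩,
    (fun t => 1 - t) ⁻¹' S, hS.preimage (sub_right_injective.injOn), fun t ht => ?_⟩
  obtain ⟨s, hs⟩ := hd (1 - t) ⟨⟨by linarith [ht.1.2], by linarith [ht.1.1]⟩, ht.2⟩
  refine ⟨-s, ?_⟩
  have := hs.comp_one_sub
  rwa [← neg_mul, ← Complex.ofReal_neg] at this

section Cuts

variable {m : ℕ} {E : Fin (m + 1) → Set ℂ} {D : Set ℂ} {u : ℂ → ℝ} (C : Cuts E D u)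

theorem Cuts.isGradientLine₀ : IsGradientLine u D C.γ₀ := by
  obtain ⟨S, hS, hd⟩ := C.descent₀.descent
  refine ⟨C.descent₀.continuousOn, C.descent₀.mem, S, hS, fun t ht => ?_⟩
  obtain ⟨-, r, -, hr⟩ := hd t ht
  exact ⟨-r, by rwa [Complex.ofReal_neg, neg_mul]⟩

theorem Cuts.isGradientLine (k : Fin C.q) : IsGradientLine u D (C.γ k) := by
  have hτ := C.τ_mem k
  have hL := C.descent_left k
  have hR := C.descent_right k
  have hγ : C.γ k = fun t => (fun t => C.γ k (1 - t)) (1 - t) := by funext t; simp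
  obtain ⟨S, hS, hdS⟩ := hL.descent
  obtain ⟨T, hT, hdT⟩ := hR.descent
  have hcR : ContinuousOn (C.γ k) (Icc (C.τ k) 1) := by
    rw [hγ]
    exact hR.continuousOn.comp (by fun_prop) fun t ht => ⟨by linarith [ht.2], by linarith [ht.1]⟩
  have hmR : ∀ t ∈ Ioo (C.τ k) 1, 1 - t ∈ Ioo 0 (1 - C.τ k) := fun t ht =>
    ⟨by linarith [ht.2], by linarith [ht.1]⟩
  refine ⟨?_, fun t ht => ?_, S ∪ (fun t => 1 - t) ⁻¹' T ∪ {C.τ k},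
    (hS.union (hT.preimage sub_right_injective.injOn)).union (finite_singleton _), ?_⟩
  · rw [← Icc_union_Icc_eq_Icc hτ.1.le hτ.2.le]
    exact hL.continuousOn.union_of_isClosed hcR isClosed_Icc isClosed_Icc
  · rcases lt_trichotomy t (C.τ k) with h | rfl | h
    · exact hL.mem t ⟨ht.1, h⟩
    · exact C.saddle_mem k
    · have := hR.mem (1 - t) (hmR t ⟨h, ht.2⟩)
      simpa using this
  · rintro t ⟨ht, htS⟩
    simp only [mem_union, not_or, mem_preimage, mem_singleton_iff] at htS
    rcases lt_or_gt_of_ne htS.2 with h | h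
    · obtain ⟨-, r, -, hr⟩ := hdS t ⟨⟨ht.1, h⟩, htS.1.1⟩
      exact ⟨-r, by rwa [Complex.ofReal_neg, neg_mul]⟩
    · obtain ⟨-, r, -, hr⟩ := hdT (1 - t) ⟨hmR t ⟨h, ht.2⟩, htS.1.2⟩
      refine ⟨r, ?_⟩
      have := hr.comp_one_sub
      rw [← hγ, neg_neg] at this
      simpa using this

/-- The union of the cuts. -/
def Cuts.support : Set ℂ := C.γ₀ '' Icc 0 1 ∪ ⋃ k, C.γ k '' Icc 0 1

/-- The end points of the cuts. -/
def Cuts.endPoints : Set ℂ := {C.γ₀ 0, C.γ₀ 1} ∪ ⋃ k, {C.γ k 0, C.γ k 1}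

theorem Cuts.finite_endPoints : C.endPoints.Finite :=
  (toFinite _).union (finite_iUnion fun _ => toFinite _)

theorem Cuts.isClosed_support : IsClosed C.support :=
  ((isCompact_Icc.image_of_continuousOn C.isGradientLine₀.continuousOn).isClosed).union
    (isClosed_iUnion_of_finite fun k =>
      (isCompact_Icc.image_of_continuousOn (C.isGradientLine k).continuousOn).isClosed)

theorem IsGradientLine.notMem_image {u : ℂ → ℝ} {D : Set ℂ} {c : ℝ → ℂ} (h : IsGradientLine u D c)
    {p : ℂ} (hp : p ∉ D) (h0 : p ≠ c 0) (h1 : p ≠ c 1) : p ∉ c '' Icc 0 1 := by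
  rintro ⟨t, ht, rfl⟩
  rcases ht.1.eq_or_lt with h2 | h2
  · exact h0 (by rw [← h2])
  · rcases ht.2.eq_or_lt with h3 | h3
    · exact h1 (by rw [h3])
    · exact hp (h.mem t ⟨h2, h3⟩)

theorem Cuts.notMem_support {p : ℂ} (hp : p ∉ D) (hpE : p ∉ C.endPoints) : p ∉ C.support := by
  simp only [endPoints, mem_union, mem_insert_iff, mem_singleton_iff, mem_iUnion, not_or,
    not_exists] at hpE
  simp only [support, mem_union, mem_iUnion, not_or, not_exists]
  exact ⟨C.isGradientLine₀.notMem_image hp hpE.1.1 hpE.1.2,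
    fun k => (C.isGradientLine k).notMem_image hp (hpE.2 k).1 (hpE.2 k).2⟩

theorem Cuts.domain_subset : C.domain ⊆ D := sdiff_subset

theorem Cuts.isOpen_domain (hD : IsOpen D) : IsOpen C.domain := hD.sdiff C.isClosed_support

theorem Cuts.gradient_ne_zero {z : ℂ} (hz : z ∈ C.domain) : gradient u z ≠ 0 := fun h => by
  obtain ⟨k, hk⟩ := C.all_saddles z hz.1 h
  exact hz.2 (Or.inr (mem_iUnion.2 ⟨k, hk⟩))

theorem Cuts.eventually_mem_domain_iff {p : ℂ} (hp : p ∉ C.support) :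
    ∀ᶠ z in 𝓝 p, (z ∈ C.domain ↔ z ∈ D) := by
  filter_upwards [C.isClosed_support.isOpen_compl.mem_nhds hp] with z hz
  exact ⟨fun h => h.1, fun h => ⟨h, hz⟩⟩

theorem IsExteriorNormal.congr {D G : Set ℂ} {p n : ℂ} (h : IsExteriorNormal D p n)
    (hG : ∀ᶠ z in 𝓝 p, (z ∈ G ↔ z ∈ D)) : IsExteriorNormal G p n := by
  obtain ⟨h1, ρ, r, hr, h2, h3, h4, h5⟩ := h
  refine ⟨h1, ρ, r, hr, h2, h3, h4, ?_⟩
  filter_upwards [hG, h5] with z hz hz'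
  rw [hz, hz']

end Cuts

/-! ### The conjugate function on the sides of the cuts -/

theorem eq_of_hasDerivAt_zero_off_finite {φ : ℝ → ℝ} {a b : ℝ} {S : Set ℝ} (hS : S.Finite)
    (hc : ContinuousOn φ (Ioo a b)) (hd : ∀ t ∈ Ioo a b \ S, HasDerivAt φ 0 t) {s t : ℝ}
    (hs : s ∈ Ioo a b) (ht : t ∈ Ioo a b) : φ s = φ t := by
  have hsub : uIcc t s ⊆ Ioo a b := ordConnected_Ioo.uIcc_subset ht hs
  have := MeasureTheory.integral_eq_of_hasDerivAt_off_countable φ (fun _ => 0) (a := t) (b := s)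
    hS.countable (hc.mono hsub) (fun x hx => hd x ⟨hsub (Ioo_subset_Icc_self hx.1), hx.2⟩) (by simp)
  simp only [intervalIntegral.integral_zero] at this
  linarith

/-- On a side of a cut the conjugate of `u` is locally constant: near such a side `u` is the real part
of a function that is holomorphic across the cut, and the cut is orthogonal to the level lines. -/
theorem locally_const_on_side {D : Set ℂ} {u : ℂ → ℝ} {Φ F : ℂ → ℂ} {γ : ℝ → ℂ} {a b : ℝ}
    (hD : IsOpen D) (hu : InnerProductSpace.HarmonicOnNhd u D)
    (hΦ : DifferentiableOn ℂ Φ (ball 0 1)) (hΦc : ContinuousOn Φ (closedBall 0 1))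
    (hF : DifferentiableOn ℂ F (ball 0 1)) (hFu : ∀ ζ ∈ ball (0 : ℂ) 1, (F ζ).re = u (Φ ζ))
    (hγ : IsGradientLine u D γ) (htr : Traverses (fun θ => Φ (circleMap 0 1 θ)) a b γ) {x : ℝ}
    (hx : x ∈ Ioo a b) :
    ∃ κ, ∀ᶠ t : ℝ in 𝓝 x, Tendsto (fun z => (F (expI z)).im) (𝓝[UHP] (t : ℂ)) (𝓝 κ) := by
  obtain ⟨σ, hσc, hσm, hσa, hσb, hσ⟩ := htr
  simp only [circleMap_eq_expI] at hσ
  have hab : a < b := hx.1.trans hx.2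
  have hσmem : ∀ t ∈ Ioo a b, σ t ∈ Ioo 0 1 := fun t ht => by
    have htI := Ioo_subset_Icc_self ht
    rw [← hσa, ← hσb]
    exact ⟨hσm (left_mem_Icc.2 hab.le) htI ht.1, hσm htI (right_mem_Icc.2 hab.le) ht.2⟩
  obtain ⟨R, hR, hRD, k, hk, hku⟩ := (hu _ (hγ.mem _ (hσmem x hx))).exists_ball_re_eq
    (hD.mem_nhds (hγ.mem _ (hσmem x hx)))
  have hΦx : Φ (expI x) = γ (σ x) := hσ x (Ioo_subset_Icc_self hx)
  have hΦe : ∀ t : ℝ, Tendsto (fun z => Φ (expI z)) (𝓝[{z | 0 ≤ z.im}] (t : ℂ))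
      (𝓝 (Φ (expI t))) := fun t =>
    (hΦc _ (expI_ofReal_mem_closedBall t)).tendsto.comp (tendsto_expI_closedBall t)
  have hnear := hΦe x
  rw [hΦx] at hnear
  have hnear' := hnear.eventually (ball_mem_nhds _ hR)
  rw [eventually_nhdsWithin_iff] at hnear'
  obtain ⟨r, hr, hrsub⟩ := Metric.eventually_nhds_iff_ball.1 hnear'
  -- Up to a constant, `F ∘ expI` is `k ∘ Φ ∘ expI` near `x`.
  have hopen : IsOpen (UHP ∩ ball (x : ℂ) r) := isOpen_UHP.inter isOpen_ball
  have hpre : IsPreconnected (UHP ∩ ball (x : ℂ) r) :=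
    (convex_UHP.inter (convex_ball _ _)).isPreconnected
  have hin : ∀ z ∈ UHP ∩ ball (x : ℂ) r, Φ (expI z) ∈ ball (γ (σ x)) R := fun z hz =>
    hrsub z hz.2 (mem_UHP.1 hz.1).le
  have hdiff : DifferentiableOn ℂ (fun z => F (expI z) - k (Φ (expI z))) (UHP ∩ ball (x : ℂ) r) :=
    (hF.comp differentiable_expI.differentiableOn fun z hz => expI_mem_ball hz.1).sub
      (hk.comp (hΦ.comp differentiable_expI.differentiableOn fun z hz => expI_mem_ball hz.1) hin)
  obtain ⟨c₀, hc₀⟩ : ∃ c₀, ∀ z ∈ UHP ∩ ball (x : ℂ) r, F (expI z) = k (Φ (expI z)) + c₀ := by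
    have hne : (UHP ∩ ball (x : ℂ) r).Nonempty := by
      have : ∀ᶠ z in 𝓝[UHP] (x : ℂ), z ∈ UHP ∩ ball (x : ℂ) r :=
        inter_mem self_mem_nhdsWithin (nhdsWithin_le_nhds (ball_mem_nhds _ hr))
      exact this.exists
    obtain ⟨z₀, hz₀⟩ := hne
    refine ⟨F (expI z₀) - k (Φ (expI z₀)), fun z hz => ?_⟩
    have := eq_of_re_eq_const (c := 0) hopen hpre hdiff (fun w hw => by
      rw [Complex.sub_re, hFu _ (expI_mem_ball hw.1), hku _ (hin w hw), sub_self]) hz hz₀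
    rw [← this]; ring
  -- Along the cut the imaginary part of `k` is constant.
  have hσcont : ContinuousAt σ x := hσc.continuousAt (Icc_mem_nhds hx.1 hx.2)
  obtain ⟨η, hη, hηsub⟩ : ∃ η > 0, ∀ s ∈ Ioo (σ x - η) (σ x + η),
      s ∈ Ioo (0 : ℝ) 1 ∧ γ s ∈ ball (γ (σ x)) R := by
    have hcont : ContinuousAt γ (σ x) :=
      hγ.continuousOn.continuousAt (Icc_mem_nhds (hσmem x hx).1 (hσmem x hx).2)
    obtain ⟨η, hη, h⟩ := Metric.eventually_nhds_iff_ball.1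
      ((eventually_mem_set.2 (Ioo_mem_nhds (hσmem x hx).1 (hσmem x hx).2)).and (hcont.eventually (ball_mem_nhds _ hR)))
    exact ⟨η, hη, fun s hs => h s (by rwa [Real.ball_eq_Ioo])⟩
  obtain ⟨S, hS, hSd⟩ := hγ.tangent
  have hφ : ∀ s ∈ Ioo (σ x - η) (σ x + η), (k (γ s)).im = (k (γ (σ x))).im := fun s hs => by
    refine eq_of_hasDerivAt_zero_off_finite (φ := fun s => (k (γ s)).im) hS (fun s hs => ?_)
      (fun s hs => ?_) hs ⟨by linarith, by linarith⟩
    · have h1 : ContinuousAt γ s := hγ.continuousOn.continuousAt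
        (Icc_mem_nhds (hηsub s hs).1.1 (hηsub s hs).1.2)
      have h2 : ContinuousAt k (γ s) :=
        (hk.differentiableAt (isOpen_ball.mem_nhds (hηsub s hs).2)).continuousAt
      exact (Complex.continuous_im.continuousAt.comp
        (ContinuousAt.comp (f := γ) h2 h1)).continuousWithinAt
    · have hmem := isOpen_ball.mem_nhds (hηsub s hs.1).2
      have h2 : DifferentiableAt ℂ k (γ s) := hk.differentiableAt hmem
      obtain ⟨v, hv⟩ := hSd s ⟨(hηsub s hs.1).1, hs.2⟩
      rw [gradient_eq_conj_deriv h2 (by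
        filter_upwards [hmem] with w hw using (hku w hw).symm)] at hv
      have h3 : HasDerivAt (fun s => k (γ s)) (deriv k (γ s) * (v * conj (deriv k (γ s)))) s :=
        h2.hasDerivAt.comp s hv
      have h4 := Complex.imCLM.hasFDerivAt.comp_hasDerivAt s h3
      have h5 : (deriv k (γ s) * (v * conj (deriv k (γ s)))).im = 0 := by
        rw [mul_left_comm, Complex.mul_conj, ← Complex.ofReal_mul, Complex.ofReal_im]
      have h6 : Complex.imCLM (deriv k (γ s) * (v * conj (deriv k (γ s)))) = 0 := h5
      rw [h6] at h4
      exact h4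
  refine ⟨(k (γ (σ x))).im + c₀.im, ?_⟩
  filter_upwards [hσcont.eventually (Ioo_mem_nhds (show σ x - η < σ x by linarith)
    (show σ x < σ x + η by linarith)), Ioo_mem_nhds hx.1 hx.2,
    Complex.continuous_ofReal.continuousAt.eventually (ball_mem_nhds (x : ℂ) hr)] with t h1 h2 h3
  have h4 : Φ (expI t) = γ (σ t) := hσ t (Ioo_subset_Icc_self h2)
  have h5 := (hΦe t).mono_left (nhdsWithin_mono _ fun z (hz : z ∈ UHP) => (mem_UHP.1 hz).le)
  rw [h4] at h5
  have h6 : ContinuousAt k (γ (σ t)) :=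
    (hk.differentiableAt (isOpen_ball.mem_nhds (hηsub _ h1).2)).continuousAt
  have h7 := ((Complex.continuous_im.tendsto _).comp (h6.tendsto.comp h5)).add_const c₀.im
  rw [hφ _ h1] at h7
  refine h7.congr' ?_
  filter_upwards [self_mem_nhdsWithin, nhdsWithin_le_nhds (isOpen_ball.mem_nhds h3)] with z hz hzb
  rw [hc₀ z ⟨hz, hzb⟩, Complex.add_im]; rfl

/-! ### The Neumann condition on the boundary curves -/

section Arc

variable {m : ℕ} {E : Fin (m + 1) → Set ℂ} {D : Set ℂ} {u : ℂ → ℝ} {C : Cuts E D u}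

theorem OrientedBoundary.mapsTo_closure (B : OrientedBoundary C) :
    MapsTo B.Φ (closedBall 0 1) (closure C.domain) := by
  rw [← closure_ball (0 : ℂ) one_ne_zero, ← B.image]
  refine mapsTo_iff_image_subset.2 (ContinuousOn.image_closure ?_)
  rw [closure_ball (0 : ℂ) one_ne_zero]
  exact B.continuousOn

theorem OrientedBoundary.mapsTo (B : OrientedBoundary C) :
    MapsTo B.Φ (ball 0 1) C.domain := fun _ hζ => B.image ▸ mem_image_of_mem _ hζ

theorem OrientedBoundary.tendsto_comp_expI (B : OrientedBoundary C) (t : ℝ) :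
    Tendsto (fun z => B.Φ (expI z)) (𝓝[UHP] (t : ℂ)) (𝓝 (B.Φ (expI t))) :=
  ((B.continuousOn _ (expI_ofReal_mem_closedBall t)).tendsto.mono_left
    (nhdsWithin_mono _ ball_subset_closedBall)).comp (tendsto_expI t)

theorem OrientedBoundary.continuous_comp_expI (B : OrientedBoundary C) :
    Continuous fun t : ℝ => B.Φ (expI t) :=
  B.continuousOn.comp_continuous (continuous_expI.comp Complex.continuous_ofReal)
    expI_ofReal_mem_closedBall

/-- On the regular part of the boundary curves, a vanishing normal derivative of `Re f` makes the
boundary values of `Im f` locally constant. -/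
theorem OrientedBoundary.locally_const_on_regular_arc (B : OrientedBoundary C)
    (hD : IsOpen D) {u₂ : ℂ → ℝ} {f : ℂ → ℂ}
    (hf : DifferentiableOn ℂ f C.domain) (hfu : ∀ z ∈ C.domain, (f z).re = u₂ z)
    {S T : Set ℂ} (hS : S.Finite) (hT : T.Finite)
    (hreg : ∀ p ∈ frontier D \ S, ∃ n, IsExteriorNormal D p n)
    (hneu : ∀ p ∈ frontier D \ T, ∀ n, IsExteriorNormal D p n →
      ∃ G : ℂ, Tendsto (gradient u₂) (𝓝[C.domain] p) (𝓝 G) ∧ Inner.inner ℝ G n = 0) {x : ℝ}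
    (hx : B.Φ (expI x) ∉ S ∪ T ∪ C.endPoints) (hnear : ∀ᶠ t : ℝ in 𝓝 x, B.Φ (expI t) ∉ D) :
    ∃ κ, ∀ᶠ t : ℝ in 𝓝 x,
      Tendsto (fun z => (f (B.Φ (expI z))).im) (𝓝[UHP] (t : ℂ)) (𝓝 κ) := by
  have hG : IsOpen C.domain := C.isOpen_domain hD
  set p := B.Φ (expI x) with hp
  have hfin : (S ∪ T ∪ C.endPoints).Finite := (hS.union hT).union C.finite_endPoints
  have hpS : p ∉ C.support := C.notMem_support hnear.self_of_nhds fun h => hx (Or.inr h)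
  have hderiv : ∀ z ∈ C.domain, deriv f z = conj (gradient u₂ z) := fun z hz => by
    rw [gradient_eq_conj_deriv (hf.differentiableAt (hG.mem_nhds hz)) (by
      filter_upwards [hG.mem_nhds hz] with w hw using (hfu w hw).symm), Complex.conj_conj]
  have hgood : ∀ᶠ q in 𝓝 p, q ∈ closure C.domain → q ∉ D → ∃ n', IsExteriorNormal C.domain q n' ∧
      ∃ L, Tendsto (deriv f) (𝓝[C.domain] q) (𝓝 L) ∧ (L * n').re = 0 := by
    filter_upwards [(C.eventually_mem_domain_iff hpS).eventually_nhds,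
      hfin.isClosed.isOpen_compl.mem_nhds hx] with q h1 h2 h3 h4
    simp only [mem_compl_iff, mem_union, not_or] at h2
    have h5 : q ∈ frontier D := by
      rw [hD.frontier_eq]; exact ⟨closure_mono C.domain_subset h3, h4⟩
    obtain ⟨n, hn⟩ := hreg q ⟨h5, h2.1.1⟩
    obtain ⟨g, hg, hgn⟩ := hneu q ⟨h5, h2.1.2⟩ n hn
    refine ⟨n, hn.congr h1, conj g, ?_, ?_⟩
    · refine ((Complex.continuous_conj.tendsto g).comp hg).congr' ?_
      filter_upwards [self_mem_nhdsWithin] with z hz using (hderiv z hz).symm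
    · rw [Complex.inner] at hgn
      rwa [mul_comm]
  have hcl : ∀ t : ℝ, B.Φ (expI t) ∈ closure C.domain := fun t =>
    B.mapsTo_closure (expI_ofReal_mem_closedBall t)
  obtain ⟨n, hn, L, hL, -⟩ := hgood.self_of_nhds (hcl x) hnear.self_of_nhds
  obtain ⟨δ, hδ, J, hJ, hJf, hJZ⟩ := exists_continuous_im_eq_of_normal_deriv_eq_zero hG hf hn
    ⟨L, hL⟩ (by
      filter_upwards [hgood, C.eventually_mem_domain_iff hpS] with q h1 h2 h3
      rw [hG.frontier_eq] at h3
      exact h1 h3.1 fun h => h3.2 (h2.2 h))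
  obtain ⟨r, hr, hrsub⟩ := Metric.eventually_nhds_iff_ball.1
    (hnear.and (B.continuous_comp_expI.continuousAt.eventually (ball_mem_nhds p hδ)))
  have hZ : (fun t : ℝ => B.Φ (expI t)) '' ball x r ⊆ frontier C.domain ∩ ball p δ := by
    rintro _ ⟨t, ht, rfl⟩
    refine ⟨?_, (hrsub t ht).2⟩
    rw [hG.frontier_eq]
    exact ⟨hcl t, fun h => (hrsub t ht).1 (C.domain_subset h)⟩
  have hconst := hJZ _ hZ ((convex_ball x r).isPreconnected.image _
    B.continuous_comp_expI.continuousOn)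
  refine ⟨J p, ?_⟩
  filter_upwards [ball_mem_nhds x hr] with t ht
  have h1 := (hJ.tendsto _).comp (B.tendsto_comp_expI t)
  rw [hconst _ (mem_image_of_mem _ ht) _ (mem_image_of_mem _ (mem_ball_self hr))] at h1
  refine h1.congr' ?_
  filter_upwards [self_mem_nhdsWithin, (B.tendsto_comp_expI t).eventually
    (isOpen_ball.mem_nhds (hrsub t ht).2)] with z hz hzb
  exact hJf _ ⟨B.mapsTo (expI_mem_ball hz), hzb⟩

end Arc

/-! ### Monotonicity of the conjugate function where the potential is maximal -/

/-- Where the real part of `h` has its maximum along a boundary interval, its conjugate increases: this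
is the Cauchy-Riemann equation for the tangential and the normal derivative. -/
theorem exists_hasDerivAt_nonneg_of_re_max {h : ℂ → ℂ} {t r c : ℝ} {v : ℝ → ℝ} (hr : 0 < r)
    (hd : DifferentiableOn ℂ h (UHP ∩ ball (t : ℂ) r))
    (hc : ∀ s ∈ ball t r, Tendsto (fun z => (h z).re) (𝓝[UHP] (s : ℂ)) (𝓝 c))
    (hle : ∀ z ∈ UHP ∩ ball (t : ℂ) r, (h z).re ≤ c)
    (hv : ∀ s ∈ ball t r, Tendsto (fun z => (h z).im) (𝓝[UHP] (s : ℂ)) (𝓝 (v s))) :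
    ∃ d, 0 ≤ d ∧ HasDerivAt v d t := by
  have hball : ∀ s : ℝ, (s : ℂ) ∈ ball (t : ℂ) r ↔ s ∈ ball t r := fun s => by
    rw [mem_ball, mem_ball, dist_eq_norm, ← Complex.ofReal_sub, Complex.norm_real, dist_eq_norm]
  have hsymm : ∀ z ∈ ball (t : ℂ) r, conj z ∈ ball (t : ℂ) r := fun z hz => by
    rw [mem_ball, dist_eq_norm] at hz ⊢
    rw [← Complex.norm_conj]; simpa using hz
  obtain ⟨g, hgd, hgf, hgconj, -⟩ := exists_reflection isOpen_ball hsymm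
    (f := fun z => Complex.I * (h z - c)) ((hd.sub_const _).const_mul _) (fun s hs => by
      have := (hc s ((hball s).1 hs)).sub_const c
      rw [sub_self] at this
      simpa using this)
  have htb : (t : ℂ) ∈ ball (t : ℂ) r := mem_ball_self hr
  have hgv : ∀ s ∈ ball t r, v s = -(g s).re := fun s hs => by
    have hsb := (hball s).2 hs
    have h1 : Tendsto (fun z => -(g z).re) (𝓝[UHP] (s : ℂ)) (𝓝 (-(g s).re)) :=
      (((Complex.continuous_re.tendsto _).comp
        (hgd.differentiableAt (isOpen_ball.mem_nhds hsb)).continuousAt.tendsto).mono_left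
        nhdsWithin_le_nhds).neg
    refine tendsto_nhds_unique (hv s hs) (h1.congr' ?_)
    filter_upwards [self_mem_nhdsWithin, nhdsWithin_le_nhds (isOpen_ball.mem_nhds hsb)] with z hz hzb
    rw [hgf ⟨hz, hzb⟩]; simp
  have hg' : HasDerivAt g (deriv g t) t :=
    (hgd.differentiableAt (isOpen_ball.mem_nhds htb)).hasDerivAt
  refine ⟨-(deriv g t).re, ?_, ?_⟩
  · rw [neg_nonneg]
    -- On the vertical line through `t`, the imaginary part of `g` decreases.
    have h1 : HasDerivAt (fun y : ℝ => (t : ℂ) + y * Complex.I) Complex.I 0 := by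
      have := ((Complex.ofRealCLM.hasDerivAt (x := (0 : ℝ))).mul_const Complex.I).const_add (t : ℂ)
      simpa using this
    have h0 : (t : ℂ) + ((0 : ℝ) : ℂ) * Complex.I = t := by simp
    have h2 : HasDerivAt (fun y : ℝ => g (t + y * Complex.I)) (deriv g t * Complex.I) 0 :=
      HasDerivAt.comp (h₂ := g) (h := fun y : ℝ => (t : ℂ) + y * Complex.I) 0 (by rwa [h0]) h1
    have h3 : HasDerivAt (fun y : ℝ => (g (t + y * Complex.I)).im) (deriv g t).re 0 := by
      have := Complex.imCLM.hasFDerivAt.comp_hasDerivAt 0 h2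
      simpa [Function.comp_def] using this
    have hg0 : (g t).im = 0 := by
      have := hgconj t htb
      rw [Complex.conj_ofReal] at this
      exact Complex.conj_eq_iff_im.1 this.symm
    refine le_of_tendsto h3.tendsto_slope_zero_right ?_
    filter_upwards [Ioo_mem_nhdsGT hr] with y hy
    rw [zero_add, h0, hg0, sub_zero, smul_eq_mul]
    have hz : (t : ℂ) + y * Complex.I ∈ UHP ∩ ball (t : ℂ) r :=
      ⟨by simpa [mem_UHP] using hy.1, by simpa [dist_eq_norm, abs_of_pos hy.1] using hy.2⟩
    rw [hgf hz]
    have h4 := hle _ hz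
    refine mul_nonpos_of_nonneg_of_nonpos (inv_nonneg.2 hy.1.le) ?_
    simp only [Complex.I_mul_im, Complex.sub_re, Complex.ofReal_re]
    linarith
  · have h1 : HasDerivAt (fun s : ℝ => g s) (deriv g t) t := hg'.comp_ofReal
    have h2 := (Complex.reCLM.hasFDerivAt.comp_hasDerivAt t h1).neg
    refine HasDerivAt.congr_of_eventuallyEq h2 ?_
    filter_upwards [ball_mem_nhds t hr] with s hs
    exact hgv s hs

/-! ### The integral of the gradient along a level line -/

/-- Along a level line of `Re h`, the integral of `|∇ Re h| = |h'|` is the increment of `Im h`, up to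
sign, since `Im h` is strictly monotone there. -/
theorem gradIntegral_eq_abs_sub {G : Set ℂ} {h : ℂ → ℂ} {u : ℂ → ℝ} {c : ℝ → ℂ} {κ A B : ℝ}
    (hG : IsOpen G) (hh : DifferentiableOn ℂ h G)
    (hgrad : ∀ z ∈ G, ‖gradient u z‖ = ‖deriv h z‖) (hne : ∀ z ∈ G, gradient u z ≠ 0)
    (hmem : ∀ t ∈ Ioo (0 : ℝ) 1, c t ∈ G) (hc : ContDiffOn ℝ 1 c (Ioo 0 1))
    (hc' : ∀ t ∈ Ioo (0 : ℝ) 1, deriv c t ≠ 0) (hre : ∀ t ∈ Ioo (0 : ℝ) 1, (h (c t)).re = κ)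
    (hA : Tendsto (fun t => (h (c t)).im) (𝓝[>] 0) (𝓝 A))
    (hB : Tendsto (fun t => (h (c t)).im) (𝓝[<] 1) (𝓝 B)) :
    gradIntegral u c = |B - A| ∧ 0 < gradIntegral u c := by
  have hcd : ∀ t ∈ Ioo (0 : ℝ) 1, HasDerivAt c (deriv c t) t := fun t ht =>
    ((hc.differentiableOn one_ne_zero).differentiableAt (isOpen_Ioo.mem_nhds ht)).hasDerivAt
  have hd : ∀ t ∈ Ioo (0 : ℝ) 1, HasDerivAt (fun t => h (c t)) (deriv h (c t) * deriv c t) t :=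
    fun t ht => (hh.differentiableAt (hG.mem_nhds (hmem t ht))).hasDerivAt.comp t (hcd t ht)
  set φ' : ℝ → ℝ := fun t => (deriv h (c t) * deriv c t).im with hφ'
  have him : ∀ t ∈ Ioo (0 : ℝ) 1, HasDerivAt (fun t => (h (c t)).im) (φ' t) t := fun t ht =>
    Complex.imCLM.hasFDerivAt.comp_hasDerivAt t (hd t ht)
  have hre0 : ∀ t ∈ Ioo (0 : ℝ) 1, (deriv h (c t) * deriv c t).re = 0 := fun t ht => by
    have h1 : HasDerivAt (fun t => (h (c t)).re) (deriv h (c t) * deriv c t).re t :=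
      Complex.reCLM.hasFDerivAt.comp_hasDerivAt t (hd t ht)
    have h2 : HasDerivAt (fun t => (h (c t)).re) 0 t :=
      (hasDerivAt_const t κ).congr_of_eventuallyEq (by
        filter_upwards [isOpen_Ioo.mem_nhds ht] with s hs using hre s hs)
    exact h1.unique h2
  have habs : ∀ t ∈ Ioo (0 : ℝ) 1, |φ' t| = ‖gradient u (c t)‖ * ‖deriv c t‖ := fun t ht => by
    rw [hgrad _ (hmem t ht), ← norm_mul]
    exact Complex.abs_im_eq_norm.2 (hre0 t ht)
  have hpos : ∀ t ∈ Ioo (0 : ℝ) 1, 0 < ‖gradient u (c t)‖ * ‖deriv c t‖ := fun t ht =>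
    mul_pos (norm_pos_iff.2 (hne _ (hmem t ht))) (norm_pos_iff.2 (hc' t ht))
  have hφc : ContinuousOn φ' (Ioo 0 1) := by
    refine Complex.continuous_im.comp_continuousOn (ContinuousOn.mul ?_ ?_)
    · exact (hh.deriv hG).continuousOn.comp hc.continuousOn hmem
    · exact hc.continuousOn_deriv_of_isOpen isOpen_Ioo le_rfl
  -- The derivative of `Im h` along the curve has constant sign.
  obtain ⟨ε, hε, hsign⟩ : ∃ ε : ℝ, |ε| = 1 ∧ ∀ t ∈ Ioo (0 : ℝ) 1, |φ' t| = ε * φ' t := by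
    by_cases hall : ∀ t ∈ Ioo (0 : ℝ) 1, 0 < φ' t
    · exact ⟨1, by simp, fun t ht => by rw [abs_of_pos (hall t ht), one_mul]⟩
    · push Not at hall
      obtain ⟨s, hs, hs0⟩ := hall
      refine ⟨-1, by simp, fun t ht => ?_⟩
      rw [neg_one_mul]
      refine abs_of_nonpos ?_
      by_contra! ht0
      obtain ⟨w, hw, hw0⟩ := isPreconnected_Ioo.intermediate_value hs ht hφc ⟨hs0, ht0.le⟩
      have := hpos w hw
      rw [← habs w hw, hw0, abs_zero] at this
      exact lt_irrefl _ this
  have hψ : ∀ t ∈ Ioo (0 : ℝ) 1, HasDerivAt (fun t => ε * (h (c t)).im)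
      (‖gradient u (c t)‖ * ‖deriv c t‖) t := fun t ht => by
    rw [← habs t ht, hsign t ht]
    exact (him t ht).const_mul ε
  have hψA := hA.const_mul ε
  have hψB := hB.const_mul ε
  have hψc : ContinuousOn (fun t => ε * (h (c t)).im) (Ioo 0 1) := fun t ht =>
    (hψ t ht).continuousAt.continuousWithinAt
  have hint : IntervalIntegrable (fun t => ‖gradient u (c t)‖ * ‖deriv c t‖)
      MeasureTheory.volume 0 1 := by
    rw [intervalIntegrable_iff_integrableOn_Ioc_of_le zero_le_one]
    refine intervalIntegral.integrableOn_deriv_of_nonneg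
      (continuousOn_Icc_extendFrom_Ioo hψc hψA hψB) (fun t ht => ?_)
      fun t ht => (hpos t ht).le
    refine (hψ t ht).congr_of_eventuallyEq ?_
    filter_upwards [isOpen_Ioo.mem_nhds ht] with s hs
    exact extendFrom_eq (subset_closure hs) (hψc s hs)
  have hval : gradIntegral u c = ε * B - ε * A :=
    intervalIntegral.integral_eq_sub_of_hasDerivAt_of_tendsto zero_lt_one hψ hint hψA hψB
  have hpos' : 0 < gradIntegral u c :=
    intervalIntegral.intervalIntegral_pos_of_pos_on hint hpos zero_lt_one
  refine ⟨?_, hpos'⟩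
  rw [← abs_of_pos hpos', hval, ← mul_sub, abs_mul, hε, one_mul]

/-! ### Boundary values of the conjugate potential -/

section Boundary

variable {m : ℕ} {E : Fin (m + 1) → Set ℂ} {D : Set ℂ} {u : ℂ → ℝ} {C : Cuts E D u}
  (B : OrientedBoundary C)

theorem OrientedBoundary.mem_side_or_mem_arc {θ : ℝ}
    (hθ : θ ∈ Ico (B.a 0) (B.a 0 + 2 * Real.pi)) :
    (∃ n, θ ∈ Icc (B.a n) (B.b n)) ∨ (∃ n : Fin B.N, θ ∈ Ioo (B.b n.castSucc) (B.a n.succ)) ∨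
      θ ∈ Ioo (B.b (Fin.last B.N)) (B.a 0 + 2 * Real.pi) := by
  have key : ∀ n : Fin (B.N + 1), θ < B.a n → (∃ n, θ ∈ Icc (B.a n) (B.b n)) ∨
      (∃ n : Fin B.N, θ ∈ Ioo (B.b n.castSucc) (B.a n.succ)) := by
    intro n
    induction n using Fin.induction with
    | zero => exact fun h => absurd hθ.1 (not_le.2 h)
    | succ n ih =>
      intro h
      rcases lt_or_ge θ (B.a n.castSucc) with h1 | h1
      · exact ih h1
      · rcases le_or_gt θ (B.b n.castSucc) with h2 | h2
        · exact Or.inl ⟨_, h1, h2⟩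
        · exact Or.inr ⟨n, h2, h⟩
  rcases lt_or_ge θ (B.a (Fin.last B.N)) with h1 | h1
  · exact (key _ h1).imp id Or.inl
  · rcases le_or_gt θ (B.b (Fin.last B.N)) with h2 | h2
    · exact Or.inl ⟨_, h1, h2⟩
    · exact Or.inr (Or.inr ⟨h2, hθ.2⟩)

theorem OrientedBoundary.exists_isGradientLine (n : Fin (B.N + 1)) :
    ∃ γ, IsGradientLine u D γ ∧ Traverses (fun θ => B.Φ (circleMap 0 1 θ)) (B.a n) (B.b n) γ := by
  by_cases h0 : n = 0
  · subst h0; exact ⟨_, C.isGradientLine₀.reverse, B.side_first⟩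
  by_cases hN : n = Fin.last B.N
  · subst hN; exact ⟨_, C.isGradientLine₀, B.side_last⟩
  obtain ⟨k, hk | hk⟩ := B.side n h0 hN
  · exact ⟨_, C.isGradientLine k, hk⟩
  · exact ⟨_, (C.isGradientLine k).reverse, hk⟩

theorem OrientedBoundary.inner_mem (n : Fin B.N) {t : ℝ}
    (ht : t ∈ Icc (B.b n.castSucc) (B.a n.succ)) : B.Φ (expI t) ∈ frontier (E (B.j n)) := by
  rw [← circleMap_eq_expI]; exact B.inner n t ht

theorem OrientedBoundary.outer_mem {t : ℝ}
    (ht : t ∈ Icc (B.b (Fin.last B.N)) (B.a 0 + 2 * Real.pi)) : B.Φ (expI t) ∈ frontier (E 0) := by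
  rw [← circleMap_eq_expI]; exact B.outer t ht

theorem expI_add_two_pi (t : ℝ) : expI ((t + 2 * Real.pi : ℝ) : ℂ) = expI t := by
  have := Complex.exp_periodic (t * Complex.I)
  rw [expI, expI, ← this]
  congr 1; push_cast; ring

variable {B} in
/-- The potential is constant on a one-sided neighbourhood of each end point of a side: to the right of
its final point `b n` and to the left of its initial point `a n`. -/
theorem OrientedBoundary.exists_const_near_corner (hu : IsPotential E D u) (n : Fin (B.N + 1)) :
    (∃ r > 0, ∃ c, ∀ t ∈ Ioo (B.b n) (B.b n + r), u (B.Φ (expI t)) = c) ∧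
      ∃ r > 0, ∃ c, ∀ t ∈ Ioo (B.a n - r) (B.a n), u (B.Φ (expI t)) = c := by
  have hin : ∀ (n : Fin B.N) (t : ℝ), t ∈ Icc (B.b n.castSucc) (B.a n.succ) →
      u (B.Φ (expI t)) = 1 := fun n t ht => hu.eq_one _ (B.inner_ne n) _ (B.inner_mem n ht)
  constructor
  · refine Fin.lastCases ?_ (fun n => ?_) n
    · refine ⟨B.a 0 + 2 * Real.pi - B.b (Fin.last B.N), sub_pos.2 B.b_last, 0, fun t ht => ?_⟩
      exact hu.eq_zero _ (B.outer_mem ⟨ht.1.le, by linarith [ht.2]⟩)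
    · refine ⟨B.a n.succ - B.b n.castSucc, sub_pos.2 (B.b_lt_a n), 1, fun t ht => ?_⟩
      exact hin n t ⟨ht.1.le, by linarith [ht.2]⟩
  · refine Fin.cases ?_ (fun n => ?_) n
    · refine ⟨B.a 0 + 2 * Real.pi - B.b (Fin.last B.N), sub_pos.2 B.b_last, 0, fun t ht => ?_⟩
      rw [← expI_add_two_pi]
      exact hu.eq_zero _ (B.outer_mem ⟨by linarith [ht.1], by linarith [ht.2]⟩)
    · refine ⟨B.a n.succ - B.b n.castSucc, sub_pos.2 (B.b_lt_a n), 1, fun t ht => ?_⟩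
      exact hin n t ⟨by linarith [ht.1], ht.2.le⟩

theorem OrientedBoundary.continuousOn_comp (hu : IsPotential E D u) :
    ContinuousOn (fun ζ => u (B.Φ ζ)) (closedBall 0 1) :=
  hu.continuousOn.comp B.continuousOn fun _ hζ =>
    closure_mono C.domain_subset (B.mapsTo_closure hζ)

/-- The boundary behaviour of the conjugate potential: if `u = Re f` on the cut domain, then
`V = Im (f ∘ Φ)` extends continuously to the closed disc, is constant on each side of a cut, and does
not decrease along the segments of the inner boundary curves. -/
theorem OrientedBoundary.exists_conjugate_boundary_values (hD : IsMultiplyConnectedDomain E D)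
    (hu : IsPotential E D u) {f : ℂ → ℂ} (hf : DifferentiableOn ℂ f C.domain)
    (hfu : ∀ z ∈ C.domain, (f z).re = u z) :
    ∃ (V : ℂ → ℝ) (κ : Fin (B.N + 1) → ℝ), ContinuousOn V (closedBall 0 1) ∧
      (∀ ζ ∈ ball (0 : ℂ) 1, V ζ = (f (B.Φ ζ)).im) ∧
      (∀ n, ∀ t ∈ Icc (B.a n) (B.b n), V (expI t) = κ n) ∧
      ∀ n : Fin B.N, κ n.castSucc ≤ κ n.succ := by
  let F : ℂ → ℂ := fun ζ => f (B.Φ ζ)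
  have hFd : DifferentiableOn ℂ F (ball 0 1) := hf.comp B.holomorphic B.mapsTo
  have hFu : ∀ ζ ∈ ball (0 : ℂ) 1, (F ζ).re = u (B.Φ ζ) := fun ζ hζ => hfu _ (B.mapsTo hζ)
  let h : ℂ → ℂ := fun z => F (expI z)
  have hh : DifferentiableOn ℂ h UHP :=
    hFd.comp differentiable_expI.differentiableOn fun z hz => expI_mem_ball hz
  have huc := B.continuousOn_comp hu
  have hre : ∀ t : ℝ, Tendsto (fun z => (h z).re) (𝓝[UHP] (t : ℂ)) (𝓝 (u (B.Φ (expI t)))) := by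
    intro t
    have h1 := ((huc _ (expI_ofReal_mem_closedBall t)).tendsto.mono_left
      (nhdsWithin_mono _ ball_subset_closedBall)).comp (tendsto_expI t)
    refine h1.congr' ?_
    filter_upwards [self_mem_nhdsWithin] with z hz using (hFu _ (expI_mem_ball hz)).symm
  obtain ⟨M, hM⟩ : ∃ M, ∀ z ∈ UHP, |(h z).re| ≤ M := by
    obtain ⟨M, hM⟩ := (isCompact_closedBall (0 : ℂ) 1).exists_bound_of_continuousOn huc
    refine ⟨M, fun z hz => ?_⟩
    have hz' := expI_mem_ball hz
    simp only [h]
    rw [hFu _ hz']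
    exact hM _ (ball_subset_closedBall hz')
  -- The conjugate function is constant on each open side.
  have hside : ∀ n, ∃ κ, ∀ t ∈ Ioo (B.a n) (B.b n),
      Tendsto (fun z => (h z).im) (𝓝[UHP] (t : ℂ)) (𝓝 κ) := fun n => by
    obtain ⟨γ, hγ, htr⟩ := B.exists_isGradientLine n
    exact exists_tendsto_const_of_locally_const isOpen_Ioo isPreconnected_Ioo fun x hx =>
      locally_const_on_side hD.isOpen hu.harmonic B.holomorphic B.continuousOn hFd hFu hγ htr hx
  choose κ hκ using hside
  -- Boundary values exist at interior points of the sides and of the boundary curves.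
  have hlim_im : ∀ (x y c t : ℝ), t ∈ Ioo x y →
      (∀ s ∈ Ioo x y, Tendsto (fun z => (h z).im) (𝓝[UHP] (s : ℂ)) (𝓝 c)) →
      ∃ ℓ, Tendsto h (𝓝[UHP] (t : ℂ)) (𝓝 ℓ) := by
    intro x y c t ht hc
    have hΩ : Complex.re ⁻¹' Ioo x y ∈ 𝓝 (t : ℂ) :=
      Complex.continuous_re.continuousAt.preimage_mem_nhds (Ioo_mem_nhds ht.1 ht.2)
    obtain ⟨ℓ, hℓ⟩ := exists_tendsto_of_im_tendsto_zero (f := fun z => h z - c * Complex.I) hΩ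
      ((hh.mono inter_subset_left).sub_const _) (fun s hs => by
        have := (hc s hs).sub_const c
        rw [sub_self] at this
        simpa using this)
    exact ⟨_, by simpa using hℓ.add_const (c * Complex.I)⟩
  have hlim_re : ∀ (x y c t : ℝ), t ∈ Ioo x y → (∀ s ∈ Ioo x y, u (B.Φ (expI s)) = c) →
      ∃ ℓ, Tendsto h (𝓝[UHP] (t : ℂ)) (𝓝 ℓ) := by
    intro x y c t ht hc
    have hΩ : Complex.re ⁻¹' Ioo x y ∈ 𝓝 (t : ℂ) :=
      Complex.continuous_re.continuousAt.preimage_mem_nhds (Ioo_mem_nhds ht.1 ht.2)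
    obtain ⟨ℓ, hℓ⟩ := exists_tendsto_of_im_tendsto_zero (f := fun z => Complex.I * (h z - c)) hΩ
      (((hh.mono inter_subset_left).sub_const _).const_mul _) (fun s hs => by
        have := (hre s).sub_const c
        rw [hc s hs, sub_self] at this
        simpa using this)
    refine ⟨_, ((hℓ.const_mul (-Complex.I)).add_const (c : ℂ)).congr fun z => ?_⟩
    linear_combination (c - h z) * Complex.I_sq
  have hlim : ∀ θ ∈ Ico (B.a 0) (B.a 0 + 2 * Real.pi), ∃ ℓ, Tendsto h (𝓝[UHP] (θ : ℂ)) (𝓝 ℓ) := by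
    intro θ hθ
    rcases B.mem_side_or_mem_arc hθ with ⟨n, hn⟩ | ⟨n, hn⟩ | hn
    · rcases hn.1.eq_or_lt with h1 | h1
      · subst h1
        obtain ⟨-, r, hr, c, hc⟩ := B.exists_const_near_corner hu n
        have hab := B.a_lt_b n
        set r' := min r (B.b n - B.a n) with hr'
        have hr0 : 0 < r' := lt_min hr (sub_pos.2 hab)
        have hr1 : r' ≤ r := min_le_left _ _
        have hr2 : r' ≤ B.b n - B.a n := min_le_right _ _
        refine exists_tendsto_of_re_left_of_im_right (a := c) (b := κ n) hr0 (hh.mono inter_subset_left)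
          (fun z hz => hM z hz.1) (fun t ht => ?_) fun t ht =>
          hκ n t ⟨ht.1, by linarith [ht.2]⟩
        rw [← hc t ⟨by linarith [ht.1], ht.2⟩]
        exact hre t
      · rcases hn.2.eq_or_lt with h2 | h2
        · subst h2
          obtain ⟨⟨r, hr, c, hc⟩, -⟩ := B.exists_const_near_corner hu n
          set r' := min r (B.b n - B.a n) with hr'
          have hr0 : 0 < r' := lt_min hr (sub_pos.2 h1)
          have hr1 : r' ≤ r := min_le_left _ _
          have hr2 : r' ≤ B.b n - B.a n := min_le_right _ _
          refine exists_tendsto_of_im_left_of_re_right (a := κ n) (b := c) hr0 (hh.mono inter_subset_left)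
            (fun z hz => hM z hz.1) (fun t ht => hκ n t ⟨by linarith [ht.1], ht.2⟩) fun t ht => ?_
          rw [← hc t ⟨ht.1, by linarith [ht.2]⟩]
          exact hre t
        · exact hlim_im _ _ _ θ ⟨h1, h2⟩ (hκ n)
    · exact hlim_re _ _ 1 θ hn fun s hs =>
        hu.eq_one _ (B.inner_ne n) _ (B.inner_mem n (Ioo_subset_Icc_self hs))
    · exact hlim_re _ _ 0 θ hn fun s hs => hu.eq_zero _ (B.outer_mem (Ioo_subset_Icc_self hs))
  have hFlim : ∀ ζ ∈ closedBall (0 : ℂ) 1, ∃ ℓ, Tendsto F (𝓝[ball 0 1] ζ) (𝓝 ℓ) := by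
    intro ζ hζ
    by_cases hζb : ζ ∈ ball (0 : ℂ) 1
    · exact ⟨F ζ, (hFd ζ hζb).continuousWithinAt⟩
    · obtain ⟨θ, hθ, rfl⟩ := exists_expI_eq hζ hζb (B.a 0)
      exact (hlim θ hθ).imp fun ℓ hℓ => tendsto_ball_of_tendsto_expI hℓ
  let Fx := extendFrom (ball (0 : ℂ) 1) F
  have hFx : ContinuousOn Fx (closedBall 0 1) :=
    continuousOn_extendFrom (by rw [closure_ball (0 : ℂ) one_ne_zero]) hFlim
  have hFxF : ∀ ζ ∈ ball (0 : ℂ) 1, Fx ζ = F ζ := fun ζ hζ =>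
    extendFrom_eq (subset_closure hζ) (hFd ζ hζ).continuousWithinAt
  let V : ℂ → ℝ := fun ζ => (Fx ζ).im
  have hVc : ContinuousOn V (closedBall 0 1) := Complex.continuous_im.comp_continuousOn hFx
  have hVt : ∀ t : ℝ, Tendsto (fun z => (h z).im) (𝓝[UHP] (t : ℂ)) (𝓝 (V (expI t))) := by
    intro t
    have h1 := ((hVc _ (expI_ofReal_mem_closedBall t)).tendsto.mono_left
      (nhdsWithin_mono _ ball_subset_closedBall)).comp (tendsto_expI t)
    refine h1.congr' ?_
    filter_upwards [self_mem_nhdsWithin] with z hz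
    simp only [Function.comp, V, hFxF _ (expI_mem_ball hz), h]
  have hVe : Continuous fun t : ℝ => V (expI t) :=
    hVc.comp_continuous (continuous_expI.comp Complex.continuous_ofReal) expI_ofReal_mem_closedBall
  have hVside : ∀ n, ∀ t ∈ Icc (B.a n) (B.b n), V (expI t) = κ n := by
    intro n t ht
    have h1 : Ioo (B.a n) (B.b n) ⊆ {t : ℝ | V (expI t) = κ n} := fun t ht =>
      tendsto_nhds_unique (hVt t) (hκ n t ht)
    have h2 := closure_minimal h1 (isClosed_eq hVe continuous_const)
    rw [closure_Ioo (B.a_lt_b n).ne] at h2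
    exact h2 ht
  refine ⟨V, κ, hVc, fun ζ hζ => by simp only [V, hFxF ζ hζ, F], hVside, fun n => ?_⟩
  -- On the inner boundary curves the potential attains its maximum.
  have hle : ∀ z ∈ UHP, (h z).re ≤ 1 := fun z hz => by
    have hp := B.mapsTo (expI_mem_ball hz)
    simp only [h]
    rw [hFu _ (expI_mem_ball hz)]
    have hmem := B.inner_mem n (left_mem_Icc.2 (B.b_lt_a n).le)
    exact hu.le_one hD (closure_mono C.domain_subset
      (B.mapsTo_closure (expI_ofReal_mem_closedBall (B.b n.castSucc))))
      (hD.notMem_of_mem_frontier hmem) (subset_closure hp.1)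
  have hder : ∀ t ∈ Ioo (B.b n.castSucc) (B.a n.succ),
      ∃ d, 0 ≤ d ∧ HasDerivAt (fun t : ℝ => V (expI t)) d t := by
    intro t ht
    obtain ⟨r, hr, hrsub⟩ := Metric.mem_nhds_iff.1 (Ioo_mem_nhds ht.1 ht.2)
    refine exists_hasDerivAt_nonneg_of_re_max hr (hh.mono inter_subset_left) (c := 1)
      (fun s hs => ?_) (fun z hz => hle z hz.1) fun s _ => hVt s
    have := hre s
    rwa [hu.eq_one _ (B.inner_ne n) _ (B.inner_mem n (Ioo_subset_Icc_self (hrsub hs)))] at this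
  have hmono : MonotoneOn (fun t : ℝ => V (expI t)) (Icc (B.b n.castSucc) (B.a n.succ)) := by
    refine monotoneOn_of_deriv_nonneg (convex_Icc _ _) hVe.continuousOn (fun t ht => ?_)
      fun t ht => ?_
    · rw [interior_Icc] at ht
      obtain ⟨d, -, hd⟩ := hder t ht
      exact hd.differentiableAt.differentiableWithinAt
    · rw [interior_Icc] at ht
      obtain ⟨d, hd0, hd⟩ := hder t ht
      rwa [hd.deriv]
  have hba := B.b_lt_a n
  have := hmono (left_mem_Icc.2 hba.le) (right_mem_Icc.2 hba.le) hba.le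
  simp only at this
  rwa [hVside _ _ (right_mem_Icc.2 (B.a_lt_b _).le), hVside _ _ (left_mem_Icc.2 (B.a_lt_b _).le)]
    at this

/-- The boundary values of the conjugate of `u₂` are locally constant on each boundary arc of the disc
that is mapped into the boundary curves of `D`. -/
theorem OrientedBoundary.locally_const_of_neumann (hD : IsMultiplyConnectedDomain E D) {d : ℝ}
    {jump : Fin B.N → ℝ} {u₂ : ℂ → ℝ} (hu₂ : IsConjugateSolution B d jump u₂) {f : ℂ → ℂ}
    (hf : DifferentiableOn ℂ f C.domain) (hfu : ∀ z ∈ C.domain, (f z).re = u₂ z) {I : Set ℝ}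
    (hI : IsOpen I) (hIE : ∀ t ∈ I, ∃ j, B.Φ (expI t) ∈ frontier (E j))
    (hinj : InjOn (fun t : ℝ => B.Φ (expI t)) I) :
    ∀ x ∈ I, ∃ κ, ∀ᶠ t : ℝ in 𝓝 x,
      Tendsto (fun z => (f (B.Φ (expI z))).im) (𝓝[UHP] (t : ℂ)) (𝓝 κ) := by
  obtain ⟨S, hS, hreg⟩ := hD.regular
  obtain ⟨T, hT, hneu⟩ := hu₂.neumann
  obtain ⟨U, hUc, hU, -⟩ := hu₂.dirichlet
  obtain ⟨M, hM⟩ := (isCompact_closedBall (0 : ℂ) 1).exists_bound_of_continuousOn hUc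
  have hfin : (S ∪ T ∪ C.endPoints).Finite := (hS.union hT).union C.finite_endPoints
  have hBfin : (I ∩ (fun t : ℝ => B.Φ (expI t)) ⁻¹' (S ∪ T ∪ C.endPoints)).Finite := by
    refine Set.Finite.of_finite_image (hfin.subset ?_) (hinj.mono inter_subset_left)
    rintro _ ⟨t, ht, rfl⟩
    exact ht.2
  have hd : DifferentiableOn ℂ (fun z => f (B.Φ (expI z))) UHP :=
    (hf.comp B.holomorphic B.mapsTo).comp differentiable_expI.differentiableOn
      fun z hz => expI_mem_ball hz
  refine locally_const_of_finite_exceptions hd (M := M) (fun z hz => ?_) hI hBfin fun x hx => ?_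
  · have hz' := expI_mem_ball hz
    rw [hfu _ (B.mapsTo hz'), ← hU _ hz']
    exact hM _ (ball_subset_closedBall hz')
  · refine B.locally_const_on_regular_arc hD.isOpen hf hfu hS hT hreg hneu
      (fun h => hx.2 ⟨hx.1, h⟩) ?_
    filter_upwards [hI.mem_nhds hx.1] with t ht
    obtain ⟨j, hj⟩ := hIE t ht
    exact hD.notMem_of_mem_frontier hj

end Boundary

theorem proposition1 {m : ℕ} (E : Fin (m + 1) → Set ℂ) (D : Set ℂ)
    (hD : IsMultiplyConnectedDomain E D)
    (u₁ : ℂ → ℝ) (hu₁ : IsPotential E D u₁)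
    (C : Cuts E D u₁) (B : OrientedBoundary C)
    (Γ₀ : ℝ → ℂ) (hΓ₀ : B.Joins 0 (Fin.last B.N) Γ₀)
    (Γ : Fin B.N → ℝ → ℂ) (hΓ : ∀ i : Fin B.N, B.Joins i.castSucc i.succ (Γ i))
    (u₂ : ℂ → ℝ)
    (hu₂ : IsConjugateSolution B (gradIntegral u₁ Γ₀) (fun i => gradIntegral u₁ (Γ i)) u₂)
    (η : ℝ → ℂ) (hη : C.IsCrossing u₂ η) :
    gradIntegral u₁ Γ₀ * gradIntegral u₂ η = 1 := by
  have hG : IsOpen C.domain := C.isOpen_domain hD.isOpen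
  obtain ⟨f₁, hf₁, hf₁u⟩ := exists_differentiableOn_re_eq B.holomorphic B.injOn B.image
    fun z hz => hu₁.harmonic z (C.domain_subset hz)
  obtain ⟨f₂, hf₂, hf₂u⟩ := exists_differentiableOn_re_eq B.holomorphic B.injOn B.image
    hu₂.harmonic
  obtain ⟨V, κ, hVc, hVf, hVκ, hκle⟩ := B.exists_conjugate_boundary_values hD hu₁ hf₁ hf₁u
  have hgrad₁ : ∀ z ∈ C.domain, gradient u₁ z = conj (deriv f₁ z) := fun z hz =>
    gradient_eq_conj_deriv (hf₁.differentiableAt (hG.mem_nhds hz)) (by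
      filter_upwards [hG.mem_nhds hz] with w hw using (hf₁u w hw).symm)
  -- The integral over a level line between two sides is the difference of the conjugate potential.
  have hjoin : ∀ (n n' : Fin (B.N + 1)) (c : ℝ → ℂ), B.Joins n n' c →
      gradIntegral u₁ c = |κ n' - κ n| ∧ 0 < gradIntegral u₁ c := by
    rintro n n' c ⟨⟨hmem, hc, hc', lev, hlev⟩, g, hg, hgb, hcg, ⟨θ, hθ, hgθ⟩, ⟨θ', hθ', hgθ'⟩⟩
    rw [circleMap_eq_expI] at hgθ hgθ'
    have hVg : ∀ t ∈ Ioo (0 : ℝ) 1, V (g t) = (f₁ (c t)).im := fun t ht => by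
      rw [hVf _ (hgb t ht), hcg t (Ioo_subset_Icc_self ht)]
    have hgmem : MapsTo g (Icc 0 1) (closedBall 0 1) := fun t ht => by
      rcases ht.1.eq_or_lt with h | h
      · rw [← h, hgθ]; exact expI_ofReal_mem_closedBall θ
      · rcases ht.2.eq_or_lt with h' | h'
        · rw [h', hgθ']; exact expI_ofReal_mem_closedBall θ'
        · exact ball_subset_closedBall (hgb t ⟨h, h'⟩)
    have hVgc : ContinuousOn (fun t => V (g t)) (Icc 0 1) := hVc.comp hg hgmem
    refine gradIntegral_eq_abs_sub hG hf₁ (fun z hz => by rw [hgrad₁ z hz, Complex.norm_conj])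
      (fun z hz => C.gradient_ne_zero hz) hmem hc hc' (κ := lev)
      (fun t ht => by rw [hf₁u _ (hmem t ht), hlev t ht]) ?_ ?_
    · have h1 := (hVgc 0 (by simp)).tendsto.mono_left (nhdsWithin_mono _ Ioo_subset_Icc_self)
      rw [hgθ, hVκ n θ (Ioo_subset_Icc_self hθ), nhdsWithin_Ioo_eq_nhdsGT zero_lt_one] at h1
      refine h1.congr' ?_
      filter_upwards [Ioo_mem_nhdsGT (zero_lt_one' ℝ)] with t ht using hVg t ht
    · have h1 := (hVgc 1 (by simp)).tendsto.mono_left (nhdsWithin_mono _ Ioo_subset_Icc_self)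
      rw [hgθ', hVκ n' θ' (Ioo_subset_Icc_self hθ'), nhdsWithin_Ioo_eq_nhdsLT zero_lt_one] at h1
      refine h1.congr' ?_
      filter_upwards [Ioo_mem_nhdsLT (zero_lt_one' ℝ)] with t ht using hVg t ht
  have hκmono : Monotone κ := Fin.monotone_iff_le_succ.2 hκle
  set d := gradIntegral u₁ Γ₀ with hd
  have hd0 : 0 < d := (hjoin _ _ _ hΓ₀).2
  have hdκ : d = κ (Fin.last B.N) - κ 0 := by
    rw [hd, (hjoin _ _ _ hΓ₀).1, abs_of_nonneg (sub_nonneg.2 (hκmono (Fin.zero_le _)))]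
  have hjump : ∀ i : Fin B.N, gradIntegral u₁ (Γ i) = κ i.succ - κ i.castSucc := fun i => by
    rw [(hjoin _ _ _ (hΓ i)).1, abs_of_nonneg (sub_nonneg.2 (hκle i))]
  have hsum : ∀ n : Fin (B.N + 1),
      ∑ i : Fin B.N with i.castSucc < n, gradIntegral u₁ (Γ i) = κ n - κ 0 := by
    intro n
    induction n using Fin.induction with
    | zero => simp
    | succ n ih =>
      have h1 : (Finset.univ.filter fun i : Fin B.N => i.castSucc < n.succ) =
          insert n (Finset.univ.filter fun i : Fin B.N => i.castSucc < n.castSucc) := by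
        ext i
        simp only [Finset.mem_filter, Finset.mem_univ, true_and, Finset.mem_insert,
          Fin.castSucc_lt_succ_iff, Fin.castSucc_lt_castSucc_iff]
        exact le_iff_eq_or_lt
      rw [h1, Finset.sum_insert (by simp), ih, hjump]
      ring
  -- By uniqueness, `d * u₂` is the conjugate potential, normalized to vanish on the first side.
  have hident : ∀ z ∈ C.domain, d * u₂ z = (f₁ z).im - κ 0 := by
    obtain ⟨U, hUc, hUu, hU0, hUN, hUn⟩ := hu₂.dirichlet
    simp only [circleMap_eq_expI] at hU0 hUN hUn
    have hW := eq_zero_of_mixed_boundary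
      (h := fun ζ => d * f₂ (B.Φ ζ) + Complex.I * f₁ (B.Φ ζ) + κ 0)
      (W := fun ζ => d * U ζ - (V ζ - κ 0)) (a := B.a 0)
      ((((hf₂.comp B.holomorphic B.mapsTo).const_mul _).add
        ((hf₁.comp B.holomorphic B.mapsTo).const_mul _)).add_const _)
      ((hUc.const_mul d).sub (hVc.sub continuousOn_const))
      (fun ζ hζ => by
        rw [hUu ζ hζ, hVf ζ hζ, ← hf₂u _ (B.mapsTo hζ)]
        simp; ring)
      (fun θ hθ => ?_)
      ⟨B.a 0, by
        rw [hU0 _ (left_mem_Icc.2 (B.a_lt_b 0).le), hVκ 0 _ (left_mem_Icc.2 (B.a_lt_b 0).le)]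
        ring⟩
    · intro z hz
      rw [← B.image] at hz
      obtain ⟨ζ, hζ, rfl⟩ := hz
      have := hW ζ (ball_subset_closedBall hζ)
      rw [hUu ζ hζ, hVf ζ hζ] at this
      linarith
    · -- On a boundary curve the imaginary part is `d * Im f₂ + u₁`, and `u₁` is constant there.
      have harc : ∀ (x y c : ℝ), θ ∈ Ioo x y →
          (∀ t ∈ Ioo x y, ∃ j, B.Φ (expI t) ∈ frontier (E j)) →
          (∀ t ∈ Ioo x y, u₁ (B.Φ (expI t)) = c) →
          InjOn (fun t : ℝ => B.Φ (expI t)) (Ioo x y) →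
          ∃ lim : ℝ, ∀ᶠ t : ℝ in 𝓝 θ, Tendsto (fun z => (d * f₂ (B.Φ (expI z)) +
            Complex.I * f₁ (B.Φ (expI z)) + κ 0).im) (𝓝[UHP] (t : ℂ)) (𝓝 lim) := by
        intro x y c hθxy hE huc hinj
        obtain ⟨μ, hμ⟩ := B.locally_const_of_neumann hD hu₂ hf₂ hf₂u isOpen_Ioo hE hinj θ hθxy
        refine ⟨d * μ + c, ?_⟩
        filter_upwards [hμ, Ioo_mem_nhds hθxy.1 hθxy.2] with t ht htxy
        have h1 := ((B.continuousOn_comp hu₁ _ (expI_ofReal_mem_closedBall t)).tendsto.mono_left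
          (nhdsWithin_mono _ ball_subset_closedBall)).comp (tendsto_expI t)
        rw [huc t htxy] at h1
        refine ((ht.const_mul d).add h1).congr' ?_
        filter_upwards [self_mem_nhdsWithin] with z hz
        simp only [Function.comp]
        rw [← hf₁u _ (B.mapsTo (expI_mem_ball hz))]
        simp
      have honce := B.once
      simp only [circleMap_eq_expI] at honce
      rcases B.mem_side_or_mem_arc hθ with ⟨n, hn⟩ | ⟨n, hn⟩ | hn
      · left
        rw [hVκ n θ hn]
        by_cases h0 : n = 0
        · subst h0; rw [hU0 θ hn]; ring
        by_cases hN : n = Fin.last B.N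
        · subst hN; rw [hUN θ hn, hdκ]; ring
        rw [hUn n h0 hN θ hn, hsum n, mul_div_cancel₀ _ hd0.ne', sub_self]
      · right
        exact harc _ _ 1 hn (fun t ht => ⟨_, B.inner_mem n (Ioo_subset_Icc_self ht)⟩)
          (fun t ht => hu₁.eq_one _ (B.inner_ne n) _ (B.inner_mem n (Ioo_subset_Icc_self ht)))
          (honce.mono fun t ht => Or.inl (mem_iUnion.2 ⟨n, ht⟩))
      · right
        exact harc _ _ 0 hn (fun t ht => ⟨_, B.outer_mem (Ioo_subset_Icc_self ht)⟩)
          (fun t ht => hu₁.eq_zero _ (B.outer_mem (Ioo_subset_Icc_self ht)))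
          (honce.mono fun t ht => Or.inr ht)
  -- Hence `u₂` is the real part of `-i f₁ / d`, up to a constant.
  let h : ℂ → ℂ := fun z => (d : ℂ)⁻¹ * (-Complex.I * f₁ z - κ 0)
  have hhd : DifferentiableOn ℂ h C.domain := ((hf₁.const_mul _).sub_const _).const_mul _
  have hhre : ∀ z ∈ C.domain, (h z).re = u₂ z := fun z hz => by
    have h1 : u₂ z = d⁻¹ * ((f₁ z).im - κ 0) := by
      rw [← hident z hz, inv_mul_cancel_left₀ hd0.ne']
    rw [h1]
    simp only [h, ← Complex.ofReal_inv, Complex.re_ofReal_mul]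
    simp
  have hhim : ∀ z ∈ C.domain, (h z).im = -(d⁻¹ * u₁ z) := fun z hz => by
    rw [← hf₁u z hz]
    simp only [h, ← Complex.ofReal_inv, Complex.im_ofReal_mul]
    simp
  have hgrad₂ : ∀ z ∈ C.domain, gradient u₂ z = conj (deriv h z) := fun z hz =>
    gradient_eq_conj_deriv (hhd.differentiableAt (hG.mem_nhds hz)) (by
      filter_upwards [hG.mem_nhds hz] with w hw using (hhre w hw).symm)
  have hderiv : ∀ z ∈ C.domain, deriv h z ≠ 0 := fun z hz h0 => by
    have h1 : deriv h z = (d : ℂ)⁻¹ * (-Complex.I * deriv f₁ z) :=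
      ((((hf₁.differentiableAt (hG.mem_nhds hz)).hasDerivAt.const_mul _).sub_const _).const_mul
        _).deriv
    rw [h1] at h0
    have h2 : deriv f₁ z = 0 := by simpa [hd0.ne'] using h0
    exact C.gradient_ne_zero hz (by rw [hgrad₁ z hz, h2, map_zero])
  obtain ⟨⟨hmem, hc, hc', lev, hlev⟩, ⟨p, hp, hpη⟩, ⟨j, hj, p', hp', hpη'⟩⟩ := hη
  have hlim : ∀ (l : Filter ℝ) (p : ℂ), l.NeBot → (∀ᶠ t in l, t ∈ Ioo (0 : ℝ) 1) →
      Tendsto η l (𝓝 p) → Tendsto (fun t => (h (η t)).im) l (𝓝 (-(d⁻¹ * u₁ p))) := by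
    intro l p hl hlI hlp
    have hηD : ∀ᶠ t in l, η t ∈ closure D := hlI.mono fun t ht =>
      subset_closure (C.domain_subset (hmem t ht))
    have hpD : p ∈ closure D := isClosed_closure.mem_of_tendsto hlp hηD
    have h1 := (hu₁.continuousOn p hpD).tendsto.comp (tendsto_nhdsWithin_iff.2 ⟨hlp, hηD⟩)
    refine ((h1.const_mul d⁻¹).neg).congr' ?_
    filter_upwards [hlI] with t ht using (hhim _ (hmem t ht)).symm
  have hA := hlim _ p inferInstance (Ioo_mem_nhdsGT zero_lt_one) hpη
  have hB := hlim _ p' inferInstance (Ioo_mem_nhdsLT zero_lt_one) hpη'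
  rw [hu₁.eq_zero p hp] at hA
  rw [hu₁.eq_one j hj p' hp'] at hB
  have hval := (gradIntegral_eq_abs_sub hG hhd
    (fun z hz => by rw [hgrad₂ z hz, Complex.norm_conj])
    (fun z hz => by rw [hgrad₂ z hz]; simpa using hderiv z hz) hmem hc hc'
    (fun t ht => by rw [hhre _ (hmem t ht), hlev t ht]) hA hB).1
  have habs : |-(d⁻¹ * 1) - -(d⁻¹ * 0)| = d⁻¹ := by
    rw [mul_one, mul_zero, neg_zero, sub_zero, abs_neg, abs_of_pos (inv_pos.2 hd0)]
  rw [hval, habs, mul_inv_cancel₀ hd0.ne']
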